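/- **Setting.** Let $d\ge 1$, $m,n\ge 0$ be integers, $\mathbb I=[-m-n..m+n]$, and call $i\in\mathbb I$ even ($\widehat i=0$) if $|i|\le m$ and odd ($\widehat i=1$) otherwise. Let $W$ be the group of permutations $w$ of $[-d..d]$ with $w(-x)=-w(x)$, with simple reflections $s_0=(-1,1)$, $s_i=(i,i+1)(-i,-i-1)$ $(1\le i<d)$ and length function $\ell$. Let $\mathcal H$ be its Hecke algebra over $\mathcal A=\mathbb Z[v,v^{-1}]$, $q=v^2$: the $\mathcal A$-algebra with basis $T_w$ $(w\in W)$, $T_wT_{w'}=T_{ww'}$ if $\ell(ww')=\ell(w)+\ell(w')$, and $(T_{s_i}+1)(T_{s_i}-q)=0$. Let $\Lambda(m|n,d)$ be the set of $\lambda=(\lambda_0,\dots,\lambda_{m+n})\in\mathbb N^{m+n+1}$ with sum $d$, and put $\tilde\lambda_i=\lambda_0+\dots+\lambda_i$. Let $R^\lambda_0=[-\lambda_0..\lambda_0]$, $R^\lambda_i=[\tilde\lambda_{i-1}+1..\tilde\lambda_i]$ and $R^\lambda_{-i}=-R^\lambda_i$ for $i\geq 1$. Let $W_\lambda\le W$ be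 generated by all simple reflections except $s_{\tilde\lambda_0},\dots,s_{\tilde\lambda_{m+n-1}}$, and let $W_{\lambda^{(0)}}$ (resp. $W_{\lambda^{(1)}}$) be generated by those of these generators $s_i$ with $i<\tilde\lambda_m$ (resp. $i>\tilde\lambda_m$); each $w\in W_\lambda$ is uniquely $w=w^{(0)}w^{(1)}$ with $w^{(i)}\in W_{\lambda^{(i)}}$. Put $$[\mathrm{xy}]_\lambda=\Big(\sum_{w\in W_{\lambda^{(0)}}}T_w\Big)\Big(\sum_{w\in W_{\lambda^{(1)}}}(-q)^{-\ell(w)}T_w\Big),\qquad \mathcal S=\mathrm{End}_{\mathcal H}\Big(\bigoplus_{\lambda\in\Lambda(m|n,d)}[\mathrm{xy}]_\lambda\mathcal H\Big),$$ the endomorphism algebra of a right $\mathcal H$-module, with composition as multiplication. Let $\mathcal D_{\lambda\mu}$ be the set of shortest representatives of the double cosets in $W_\lambda\backslash W/W_\mu$, and $\mathcal D^\circ_{\lambda\mu}$ the set of $g\in\mathcal D_{\lambda\mu}$ with $g^{-1}W_{\lambda^{(1)}}g\cap W_{\mu^{(0)}}=g^{-1}W_{\lambda^{(0)}}g\cap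 W_{\mu^{(1)}}=\{1\}$. Put $\kappa(\lambda,g,\mu)=(|R^\lambda_i\cap gR^\mu_j|)_{i,j\in\mathbb I}$. Let $\Xi_{m|n,d}$ be the set of $\mathbb I\times\mathbb I$ matrices $(a_{ij})$ over $\mathbb N$ with $\sum_{i,j} a_{ij}=2d+1$, $a_{ij}=a_{-i,-j}$, and $a_{ij}\in\{0,1\}$ if $\widehat i\ne\widehat j$; $\kappa$ is a bijection from the triples $(\lambda,g,\mu)$ with $g\in\mathcal D^\circ_{\lambda\mu}$ onto $\Xi_{m|n,d}$. For $A=\kappa(\mu,g,\nu)\in\Xi_{m|n,d}$ with $g\in\mathcal D^\circ_{\mu\nu}$, let $W_\delta=g^{-1}W_\mu g\cap W_\nu$, let $\mathcal D_\delta$ be the set of shortest representatives of the right cosets in $W_\delta\backslash W$, and let $e_A\in\mathcal S$ be the map with $$e_A([\mathrm{xy}]_\lambda h)=\delta_{\nu\lambda}\,[\mathrm{xy}]_\mu T_g\Big(\sum_{w=w^{(0)}w^{(1)}\in\mathcal D_\delta\cap W_\nu}(-q)^{-\ell(w^{(1)})}T_w\Big)h\qquad(\lambda\in\Lambda(m|n,d),\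 h\in\mathcal H).$$ Put $e_M=0$ for an integer matrix $M\notin\Xi_{m|n,d}$. Write $[a]_p=1+p+\dots+p^{a-1}$ and $[2a]_{\mathfrak c}=[a]_q(q^a+1)$. For $i\in\mathbb I$ put $(\mathbf q_i,\dot{\mathbf q}_i,\ddot{\mathbf q}_i)=(q,1,q)$ if $\widehat i=0$, and $(q^{-1},-q^{-1},-1)$ if $\widehat i=1$. Let $E^\theta_{ij}=E_{ij}+E_{-i,-j}$, where $E_{ij}$ is the matrix unit (so $E^\theta_{00}=2E_{00}$), and $A_{hk}=A+E^\theta_{hk}-E^\theta_{h+1,k}$, $\check A_{hk}=A-E^\theta_{hk}+E^\theta_{h+1,k}$. **Proposition 3.4.** Let $A=(a_{ij})=\kappa(\mu,g,\nu)$, $B=\kappa(\lambda,1,\mu)$, $C=\kappa(\lambda',1,\mu)$ be in $\Xi_{m|n,d}$, where $\lambda,\lambda',\mu,\nu\in\Lambda(m|n,d)$ and $g\in\mathcal D_{\mu\nu}$, and let $h\in[0..m+n-1]$. (1) Assume that $B-E^\theta_{h,h+1}$ is diagonal. If $h\neq0$, then $$e_Be_A=\sum_{k\in\mathbb I}\dot{\mathbf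 q}_{h+1}^{\sum_{j<k}a_{h+1,j}}\,\ddot{\mathbf q}_h^{\sum_{j>k}a_{hj}}\,[a_{hk}+1]_{\mathbf q_h}\,e_{A_{hk}};$$ if $h=0$, then $$e_Be_A=\dot{\mathbf q}_{1}^{\sum_{j<0}a_{1j}}\,\ddot{\mathbf q}_0^{\sum_{j>0}a_{0j}}\,[a_{00}+1]_{\mathfrak c}\,e_{A_{00}}+\sum_{k\neq0}\dot{\mathbf q}_{1}^{\sum_{j<k}a_{1j}}\,\ddot{\mathbf q}_0^{\sum_{j>k}a_{0j}}\,[a_{0k}+1]_{\mathbf q_0}\,e_{A_{0k}}.$$ (2) Assume that $C-E^\theta_{h+1,h}$ is diagonal. Then $$e_Ce_A=\sum_{k\in\mathbb I}\dot{\mathbf q}_{h}^{\sum_{j>k}a_{hj}}\,\ddot{\mathbf q}_{h+1}^{\sum_{j<k}a_{h+1,j}}\,[a_{h+1,k}+1]_{\mathbf q_{h+1}}\,e_{\check A_{hk}}.$$ -/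

import Mathlib

open scoped LaurentPolynomial DirectSum

namespace IotaSchur

/-! ### The Weyl group of type B as signed permutations -/

/-- The integral interval `[-N..N]`. -/
abbrev SymInt (N : ℕ) : Type := ↥(Set.Icc (-(N : ℤ)) (N : ℤ))

/-- The map `x ↦ -x` of `[-N..N]`. -/
def SymInt.opp {N : ℕ} (x : SymInt N) : SymInt N :=
  ⟨-x.1, by have h := x.2; simp only [Set.mem_Icc] at h ⊢; omega⟩

/-- The element `0` of `[-N..N]`. -/
def SymInt.origin (N : ℕ) : SymInt N := ⟨0, by simp⟩

/-- The permutations `w` of `[-d..d]` with `w (-x) = - w x`. -/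
def signedPerms (d : ℕ) : Subgroup (Equiv.Perm (SymInt d)) where
  carrier := {w | ∀ x, w x.opp = (w x).opp}
  mul_mem' := by
    intro a b ha hb x
    simp only [Set.mem_ofPred_eq] at ha hb
    simp [hb x, ha]
  one_mem' := by intro x; rfl
  inv_mem' := by
    intro a ha x
    simp only [Set.mem_ofPred_eq] at ha
    rw [Equiv.Perm.inv_eq_iff_eq, ha]
    simp

/-- The Weyl group `W` of type `B_d`. -/
abbrev Weyl (d : ℕ) : Type := ↥(signedPerms d)

noncomputable instance instFintypeWeyl (d : ℕ) : Fintype (Weyl d) := Fintype.ofFinite _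

/-- `s_0 = (-1, 1)` and `s_i = (i, i+1)(-i, -i-1)` for `1 ≤ i < d`, as permutations. -/
def simplePerm {d : ℕ} (i : Fin d) : Equiv.Perm (SymInt d) :=
  if i.1 = 0 then
    Equiv.swap ⟨-1, by have := i.2; simp only [Set.mem_Icc]; omega⟩
      ⟨1, by have := i.2; simp only [Set.mem_Icc]; omega⟩
  else
    Equiv.swap ⟨(i.1 : ℤ), by have := i.2; simp only [Set.mem_Icc]; omega⟩
        ⟨(i.1 : ℤ) + 1, by have := i.2; simp only [Set.mem_Icc]; omega⟩ *
      Equiv.swap ⟨-(i.1 : ℤ), by have := i.2; simp only [Set.mem_Icc]; omega⟩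
        ⟨-(i.1 : ℤ) - 1, by have := i.2; simp only [Set.mem_Icc]; omega⟩

theorem simplePerm_mem {d : ℕ} (i : Fin d) : simplePerm i ∈ signedPerms d := by
  intro x
  unfold simplePerm
  split_ifs with h
  · simp only [Equiv.swap_apply_def, SymInt.opp, Subtype.ext_iff]
    (split_ifs <;> simp_all); omega
  · simp only [Equiv.Perm.coe_mul, Function.comp_apply, Equiv.swap_apply_def, SymInt.opp,
      Subtype.ext_iff, apply_ite Subtype.val]
    split_ifs <;> omega

/-- The simple reflections `s_0, …, s_{d-1}` of `W`. -/
def simple {d : ℕ} (i : Fin d) : Weyl d := ⟨simplePerm i, simplePerm_mem i⟩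

/-- The length function of `W` with respect to `s_0, …, s_{d-1}`. -/
noncomputable def len {d : ℕ} (w : Weyl d) : ℕ :=
  sInf {k | ∃ l : List (Fin d), l.length = k ∧ (l.map simple).prod = w}

/-! ### Compositions with parity, parabolic subgroups, double cosets -/

/-- The index set `𝕀 = [-m-n..m+n]`. -/
abbrev Idx (m n : ℕ) : Type := SymInt (m + n)

/-- `i` has parity `1`, i.e. `m < |i|`. -/
def IsOddIdx {m n : ℕ} (i : Idx m n) : Prop := (m : ℤ) < |i.1|

/-- Weak compositions `(λ_0, …, λ_m | λ_{m+1}, …, λ_{m+n})` of `d`. -/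
abbrev Comp (m n d : ℕ) : Type := {c : Fin (m + n + 1) → ℕ // ∑ i, c i = d}

variable {m n d : ℕ}

/-- The partial sum `λ_0 + ⋯ + λ_k`. -/
def psum (c : Comp m n d) (k : ℕ) : ℕ := ∑ j with j.1 ≤ k, c.1 j

/-- The integral intervals `R_i^λ ⊆ [-d..d]`, `i ∈ 𝕀`. -/
def interval (c : Comp m n d) (i : Idx m n) : Set (SymInt d) :=
  {x | if i.1 = 0 then |x.1| ≤ (psum c 0 : ℤ)
       else if 0 < i.1 then
         (psum c (i.1 - 1).toNat : ℤ) < x.1 ∧ x.1 ≤ (psum c i.1.toNat : ℤ)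
       else (psum c (-i.1 - 1).toNat : ℤ) < -x.1 ∧ -x.1 ≤ (psum c (-i.1).toNat : ℤ)}

/-- The simple reflections that generate `W_λ`: all `s_i` except those with
`i = λ_0 + ⋯ + λ_k` for some `0 ≤ k ≤ m + n - 1`. -/
def allowed (c : Comp m n d) (i : Fin d) : Prop := ∀ k < m + n, i.1 ≠ psum c k

/-- The parabolic subgroup `W_λ`. -/
def parabolic (c : Comp m n d) : Subgroup (Weyl d) :=
  Subgroup.closure {w | ∃ i : Fin d, allowed c i ∧ w = simple i}

/-- The even part of `W_λ`; its generators act inside the `R_i^λ` with `i` even. -/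
def parabolicEven (c : Comp m n d) : Subgroup (Weyl d) :=
  Subgroup.closure {w | ∃ i : Fin d, allowed c i ∧ i.1 < psum c m ∧ w = simple i}

/-- The odd part of `W_λ`; its generators act inside the `R_i^λ` with `i` odd. -/
def parabolicOdd (c : Comp m n d) : Subgroup (Weyl d) :=
  Subgroup.closure {w | ∃ i : Fin d, allowed c i ∧ psum c m < i.1 ∧ w = simple i}

/-- `𝒟_{λμ}`: the shortest representatives of the double cosets in `W_λ \ W / W_μ`. -/
def doubleReps (a b : Comp m n d) : Set (Weyl d) :=
  {g | ∀ x ∈ parabolic a, ∀ y ∈ parabolic b, len g ≤ len (x * g * y)}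

/-- `g⁻¹ H g`. -/
def conjInv (g : Weyl d) (H : Subgroup (Weyl d)) : Subgroup (Weyl d) :=
  H.map (MulAut.conj g⁻¹).toMonoidHom

/-- `𝒟°_{λμ}`: the elements of `𝒟_{λμ}` with the even-odd trivial intersection property. -/
def superReps (a b : Comp m n d) : Set (Weyl d) :=
  {g | g ∈ doubleReps a b ∧
    conjInv g (parabolicOdd a) ⊓ parabolicEven b = ⊥ ∧
    conjInv g (parabolicEven a) ⊓ parabolicOdd b = ⊥}

/-- The matrix `κ(λ, g, μ) = (|R_i^λ ∩ g R_j^μ|)_{i,j ∈ 𝕀}`. -/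
noncomputable def kappa (a : Comp m n d) (g : Weyl d) (b : Comp m n d) :
    Matrix (Idx m n) (Idx m n) ℕ :=
  Matrix.of fun i j => (interval a i ∩ (fun x => g.1 x) '' interval b j).ncard

/-- The set `Ξ_{m|n,d}` of matrices. -/
def Xi (m n d : ℕ) : Set (Matrix (Idx m n) (Idx m n) ℕ) :=
  {A | (∑ i, ∑ j, A i j = 2 * d + 1) ∧ (∀ i j, A i j = A i.opp j.opp) ∧
    ∀ i j, ¬ (IsOddIdx i ↔ IsOddIdx j) → A i j = 0 ∨ A i j = 1}

/-- The group `W_δ = g⁻¹ W_λ g ∩ W_μ`, where `δ = δ(λ, g, μ)`. -/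
def deltaGroup (a : Comp m n d) (g : Weyl d) (b : Comp m n d) : Subgroup (Weyl d) :=
  conjInv g (parabolic a) ⊓ parabolic b

/-- `𝒟_δ`: the shortest representatives of the right cosets in `W_δ \ W`. -/
def deltaReps (a : Comp m n d) (g : Weyl d) (b : Comp m n d) : Set (Weyl d) :=
  {w | ∀ x ∈ deltaGroup a g b, len w ≤ len (x * w)}

/-! ### The Hecke algebra over `ℤ[v, v⁻¹]` -/

/-- `q = v²`. -/
noncomputable def q : ℤ[T;T⁻¹] := LaurentPolynomial.T 2

/-- `q⁻¹ = v⁻²`. -/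
noncomputable def qinv : ℤ[T;T⁻¹] := LaurentPolynomial.T (-2)

/-- The defining relations of the Hecke algebra on the generators `T_w`, `w ∈ W`. -/
inductive HeckeRel (d : ℕ) :
    FreeAlgebra ℤ[T;T⁻¹] (Weyl d) → FreeAlgebra ℤ[T;T⁻¹] (Weyl d) → Prop
  | one : HeckeRel d (FreeAlgebra.ι _ 1) 1
  | mul (w w' : Weyl d) (h : len (w * w') = len w + len w') :
      HeckeRel d (FreeAlgebra.ι _ w * FreeAlgebra.ι _ w') (FreeAlgebra.ι _ (w * w'))
  | quad (i : Fin d) :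
      HeckeRel d ((FreeAlgebra.ι _ (simple i) + 1) *
        (FreeAlgebra.ι _ (simple i) - algebraMap ℤ[T;T⁻¹] _ q)) 0

/-- The Hecke algebra `ℋ` of type `B_d` over `ℤ[v, v⁻¹]`, presented by the generators `T_w`
and their multiplication rules. -/
abbrev Hecke (d : ℕ) : Type := RingQuot (HeckeRel d)

/-- The element `T_w` of the Hecke algebra. -/
noncomputable def Tw (w : Weyl d) : Hecke d :=
  RingQuot.mkAlgHom ℤ[T;T⁻¹] (HeckeRel d) (FreeAlgebra.ι _ w)

open Classical in
/-- `x_{λ^{(0)}}`. -/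
noncomputable def xEven (c : Comp m n d) : Hecke d := ∑ w with w ∈ parabolicEven c, Tw w

open Classical in
/-- `y_{λ^{(1)}}`. -/
noncomputable def yOdd (c : Comp m n d) : Hecke d :=
  ∑ w with w ∈ parabolicOdd c, ((-qinv) ^ len w) • Tw w

/-- `[xy]_λ`. -/
noncomputable def xy (c : Comp m n d) : Hecke d := xEven c * yOdd c

/-! ### The Schur superalgebra and its basis -/

/-- The signed `q`-permutation module `[xy]_λ ℋ`, a right `ℋ`-module. -/
noncomputable def permModule (c : Comp m n d) : Submodule (Hecke d)ᵐᵒᵖ (Hecke d) :=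
  Submodule.span (Hecke d)ᵐᵒᵖ {xy c}

/-- The element `[xy]_λ h` of `[xy]_λ ℋ`. -/
noncomputable def xyMul (c : Comp m n d) (h : Hecke d) : permModule c :=
  ⟨xy c * h, by
    have := (permModule c).smul_mem (MulOpposite.op h) (Submodule.mem_span_singleton_self (xy c))
    simpa using this⟩

/-- The right `ℋ`-module `⨁_λ [xy]_λ ℋ`. -/
abbrev TotalModule (m n d : ℕ) : Type := ⨁ c : Comp m n d, permModule c

/-- The Schur superalgebra: the `ℋ`-linear endomorphisms of `⨁_λ [xy]_λ ℋ`, with composition. -/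
abbrev Schur (m n d : ℕ) : Type := Module.End (Hecke d)ᵐᵒᵖ (TotalModule m n d)

/-- The element `[xy]_λ h` of the summand of index `λ`. -/
noncomputable def inSummand (c : Comp m n d) (h : Hecke d) : TotalModule m n d :=
  DirectSum.lof (Hecke d)ᵐᵒᵖ (Comp m n d) (fun c => permModule c) c (xyMul c h)

open Classical in
/-- `T_{𝒟_δ ∩ W_ν} = ∑ (-q)^{-ℓ(w^{(1)})} T_w` over `w = w^{(0)} w^{(1)} ∈ 𝒟_δ ∩ W_ν`, where
`δ = δ(μ, g, ν)` and `w^{(0)}`, `w^{(1)}` are the even and odd parts of `w ∈ W_ν`. -/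
noncomputable def TReps (a : Comp m n d) (g : Weyl d) (b : Comp m n d) : Hecke d :=
  ∑ u with u ∈ parabolicEven b, ∑ w with w ∈ parabolicOdd b,
    if u * w ∈ deltaReps a g b then ((-qinv) ^ len w) • Tw (u * w) else 0

/-- The defining property of `φ_{μν}^g`: it maps `[xy]_λ h` to
`δ_{νλ} [xy]_μ T_g T_{𝒟_δ ∩ W_ν} h`. -/
def IsPhi (a : Comp m n d) (g : Weyl d) (b : Comp m n d) (f : Schur m n d) : Prop :=
  ∀ (c : Comp m n d) (h : Hecke d),
    f (inSummand c h) = if b = c then inSummand a (Tw g * TReps a g b * h) else 0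

open Classical in
/-- The map `φ_{μν}^g`: the right `ℋ`-linear map with the defining property. (It exists for
`g ∈ 𝒟°_{μν}`, and it is unique since the `[xy]_λ h` span.) -/
noncomputable def phi (a : Comp m n d) (g : Weyl d) (b : Comp m n d) : Schur m n d :=
  if h : ∃ f, IsPhi a g b f then h.choose else 0

open Classical in
/-- `e_A = φ_{μν}^g` for `A = κ(μ, g, ν) ∈ Ξ_{m|n,d}` with `g ∈ 𝒟°_{μν}` (each `A ∈ Ξ_{m|n,d}` is
of this form for exactly one triple); `e_A = 0` for `A ∉ Ξ_{m|n,d}`. -/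
noncomputable def e (A : Matrix (Idx m n) (Idx m n) ℕ) : Schur m n d :=
  if h : A ∈ Xi m n d ∧
      ∃ p : Comp m n d × Weyl d × Comp m n d,
        p.2.1 ∈ superReps p.1 p.2.2 ∧ A = kappa p.1 p.2.1 p.2.2 then
    phi h.2.choose.1 h.2.choose.2.1 h.2.choose.2.2
  else 0

/-- `A` as an integer matrix. -/
def toInt (A : Matrix (Idx m n) (Idx m n) ℕ) : Matrix (Idx m n) (Idx m n) ℤ :=
  A.map (fun a => (a : ℤ))

open Classical in
/-- `e_M` for an integer matrix `M`; it is `0` if `M` has a negative entry or is otherwise not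
in `Ξ_{m|n,d}`. -/
noncomputable def eInt (M : Matrix (Idx m n) (Idx m n) ℤ) : Schur m n d :=
  if ∀ i j, 0 ≤ M i j then e (M.map Int.toNat) else 0

/-- `E^θ_{ij} = E_{ij} + E_{-i,-j}` (so that `E^θ_{00}` has the entry `2`). -/
def Etheta (i j : Idx m n) : Matrix (Idx m n) (Idx m n) ℤ :=
  Matrix.single i j 1 + Matrix.single i.opp j.opp 1

/-! ### Quantum combinatorics -/

/-- `[a]_p = (p^a - 1)/(p - 1) = 1 + p + ⋯ + p^{a-1}`. -/
noncomputable def qint (p : ℤ[T;T⁻¹]) (a : ℕ) : ℤ[T;T⁻¹] := ∑ i ∈ Finset.range a, p ^ i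

/-- `[b]_𝔠` for even `b`, i.e. `[2a]_𝔠 = [a]_q (q^a + 1)`. -/
noncomputable def cint (b : ℕ) : ℤ[T;T⁻¹] := qint q (b / 2) * (q ^ (b / 2) + 1)

open Classical in
/-- `𝐪_i = q` for `i` even, `q⁻¹` for `i` odd. -/
noncomputable def qb (i : Idx m n) : ℤ[T;T⁻¹] := if IsOddIdx i then qinv else q

open Classical in
/-- `𝐪̇_i = 1` for `i` even, `-q⁻¹` for `i` odd. -/
noncomputable def qdot (i : Idx m n) : ℤ[T;T⁻¹] := if IsOddIdx i then -qinv else 1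

open Classical in
/-- `𝐪̈_i = q` for `i` even, `-1` for `i` odd. -/
noncomputable def qddot (i : Idx m n) : ℤ[T;T⁻¹] := if IsOddIdx i then -1 else q

end IotaSchur

open IotaSchur

open scoped LaurentPolynomial DirectSum

namespace IotaSchur

variable {m n d : ℕ}

/-! ### Signed permutations and inversions -/

/-! The product formula is read off from signed sums of `T_y` over minimal coset representatives. By
`Tw_mul_TReps`, the element `T_g T_{𝒟_δ ∩ W_b}` is the sum `cosetSum` of `signWt b y • T_y` over the
minimal representatives `y` of `W_a \ W` with `κ(a, y, b) = A`. It depends on the matrix alone, and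
so does the action of `e_A` on the elements `[xy]_c h` (`eInt_apply`). The map `e_A` is well defined
because `[xy]_a` times this sum runs over the whole double coset with weights symmetric in `a` and
`b`; the anti-involution `T_w ↦ T_{w⁻¹}` then exhibits it as a left multiple of `[xy]_b`
(`exists_mul_xy`).

If `B` has a single pair of off-diagonal entries, the block labellings of `a` and `b` differ only at
two points `±z`. Each term of the product is `T_t T_w = T_{tw}` with `t ∈ W_b`. Refactor `tw = py`
with `p ∈ W_a` and `y` minimal for `W_a`; then `[xy]_a` absorbs `T_p` through the character `charWt`
(`q` on even blocks, `-1` on odd ones). The pair `(t, w)` is recorded by `y` and the point `x` that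
`tw` moves to `z`, so the product becomes a sum over the column `k` of `x`, over `y` with the
shifted matrix, and over `x` (`DifferAt.xy_mul_cosetSum_mul`).

The weight of a term counts points before or after `x` (`StepWeights.weight_eq`). Points in other
columns give the powers of `qdot` and `qddot`; points in column `k` give a geometric sum, that is
`[a_{hk} + 1]` to the base `qddot h * qdot k`. This base is `𝐪_h` if `h` and `k` have equal parity.
Otherwise it is `-1`, and `[1] = 1`, `[2] = 0` yield the right coefficient inside `Ξ` and kill the
matrices outside `Ξ`. At `h = k = 0` the entry `a_00` is odd, and `[a_00 + 1]_𝔠` equals `[a_00 +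
1]_q`, so the centre is no exception. Part (2) is part (1) with the order reversed, which is why
both are proved over an `OrderPair`.

All lengths and weights are instances of `ninv Q`, the number of inversions satisfying `Q`, which is
additive on reduced products (`ninv_mul`). -/

@[simp] theorem SymInt.coe_opp {N : ℕ} (x : SymInt N) : (x.opp).1 = -x.1 := rfl

@[simp] theorem SymInt.opp_opp {N : ℕ} (x : SymInt N) : x.opp.opp = x := by
  ext; simp

@[simp] theorem SymInt.coe_origin (N : ℕ) : (SymInt.origin N).1 = 0 := rfl

theorem SymInt.opp_lt_opp {N : ℕ} {x y : SymInt N} : x.opp < y.opp ↔ y < x := by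
  simp [← Subtype.coe_lt_coe]

theorem SymInt.opp_eq_origin {N : ℕ} {x : SymInt N} : x.opp = SymInt.origin N ↔ x = SymInt.origin N := by
  simp [Subtype.ext_iff]

theorem Weyl.map_opp (w : Weyl d) (x : SymInt d) : w.1 x.opp = (w.1 x).opp := w.2 x

@[simp] theorem Weyl.mul_apply (w w' : Weyl d) (x : SymInt d) : (w * w').1 x = w.1 (w'.1 x) := rfl

@[simp] theorem Weyl.one_apply (x : SymInt d) : (1 : Weyl d).1 x = x := rfl

@[simp] theorem Weyl.inv_apply_self (w : Weyl d) (x : SymInt d) : (w⁻¹).1 (w.1 x) = x :=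
  w.1.symm_apply_apply x

@[simp] theorem Weyl.apply_inv_self (w : Weyl d) (x : SymInt d) : w.1 ((w⁻¹).1 x) = x :=
  w.1.apply_symm_apply x

theorem Weyl.apply_inj (w : Weyl d) {x y : SymInt d} : w.1 x = w.1 y ↔ x = y :=
  w.1.injective.eq_iff

theorem Weyl.ext' {w w' : Weyl d} (h : ∀ x, w.1 x = w'.1 x) : w = w' :=
  Subtype.ext (Equiv.ext h)

@[simp] theorem Weyl.apply_origin (w : Weyl d) : w.1 (SymInt.origin d) = SymInt.origin d := by
  have h := w.map_opp (SymInt.origin d)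
  have h0 : (SymInt.origin d).opp = SymInt.origin d := by ext; simp
  rw [h0, Subtype.ext_iff] at h
  ext
  simp only [SymInt.coe_opp] at h
  simp only [SymInt.coe_origin]
  omega

theorem Weyl.apply_eq_origin (w : Weyl d) {x : SymInt d} :
    w.1 x = SymInt.origin d ↔ x = SymInt.origin d := by
  rw [← w.apply_inj (x := x), w.apply_origin]

theorem Weyl.inv_eq_iff (w : Weyl d) {x y : SymInt d} : (w⁻¹).1 x = y ↔ x = w.1 y := by
  constructor
  · rintro rfl; simp
  · rintro rfl; simp

theorem card_filter_and_add_not {α : Type*} [Fintype α] (P R : α → Prop) [DecidablePred P]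
    [DecidablePred R] :
    Finset.card {x | P x ∧ R x} + Finset.card {x | P x ∧ ¬ R x} = Finset.card {x | P x} := by
  rw [← Finset.filter_filter, ← Finset.filter_filter, Finset.card_filter_add_card_filter_not]

open Classical in
/-- The number of inversions `x < y`, `w y < w x` of `w`, modulo `(x, y) ↦ (-y, -x)`,
that satisfy `Q`. -/
noncomputable def ninv (Q : SymInt d → SymInt d → Prop) (w : Weyl d) : ℕ :=
  Finset.card {p : SymInt d × SymInt d | p.1 ≠ SymInt.origin d ∧ p.2.opp ≤ p.1 ∧ p.1 < p.2 ∧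
    w.1 p.2 < w.1 p.1 ∧ Q p.1 p.2}

open Classical in
/-- The number of all inversions of `w` away from `0` that satisfy `Q`. -/
noncomputable def fullInv (Q : SymInt d → SymInt d → Prop) (w : Weyl d) : ℕ :=
  Finset.card {p : SymInt d × SymInt d | p.1 ≠ SymInt.origin d ∧ p.2 ≠ SymInt.origin d ∧ p.1 < p.2 ∧
    w.1 p.2 < w.1 p.1 ∧ Q p.1 p.2}

/-- Relations invariant under exchange of the arguments and under `x ↦ -x`. -/
structure SymRel (Q : SymInt d → SymInt d → Prop) : Prop where
  swap : ∀ {x y}, Q x y → Q y x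
  opp : ∀ {x y}, Q x y → Q x.opp y.opp

theorem ninv_congr {Q Q' : SymInt d → SymInt d → Prop} {w : Weyl d}
    (h : ∀ x y, x < y → w.1 y < w.1 x → (Q x y ↔ Q' x y)) : ninv Q w = ninv Q' w := by
  classical
  unfold ninv
  congr 1
  ext p
  simp only [Finset.mem_filter, Finset.mem_univ, true_and]
  constructor
  · rintro ⟨h1, h2, h3, h4, h5⟩; exact ⟨h1, h2, h3, h4, (h _ _ h3 h4).1 h5⟩
  · rintro ⟨h1, h2, h3, h4, h5⟩; exact ⟨h1, h2, h3, h4, (h _ _ h3 h4).2 h5⟩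

/-- The involution `(x, y) ↦ (-y, -x)` on the inversions away from `0` has `ninv` many orbits, and
its fixed points are the pairs `(x, -x)`. This reduces statements about `ninv` to `fullInv`, which
involves no choice of representatives. -/
theorem two_mul_ninv {Q : SymInt d → SymInt d → Prop} (hQ : SymRel Q) (w : Weyl d) :
    2 * ninv Q w = fullInv Q w + fullInv (fun x y => Q x y ∧ y = x.opp) w := by
  classical
  have h1 : ninv Q w = Finset.card {p : SymInt d × SymInt d | (p.1 ≠ SymInt.origin d ∧
      p.2 ≠ SymInt.origin d ∧ p.1 < p.2 ∧ w.1 p.2 < w.1 p.1 ∧ Q p.1 p.2) ∧ p.2.opp < p.1} +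
      fullInv (fun x y => Q x y ∧ y = x.opp) w := by
    unfold ninv fullInv
    rw [← Finset.card_union_of_disjoint]
    · congr 1
      ext ⟨x, y⟩
      simp only [Finset.mem_filter, Finset.mem_univ, true_and, Finset.mem_union,
        ← Subtype.coe_le_coe, ← Subtype.coe_lt_coe, ne_eq, Subtype.ext_iff, SymInt.coe_opp,
        SymInt.coe_origin]
      constructor
      · rintro ⟨a, b, c, e, f⟩
        by_cases hxy : -y.1 < x.1
        · left; refine ⟨⟨a, by omega, c, e, f⟩, hxy⟩
        · right; refine ⟨a, by omega, c, e, f, by omega⟩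
      · rintro (⟨⟨a, b, c, e, f⟩, g⟩ | ⟨a, b, c, e, f, g⟩)
        · exact ⟨a, by omega, c, e, f⟩
        · exact ⟨a, by omega, c, e, f⟩
    · rw [Finset.disjoint_left]
      rintro ⟨x, y⟩
      simp only [Finset.mem_filter, Finset.mem_univ, true_and, 
        ← Subtype.coe_lt_coe, ne_eq, Subtype.ext_iff, SymInt.coe_opp,
        SymInt.coe_origin]
      rintro ⟨_, a⟩ ⟨_, _, _, _, _, b⟩
      omega
  have h2 : ninv Q w = Finset.card {p : SymInt d × SymInt d | (p.1 ≠ SymInt.origin d ∧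
      p.2 ≠ SymInt.origin d ∧ p.1 < p.2 ∧ w.1 p.2 < w.1 p.1 ∧ Q p.1 p.2) ∧ ¬ p.2.opp < p.1} := by
    unfold ninv
    apply Finset.card_nbij' (fun p => (p.2.opp, p.1.opp)) (fun p => (p.2.opp, p.1.opp))
    · rintro ⟨x, y⟩
      simp only [Finset.mem_coe, Finset.mem_filter, Finset.mem_univ, true_and,
        SymInt.opp_opp, SymInt.opp_lt_opp, Weyl.map_opp]
      rintro ⟨a, b, c, e, f⟩
      refine ⟨⟨?_, by rwa [ne_eq, SymInt.opp_eq_origin], c, e, hQ.swap (hQ.opp f)⟩, ?_⟩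
      · simp only [← Subtype.coe_le_coe, ← Subtype.coe_lt_coe, ne_eq, Subtype.ext_iff,
          SymInt.coe_opp, SymInt.coe_origin] at *
        omega
      · simp only [← Subtype.coe_le_coe, ← Subtype.coe_lt_coe, ne_eq, Subtype.ext_iff,
          SymInt.coe_opp, SymInt.coe_origin] at *
        omega
    · rintro ⟨x, y⟩
      simp only [Finset.mem_coe, Finset.mem_filter, Finset.mem_univ, true_and,
        SymInt.opp_opp, SymInt.opp_lt_opp, Weyl.map_opp]
      rintro ⟨⟨a, b, c, e, f⟩, g⟩
      refine ⟨by rwa [ne_eq, SymInt.opp_eq_origin], ?_, c, e, hQ.swap (hQ.opp f)⟩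
      simp only [← Subtype.coe_le_coe, ← Subtype.coe_lt_coe, ne_eq, Subtype.ext_iff,
          SymInt.coe_opp, SymInt.coe_origin] at *
      omega
    · rintro ⟨x, y⟩ _; simp
    · rintro ⟨x, y⟩ _; simp
  rw [two_mul]
  nth_rewrite 2 [h1]
  nth_rewrite 1 [h2]
  rw [← add_assoc]
  congr 1
  unfold fullInv
  rw [add_comm]
  exact card_filter_and_add_not _ _

theorem fullInv_inv (Q : SymInt d → SymInt d → Prop) (hQ : ∀ x y, Q x y → Q y x) (w : Weyl d) :
    fullInv Q w⁻¹ = fullInv (fun x y => Q (w.1 x) (w.1 y)) w := by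
  classical
  unfold fullInv
  apply Finset.card_nbij' (fun p => ((w⁻¹).1 p.2, (w⁻¹).1 p.1)) (fun p => (w.1 p.2, w.1 p.1))
  · rintro ⟨x, y⟩
    simp only [Finset.mem_coe, Finset.mem_filter, Finset.mem_univ, true_and, ne_eq,
      Weyl.apply_eq_origin, Weyl.apply_inv_self]
    rintro ⟨a, b, c, e, f⟩
    exact ⟨b, a, e, c, hQ _ _ f⟩
  · rintro ⟨x, y⟩
    simp only [Finset.mem_coe, Finset.mem_filter, Finset.mem_univ, true_and, ne_eq,
      Weyl.apply_eq_origin, Weyl.inv_apply_self]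
    rintro ⟨a, b, c, e, f⟩
    exact ⟨b, a, e, c, hQ _ _ f⟩
  · rintro ⟨x, y⟩ _; simp
  · rintro ⟨x, y⟩ _; simp

theorem SymRel.comp {Q : SymInt d → SymInt d → Prop} (hQ : SymRel Q) (w : Weyl d) :
    SymRel (fun x y => Q (w.1 x) (w.1 y)) :=
  ⟨fun h => hQ.swap h, fun h => by simpa only [Weyl.map_opp] using hQ.opp h⟩

theorem ninv_inv {Q : SymInt d → SymInt d → Prop} (hQ : SymRel Q) (w : Weyl d) :
    ninv Q w⁻¹ = ninv (fun x y => Q (w.1 x) (w.1 y)) w := by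
  have h1 := two_mul_ninv hQ w⁻¹
  have h2 := two_mul_ninv (hQ.comp w) w
  rw [fullInv_inv _ (fun _ _ => hQ.swap), fullInv_inv] at h1
  · simp only [← Weyl.map_opp, Weyl.apply_inj] at h1
    omega
  · rintro x y ⟨a, rfl⟩
    exact ⟨hQ.swap a, by simp⟩

/-- The hypothesis says that `w` undoes no relevant inversion of `w'`. The inversions of `w * w'`
then split into those already made by `w'` and those that `w` adds. -/
theorem fullInv_mul (Q : SymInt d → SymInt d → Prop) (hQ : ∀ x y, Q x y → Q y x) (w w' : Weyl d)
    (h : ∀ x y, x < y → Q x y → w'.1 y < w'.1 x → w.1 (w'.1 y) < w.1 (w'.1 x)) :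
    fullInv Q (w * w') =
      fullInv (fun x y => Q ((w'⁻¹).1 x) ((w'⁻¹).1 y)) w + fullInv Q w' := by
  classical
  have h1 : fullInv Q w' = Finset.card {p : SymInt d × SymInt d | (p.1 ≠ SymInt.origin d ∧
      p.2 ≠ SymInt.origin d ∧ p.1 < p.2 ∧ (w * w').1 p.2 < (w * w').1 p.1 ∧ Q p.1 p.2) ∧
      ¬ w'.1 p.1 < w'.1 p.2} := by
    unfold fullInv
    congr 1
    ext ⟨x, y⟩
    simp only [Finset.mem_filter, Finset.mem_univ, true_and, not_lt]
    constructor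
    · rintro ⟨a, b, c, e, f⟩
      exact ⟨⟨a, b, c, h _ _ c f e, f⟩, e.le⟩
    · rintro ⟨⟨a, b, c, e, f⟩, g⟩
      exact ⟨a, b, c, lt_of_le_of_ne g (by rw [ne_eq, w'.apply_inj]; exact c.ne'), f⟩
  have h2 : fullInv (fun x y => Q ((w'⁻¹).1 x) ((w'⁻¹).1 y)) w =
      Finset.card {p : SymInt d × SymInt d | (p.1 ≠ SymInt.origin d ∧
      p.2 ≠ SymInt.origin d ∧ p.1 < p.2 ∧ (w * w').1 p.2 < (w * w').1 p.1 ∧ Q p.1 p.2) ∧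
      w'.1 p.1 < w'.1 p.2} := by
    unfold fullInv
    apply Finset.card_nbij' (fun p => ((w'⁻¹).1 p.1, (w'⁻¹).1 p.2)) (fun p => (w'.1 p.1, w'.1 p.2))
    · rintro ⟨x, y⟩
      simp only [Finset.mem_coe, Finset.mem_filter, Finset.mem_univ, true_and]
      simp only [ne_eq, Weyl.apply_eq_origin, Weyl.apply_inv_self, Weyl.mul_apply]
      rintro ⟨a, b, c, e, f⟩
      refine ⟨⟨a, b, ?_, e, f⟩, c⟩
      by_contra hc
      have hc' : (w'⁻¹).1 y < (w'⁻¹).1 x :=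
        lt_of_le_of_ne (not_lt.1 hc) (by rw [ne_eq, Weyl.apply_inj]; exact c.ne')
      have := h _ _ hc' (hQ _ _ f) (by simpa using c)
      simp only [Weyl.apply_inv_self] at this
      exact absurd e this.asymm
    · rintro ⟨x, y⟩
      simp only [Finset.mem_coe, Finset.mem_filter, Finset.mem_univ, true_and]
      simp only [ne_eq, Weyl.apply_eq_origin, Weyl.inv_apply_self, Weyl.mul_apply]
      rintro ⟨⟨a, b, c, e, f⟩, g⟩
      exact ⟨a, b, g, e, f⟩
    · rintro ⟨x, y⟩ _; simp
    · rintro ⟨x, y⟩ _; simp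
  rw [h1, h2]
  unfold fullInv
  exact (card_filter_and_add_not _ _).symm

/-- Carrying `Q` pays off here: for `Q` trivial this is additivity of length, and for pairs inside
odd or even blocks it makes the weights multiplicative. -/
theorem ninv_mul {Q : SymInt d → SymInt d → Prop} (hQ : SymRel Q) (w w' : Weyl d)
    (h : ∀ x y, x < y → Q x y → w'.1 y < w'.1 x → w.1 (w'.1 y) < w.1 (w'.1 x)) :
    ninv Q (w * w') = ninv (fun x y => Q ((w'⁻¹).1 x) ((w'⁻¹).1 y)) w + ninv Q w' := by
  have h1 := two_mul_ninv hQ (w * w')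
  have h2 := two_mul_ninv (hQ.comp w'⁻¹) w
  have h3 : 2 * ninv Q w' = fullInv (fun x y => Q x y) w' + _ := two_mul_ninv hQ w'
  rw [fullInv_mul _ (fun _ _ => hQ.swap) _ _ h, fullInv_mul] at h1
  · simp only [← Weyl.map_opp, Weyl.apply_inj] at h1 h2
    omega
  · rintro x y ⟨a, rfl⟩
    exact ⟨hQ.swap a, by simp⟩
  · rintro x y a b c
    exact h x y a b.1 c

/-! ### The length function counts inversions -/

theorem coe_simple_apply (i : Fin d) (x : SymInt d) : ((simple i).1 x).1 =
    if i.1 = 0 then (if x.1 = -1 then 1 else if x.1 = 1 then -1 else x.1)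
    else (if x.1 = i.1 then (i.1 : ℤ) + 1 else if x.1 = (i.1 : ℤ) + 1 then i.1 else
      if x.1 = -(i.1 : ℤ) then -(i.1 : ℤ) - 1 else if x.1 = -(i.1 : ℤ) - 1 then -(i.1 : ℤ)
      else x.1) := by
  change (simplePerm i x).1 = _
  unfold simplePerm
  split_ifs with h h1 h2 h3 h4 h5 h6 <;>
  simp only [Equiv.Perm.coe_mul, Function.comp_apply, Equiv.swap_apply_def, 
      Subtype.ext_iff, apply_ite Subtype.val] <;>
    split_ifs <;> omega

/-- The left end of the pair exchanged by `s_i`: it is `-1` for `i = 0` and `i` otherwise. -/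
def leftEnd (i : Fin d) : SymInt d :=
  ⟨if i.1 = 0 then -1 else i.1, by have := i.2; simp only [Set.mem_Icc]; split_ifs <;> omega⟩

/-- The right end `i + 1` of the pair exchanged by `s_i`. -/
def rightEnd (i : Fin d) : SymInt d :=
  ⟨(i.1 : ℤ) + 1, by have := i.2; simp only [Set.mem_Icc]; omega⟩

theorem simple_apply_leftEnd (i : Fin d) : (simple i).1 (leftEnd i) = rightEnd i := by
  ext
  rw [coe_simple_apply]
  simp only [leftEnd, rightEnd]
  split_ifs <;> omega

theorem simple_mul_self (i : Fin d) : simple i * simple i = 1 := by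
  apply Weyl.ext'
  intro x
  ext
  simp only [Weyl.mul_apply, Weyl.one_apply]
  have h1 := coe_simple_apply i x
  have h2 := coe_simple_apply i ((simple i).1 x)
  split_ifs at h1 h2 <;> omega

theorem simple_inv (i : Fin d) : (simple i)⁻¹ = simple i :=
  inv_eq_of_mul_eq_one_left (simple_mul_self i)

theorem simple_apply_rightEnd (i : Fin d) : (simple i).1 (rightEnd i) = leftEnd i := by
  rw [← simple_apply_leftEnd, ← Weyl.mul_apply, simple_mul_self, Weyl.one_apply]

theorem leftEnd_lt_rightEnd (i : Fin d) : leftEnd i < rightEnd i := by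
  rw [← Subtype.coe_lt_coe]
  simp only [leftEnd, rightEnd]
  split_ifs <;> omega

/-- The pairs inverted by `s_i`. -/
theorem simple_inversion {i : Fin d} {x y : SymInt d} (h : x < y)
    (h' : (simple i).1 y < (simple i).1 x) :
    (x = leftEnd i ∧ y = rightEnd i) ∨ (y = (leftEnd i).opp ∧ x = (rightEnd i).opp) ∨
    (i.1 = 0 ∧ x = leftEnd i ∧ y = SymInt.origin d) ∨
    (i.1 = 0 ∧ x = SymInt.origin d ∧ y = rightEnd i) := by
  rw [← Subtype.coe_lt_coe] at h h'
  have h1 := coe_simple_apply i x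
  have h2 := coe_simple_apply i y
  simp only [Subtype.ext_iff, leftEnd, rightEnd, SymInt.coe_opp, SymInt.coe_origin]
  split_ifs at h1 h2 ⊢ <;> omega

theorem leftEnd_of_zero {i : Fin d} (hi : i.1 = 0) : leftEnd i = (rightEnd i).opp := by
  ext
  simp [leftEnd, rightEnd, hi]

theorem apply_simple_lt {w : Weyl d} {i : Fin d} (hw : w.1 (leftEnd i) < w.1 (rightEnd i))
    {x y : SymInt d} (h : x < y) (h' : (simple i).1 y < (simple i).1 x) :
    w.1 ((simple i).1 y) < w.1 ((simple i).1 x) := by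
  -- The reflection `s_0` also inverts `(-1, 0)` and `(0, 1)`; since `w` commutes with negation, `w
  -- (-1) < w 1` places `0` between the two values.
  have key : i.1 = 0 → w.1 (leftEnd i) < SymInt.origin d ∧ SymInt.origin d < w.1 (rightEnd i) := by
    intro hi
    rw [leftEnd_of_zero hi, w.map_opp, ← Subtype.coe_lt_coe, SymInt.coe_opp] at hw
    rw [leftEnd_of_zero hi, w.map_opp, ← Subtype.coe_lt_coe, ← Subtype.coe_lt_coe, SymInt.coe_opp,
      SymInt.coe_origin]
    omega
  rcases simple_inversion h h' with ⟨rfl, rfl⟩ | ⟨rfl, rfl⟩ | ⟨hi, rfl, rfl⟩ | ⟨hi, rfl, rfl⟩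
  · rwa [simple_apply_leftEnd, simple_apply_rightEnd]
  · rw [(simple i).map_opp, (simple i).map_opp, simple_apply_leftEnd, simple_apply_rightEnd, w.map_opp,
      w.map_opp,
      SymInt.opp_lt_opp]
    exact hw
  · rw [simple_apply_leftEnd, Weyl.apply_origin, Weyl.apply_origin]
    exact (key hi).2
  · rw [simple_apply_rightEnd, Weyl.apply_origin, Weyl.apply_origin]
    exact (key hi).1

theorem symRel_true : SymRel (fun _ _ : SymInt d => True) := ⟨fun _ => trivial, fun _ => trivial⟩

theorem ninv_simple {Q : SymInt d → SymInt d → Prop} (i : Fin d) (h : Q (leftEnd i) (rightEnd i)) :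
    ninv Q (simple i) = 1 := by
  classical
  unfold ninv
  rw [Finset.card_eq_one]
  refine ⟨(leftEnd i, rightEnd i), ?_⟩
  ext ⟨x, y⟩
  simp only [Finset.mem_filter, Finset.mem_univ, true_and, Finset.mem_singleton, Prod.mk.injEq]
  constructor
  · rintro ⟨a, b, c, e, f⟩
    have := simple_inversion c e
    clear e f h
    simp only [← Subtype.coe_le_coe, ← Subtype.coe_lt_coe, ne_eq, Subtype.ext_iff, SymInt.coe_opp,
        SymInt.coe_origin, leftEnd, rightEnd] at *
    split_ifs at * 
    all_goals omega
  · rintro ⟨rfl, rfl⟩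
    refine ⟨?_, ?_, leftEnd_lt_rightEnd i, ?_, h⟩
    · simp only [ne_eq, Subtype.ext_iff, SymInt.coe_origin, leftEnd]
      split_ifs
      · simp
      · omega
    · simp only [← Subtype.coe_le_coe, SymInt.coe_opp, leftEnd, rightEnd]
      split_ifs <;> omega
    · rw [simple_apply_leftEnd, simple_apply_rightEnd]
      exact leftEnd_lt_rightEnd i

theorem ninv_mul_simple {w : Weyl d} {i : Fin d} (hw : w.1 (leftEnd i) < w.1 (rightEnd i)) :
    ninv (fun _ _ => True) (w * simple i) = ninv (fun _ _ => True) w + 1 := by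
  rw [ninv_mul symRel_true, ninv_simple i trivial]
  intro x y h _ h'
  exact apply_simple_lt hw h h'

theorem ninv_mul_simple_of_gt {w : Weyl d} {i : Fin d} (hw : w.1 (rightEnd i) < w.1 (leftEnd i)) :
    ninv (fun _ _ => True) w = ninv (fun _ _ => True) (w * simple i) + 1 := by
  rw [← ninv_mul_simple, mul_assoc, simple_mul_self, mul_one]
  simpa [simple_apply_leftEnd, simple_apply_rightEnd] using hw

theorem Weyl.lt_or_gt (w : Weyl d) (i : Fin d) :
    w.1 (leftEnd i) < w.1 (rightEnd i) ∨ w.1 (rightEnd i) < w.1 (leftEnd i) := by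
  rcases lt_trichotomy (w.1 (leftEnd i)) (w.1 (rightEnd i)) with h | h | h
  · exact Or.inl h
  · exact absurd (w.apply_inj.1 h) (leftEnd_lt_rightEnd i).ne
  · exact Or.inr h

/-- A relation that holds for successive elements of a convex set holds for all pairs. -/
theorem lt_of_adjacent {S : SymInt d → Prop} {φ : SymInt d → SymInt d}
    (hS : ∀ x y z, S x → S z → x ≤ y → y ≤ z → S y)
    (h : ∀ x y, S x → S y → y.1 = x.1 + 1 → φ x < φ y) {x y : SymInt d} (hx : S x) (hy : S y)
    (hxy : x < y) : φ x < φ y := by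
  rw [← Subtype.coe_lt_coe] at hxy
  obtain ⟨k, hk⟩ : ∃ k : ℕ, y.1 = x.1 + k + 1 := ⟨(y.1 - x.1 - 1).toNat, by omega⟩
  clear hxy
  induction k generalizing y with
  | zero => exact h x y hx hy (by simpa using hk)
  | succ k ih =>
    let z : SymInt d := ⟨y.1 - 1, by
      have h1 := x.2; have h2 := y.2; simp only [Set.mem_Icc] at *; push_cast at hk; omega⟩
    have hz : S z := by
      refine hS x z y hx hy ?_ ?_ <;> simp only [← Subtype.coe_le_coe, z]
      · push_cast at hk; omega
      · omega
    refine (ih hz ?_).trans (h z y hz hy ?_)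
    · simp only [z]; push_cast at hk; omega
    · simp [z]

/-- A finite linear order has no order automorphism except the identity. -/
theorem eq_one_of_strictMono {w : Weyl d} (h : ∀ x y, x < y → w.1 x < w.1 y) : w = 1 := by
  have hm : StrictMono (w.1 : SymInt d → SymInt d) := fun x y hxy => h x y hxy
  let e : SymInt d ≃o SymInt d := StrictMono.orderIsoOfSurjective _ hm w.1.surjective
  apply Weyl.ext'
  intro x
  have : e = OrderIso.refl _ := Subsingleton.elim _ _
  exact congrArg (fun f : SymInt d ≃o SymInt d => f x) this

/-- Adjacent elements are exchanged by a simple reflection, except for the pairs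
that involve `0`, which are governed by `s_0`. -/
theorem adjacent_cases {x y : SymInt d} (h : y.1 = x.1 + 1) : ∃ i : Fin d,
    (x = leftEnd i ∧ y = rightEnd i) ∨ (y = (leftEnd i).opp ∧ x = (rightEnd i).opp) ∨
    (i.1 = 0 ∧ x = leftEnd i ∧ y = SymInt.origin d) ∨
    (i.1 = 0 ∧ x = SymInt.origin d ∧ y = rightEnd i) := by
  have hx := x.2
  have hy := y.2
  simp only [Set.mem_Icc] at hx hy
  simp only [Subtype.ext_iff, leftEnd, rightEnd, SymInt.coe_opp, SymInt.coe_origin]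
  rcases lt_trichotomy x.1 0 with h0 | h0 | h0
  · by_cases h1 : x.1 = -1
    · refine ⟨⟨0, by omega⟩, ?_⟩
      simp only [if_true, Nat.cast_zero, true_and]
      omega
    refine ⟨⟨(-x.1 - 1).toNat, by omega⟩, ?_⟩
    simp only
    split_ifs <;> omega
  · refine ⟨⟨0, by omega⟩, ?_⟩
    simp only [if_true, Nat.cast_zero, true_and]
    omega
  · refine ⟨⟨x.1.toNat, by omega⟩, ?_⟩
    simp only
    split_ifs <;> omega

theorem Weyl.lt_of_leftEnd_lt {w : Weyl d} {i : Fin d} (hw : w.1 (leftEnd i) < w.1 (rightEnd i))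
    {x y : SymInt d} (h : (x = leftEnd i ∧ y = rightEnd i) ∨
      (y = (leftEnd i).opp ∧ x = (rightEnd i).opp) ∨
      (i.1 = 0 ∧ x = leftEnd i ∧ y = SymInt.origin d) ∨
      (i.1 = 0 ∧ x = SymInt.origin d ∧ y = rightEnd i)) : w.1 x < w.1 y := by
  have key : i.1 = 0 → w.1 (leftEnd i) < SymInt.origin d ∧ SymInt.origin d < w.1 (rightEnd i) := by
    intro hi
    rw [leftEnd_of_zero hi, w.map_opp, ← Subtype.coe_lt_coe, SymInt.coe_opp] at hw
    rw [leftEnd_of_zero hi, w.map_opp, ← Subtype.coe_lt_coe, ← Subtype.coe_lt_coe, SymInt.coe_opp,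
      SymInt.coe_origin]
    omega
  rcases h with ⟨rfl, rfl⟩ | ⟨rfl, rfl⟩ | ⟨hi, rfl, rfl⟩ | ⟨hi, rfl, rfl⟩
  · exact hw
  · rwa [w.map_opp, w.map_opp, SymInt.opp_lt_opp]
  · rw [w.apply_origin]; exact (key hi).1
  · rw [w.apply_origin]; exact (key hi).2

theorem exists_descent {w : Weyl d} (hw : w ≠ 1) : ∃ i, w.1 (rightEnd i) < w.1 (leftEnd i) := by
  by_contra! hc
  refine hw (eq_one_of_strictMono fun x y hxy => ?_)
  refine lt_of_adjacent (S := fun _ => True) (by simp) ?_ trivial trivial hxy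
  intro x y _ _ h
  obtain ⟨i, hi⟩ := adjacent_cases h
  refine Weyl.lt_of_leftEnd_lt ?_ hi
  rcases w.lt_or_gt i with h | h
  · exact h
  · exact absurd h (not_lt.2 (hc i))

theorem ninv_prod_le (l : List (Fin d)) : ninv (fun _ _ => True) (l.map simple).prod ≤ l.length := by
  induction l using List.reverseRecOn with
  | nil =>
    simp only [List.map_nil, List.prod_nil, List.length_nil, Nat.le_zero, ninv, Finset.card_eq_zero]
    ext p
    simp only [Finset.mem_filter, Finset.mem_univ, true_and, Finset.notMem_empty, iff_false]
    rintro ⟨_, _, a, b, _⟩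
    exact a.asymm b
  | append_singleton l i ih =>
    simp only [List.map_append, List.map_cons, List.map_nil, List.prod_append, List.prod_cons,
      List.prod_nil, mul_one, List.length_append, List.length_cons, List.length_nil, zero_add]
    rcases Weyl.lt_or_gt (l.map simple).prod i with h | h
    · rw [ninv_mul_simple h]; omega
    · have := ninv_mul_simple_of_gt h; omega

theorem exists_word (w : Weyl d) :
    ∃ l : List (Fin d), l.length = ninv (fun _ _ => True) w ∧ (l.map simple).prod = w := by
  generalize hk : ninv (fun _ _ => True) w = k
  induction k generalizing w with
  | zero =>
    refine ⟨[], rfl, ?_⟩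
    by_contra hw
    obtain ⟨i, hi⟩ := exists_descent (Ne.symm hw)
    have := ninv_mul_simple_of_gt hi
    omega
  | succ k ih =>
    have hw : w ≠ 1 := by
      rintro rfl
      have := ninv_prod_le ([] : List (Fin d))
      simp only [List.map_nil, List.prod_nil, List.length_nil] at this
      omega
    obtain ⟨i, hi⟩ := exists_descent hw
    obtain ⟨l, h1, h2⟩ := ih (w * simple i) (by have := ninv_mul_simple_of_gt hi; omega)
    refine ⟨l ++ [i], by simp [h1], ?_⟩
    simp [h2, mul_assoc, simple_mul_self]

/-- A generator changes the number of inversions by exactly one, so no word is shorter than this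
number; removing descents one by one produces a word that attains it. -/
theorem len_eq_ninv (w : Weyl d) : len w = ninv (fun _ _ => True) w := by
  apply le_antisymm
  · exact Nat.sInf_le (exists_word w)
  · apply le_csInf
    · exact ⟨_, exists_word w⟩
    · rintro k ⟨l, rfl, rfl⟩
      exact ninv_prod_le l

theorem len_mul {w w' : Weyl d}
    (h : ∀ x y, x < y → w'.1 y < w'.1 x → w.1 (w'.1 y) < w.1 (w'.1 x)) :
    len (w * w') = len w + len w' := by
  rw [len_eq_ninv, len_eq_ninv, len_eq_ninv, ninv_mul symRel_true]
  exact fun x y a _ b => h x y a b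

theorem len_inv (w : Weyl d) : len w⁻¹ = len w := by
  rw [len_eq_ninv, len_eq_ninv, ninv_inv symRel_true]

theorem len_simple (i : Fin d) : len (simple i) = 1 := by
  rw [len_eq_ninv, ninv_simple i trivial]

theorem len_mul_simple {w : Weyl d} {i : Fin d} (hw : w.1 (leftEnd i) < w.1 (rightEnd i)) :
    len (w * simple i) = len w + 1 := by
  rw [len_eq_ninv, len_eq_ninv, ninv_mul_simple hw]

theorem len_mul_simple_of_gt {w : Weyl d} {i : Fin d} (hw : w.1 (rightEnd i) < w.1 (leftEnd i)) :
    len w = len (w * simple i) + 1 := by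
  rw [len_eq_ninv, len_eq_ninv, ← ninv_mul_simple_of_gt hw]

theorem len_simple_mul {w : Weyl d} {i : Fin d} (hw : (w⁻¹).1 (leftEnd i) < (w⁻¹).1 (rightEnd i)) :
    len (simple i * w) = len w + 1 := by
  rw [← len_inv, mul_inv_rev, simple_inv, len_mul_simple hw, len_inv]

theorem len_simple_mul_of_gt {w : Weyl d} {i : Fin d}
    (hw : (w⁻¹).1 (rightEnd i) < (w⁻¹).1 (leftEnd i)) : len w = len (simple i * w) + 1 := by
  rw [← len_inv, len_mul_simple_of_gt hw, ← len_inv, mul_inv_rev, simple_inv, inv_inv]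

theorem ninv_one (Q : SymInt d → SymInt d → Prop) : ninv Q 1 = 0 := by
  simp only [ninv, Finset.card_eq_zero]
  ext p
  simp only [Finset.mem_filter, Finset.mem_univ, true_and, Finset.notMem_empty, iff_false]
  rintro ⟨_, _, a, b, _⟩
  exact a.asymm b

theorem eq_one_of_len_eq_zero {w : Weyl d} (h : len w = 0) : w = 1 := by
  by_contra hw
  obtain ⟨i, hi⟩ := exists_descent hw
  have := len_mul_simple_of_gt hi
  omega

/-! ### Labellings of `[-d..d]` with convex classes -/

/-- A labelling of `[-d..d]` whose classes are convex and permuted by `x ↦ -x`. -/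
structure IsLabelling {α : Type*} (f : SymInt d → α) : Prop where
  convex : ∀ {x y z}, x ≤ y → y ≤ z → f x = f z → f y = f x
  opp : ∀ {x y}, f x = f y → f x.opp = f y.opp

/-- `w` preserves the classes of the labelling `f`. -/
def Pres {α : Type*} (f : SymInt d → α) (w : Weyl d) : Prop := ∀ x, f (w.1 x) = f x

/-- `w⁻¹` is increasing on the classes of `f`. -/
def Inc {α : Type*} (f : SymInt d → α) (w : Weyl d) : Prop :=
  ∀ x y, x < y → f x = f y → (w⁻¹).1 x < (w⁻¹).1 y

section Labelling
variable {α β : Type*} {f : SymInt d → α}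

theorem Pres.one : Pres f (1 : Weyl d) := fun _ => rfl

theorem Pres.mul {w w' : Weyl d} (h : Pres f w) (h' : Pres f w') : Pres f (w * w') := fun x => by
  rw [Weyl.mul_apply, h, h']

theorem Pres.inv {w : Weyl d} (h : Pres f w) : Pres f w⁻¹ := fun x => by
  rw [← h, Weyl.apply_inv_self]

theorem Inc.one : Inc f (1 : Weyl d) := fun x y h _ => by simpa using h

theorem Inc.lt_iff {w : Weyl d} (h : Inc f w) {x y : SymInt d} (hf : f (w.1 x) = f (w.1 y)) :
    w.1 x < w.1 y ↔ x < y := by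
  constructor
  · intro hlt
    simpa using h _ _ hlt hf
  · intro hlt
    by_contra hc
    rcases (not_lt.1 hc).eq_or_lt with h1 | h1
    · exact hlt.ne' (w.apply_inj.1 h1)
    · have := h _ _ h1 hf.symm
      simp only [Weyl.inv_apply_self] at this
      exact hlt.asymm this

theorem Inc.inv_lt_iff {w : Weyl d} (h : Inc f w) {x y : SymInt d} (hf : f x = f y) :
    (w⁻¹).1 x < (w⁻¹).1 y ↔ x < y := by
  rw [← h.lt_iff (by simpa using hf)]
  simp

/-- Disjoint convex classes are comparable as wholes, so the order of two points in different
classes depends only on the classes. -/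
theorem IsLabelling.lt_of_ne (hf : IsLabelling f) {x y x' y' : SymInt d} (hxy : x < y)
    (hne : f x ≠ f y) (hx : f x' = f x) (hy : f y' = f y) : x' < y' := by
  by_contra hc
  rw [not_lt] at hc
  rcases lt_or_ge y' x with h1 | h1
  · exact hne ((hf.convex h1.le hxy.le hy).trans hy)
  · have h2 : f y' = f x := hf.convex h1 hc hx.symm
    exact hne (h2.symm.trans hy)

theorem Pres.lt_iff (hf : IsLabelling f) {w : Weyl d} (hw : Pres f w) {x y : SymInt d}
    (hne : f x ≠ f y) : w.1 x < w.1 y ↔ x < y := by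
  constructor
  · intro h
    exact hf.lt_of_ne h (by rwa [hw, hw]) (hw x).symm (hw y).symm
  · intro h
    exact hf.lt_of_ne h hne (hw x) (hw y)

/-- An inversion of `y` joins two different classes, because `y⁻¹` is increasing on each class; an
element preserving the classes cannot undo it. Hence products `W_f` times minimal representative are
reduced. -/
theorem Pres.apply_lt (hf : IsLabelling f) {w y : Weyl d} (hw : Pres f w) (hy : Inc f y)
    {u v : SymInt d} (huv : u < v) (h : y.1 v < y.1 u) : w.1 (y.1 v) < w.1 (y.1 u) := by
  rw [Pres.lt_iff hf hw]
  · exact h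
  · intro he
    exact huv.asymm ((hy.lt_iff he).1 h)

theorem Pres.len_mul (hf : IsLabelling f) {w y : Weyl d} (hw : Pres f w) (hy : Inc f y) :
    len (w * y) = len w + len y :=
  IotaSchur.len_mul fun _ _ h h' => hw.apply_lt hf hy h h'

/-- Minimal coset representatives are unique. -/
theorem Inc.eq_one (hf : IsLabelling f) {t y : Weyl d} (ht : Pres f t) (hy : Inc f y)
    (hty : Inc f (t * y)) : t = 1 := by
  -- `ℓ(ty) = ℓ(t) + ℓ(y)` and `ℓ(y) = ℓ(t⁻¹) + ℓ(ty)` together force `ℓ(t) = 0`.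
  have h1 := ht.len_mul hf hy
  have h2 := ht.inv.len_mul hf hty
  rw [inv_mul_cancel_left] at h2
  exact eq_one_of_len_eq_zero (by omega)

/-- Monotonicity on a class need only be tested on adjacent points, and a failure there is a left
descent by a simple reflection preserving the classes. -/
theorem Inc.of_len_le (hf : IsLabelling f) {y : Weyl d}
    (h : ∀ i, Pres f (simple i) → len y ≤ len (simple i * y)) : Inc f y := by
  intro u v huv he
  refine lt_of_adjacent (S := fun x => f x = f u) (φ := fun x => (y⁻¹).1 x) ?_ ?_ rfl he.symm huv
  · intro a b c ha hc hab hbc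
    exact (hf.convex hab hbc (ha.trans hc.symm)).trans ha
  · intro a b ha hb hab
    obtain ⟨i, hi⟩ := adjacent_cases hab
    refine Weyl.lt_of_leftEnd_lt ?_ hi
    rcases (y⁻¹).lt_or_gt i with h1 | h1
    · exact h1
    · exfalso
      have hab' : f a = f b := ha.trans hb.symm
      -- If the adjacent pair contains `0`, its class is stable under negation and so contains both
      -- ends `-1` and `1` of `s_0`.
      have hlr : f (leftEnd i) = f (rightEnd i) := by
        have h0 : (SymInt.origin d).opp = SymInt.origin d := by ext; simp
        rcases hi with ⟨rfl, rfl⟩ | ⟨rfl, rfl⟩ | ⟨hi, rfl, rfl⟩ | ⟨hi, rfl, rfl⟩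
        · exact hab'
        · simpa using (hf.opp hab').symm
        · have h2 := hf.opp hab'
          rw [h0, leftEnd_of_zero hi, SymInt.opp_opp] at h2
          rw [hab', h2]
        · have h2 := hf.opp hab'
          rw [h0, ← leftEnd_of_zero hi] at h2
          rw [← hab', h2]
      have hp : Pres f (simple i) := by
        have hopp := hf.opp hlr
        intro x
        by_cases e1 : x = leftEnd i
        · rw [e1, simple_apply_leftEnd, hlr]
        by_cases e2 : x = rightEnd i
        · rw [e2, simple_apply_rightEnd, hlr]
        by_cases e3 : x = (leftEnd i).opp
        · rw [e3, Weyl.map_opp, simple_apply_leftEnd, hopp]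
        by_cases e4 : x = (rightEnd i).opp
        · rw [e4, Weyl.map_opp, simple_apply_rightEnd, hopp]
        congr 1
        simp only [Subtype.ext_iff, coe_simple_apply, leftEnd, rightEnd, SymInt.coe_opp] at *
        split_ifs at * <;> omega
      have h2 := h i hp
      have h3 := len_simple_mul_of_gt h1
      omega

theorem exists_decomposition (hf : IsLabelling f) (y : Weyl d) :
    ∃ p y' : Weyl d, Pres f p ∧ Inc f y' ∧ y = p * y' := by
  obtain ⟨p, hp, hmin⟩ : ∃ p ∈ {p : Weyl d | Pres f p}, ∀ p' ∈ {p : Weyl d | Pres f p},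
      len (p⁻¹ * y) ≤ len (p'⁻¹ * y) :=
    Set.exists_min_image _ (fun p => len (p⁻¹ * y)) (Set.toFinite _) ⟨1, Pres.one⟩
  refine ⟨p, p⁻¹ * y, hp, Inc.of_len_le hf fun i hi => ?_, by simp⟩
  have := hmin (p * simple i) (hp.mul hi)
  simpa [mul_assoc, simple_inv] using this

/-- Without a left descent among the simple reflections of `W_f`, the element would be a minimal
representative of the trivial coset, hence `1`. So reduced words can be chosen inside `W_f`, which
gives `Pres.induction`. -/
theorem Pres.exists_simple (hf : IsLabelling f) {w : Weyl d} (hw : Pres f w) (h1 : w ≠ 1) :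
    ∃ i w', Pres f (simple i) ∧ Pres f w' ∧ w = simple i * w' ∧ len w = len w' + 1 ∧
      (w'⁻¹).1 (leftEnd i) < (w'⁻¹).1 (rightEnd i) := by
  by_contra! hc
  refine h1 (Inc.eq_one (y := 1) hf hw Inc.one ?_)
  rw [mul_one]
  refine Inc.of_len_le hf fun i hi => ?_
  rcases (w⁻¹).lt_or_gt i with h | h
  · rw [len_simple_mul h]; omega
  · exfalso
    refine (hc i (simple i * w) hi (hi.mul hw) ?_ (len_simple_mul_of_gt h)).not_gt ?_
    · rw [← mul_assoc, simple_mul_self, one_mul]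
    · simpa [mul_inv_rev, simple_inv, simple_apply_leftEnd, simple_apply_rightEnd] using h

end Labelling

/-! ### The block labelling of a composition -/

theorem psum_mono (c : Comp m n d) {k l : ℕ} (h : k ≤ l) : psum c k ≤ psum c l := by
  unfold psum
  apply Finset.sum_le_sum_of_subset
  intro j
  simp only [Finset.mem_filter, Finset.mem_univ, true_and]
  omega

theorem psum_of_le (c : Comp m n d) {k : ℕ} (h : m + n ≤ k) : psum c k = d := by
  refine (Finset.sum_congr (Finset.filter_true_of_mem fun j _ => ?_) fun _ _ => rfl).trans c.2
  have := j.2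
  omega

theorem psum_le (c : Comp m n d) (k : ℕ) : psum c k ≤ d := by
  exact (psum_mono c (le_max_right (m + n) k)).trans (psum_of_le c (le_max_left _ _)).le

theorem psum_succ (c : Comp m n d) {k : ℕ} (hk : k + 1 < m + n + 1) :
    psum c (k + 1) = psum c k + c.1 ⟨k + 1, hk⟩ := by
  unfold psum
  rw [show ({j | j.1 ≤ k + 1} : Finset (Fin (m + n + 1))) =
    insert (⟨k + 1, hk⟩ : Fin (m + n + 1)) ({j | j.1 ≤ k} : Finset (Fin (m + n + 1))) by
      ext j
      simp only [Finset.mem_filter, Finset.mem_univ, true_and, Finset.mem_insert, Fin.ext_iff]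
      omega, Finset.sum_insert, add_comm]
  simp

theorem psum_zero (c : Comp m n d) : psum c 0 = c.1 0 := by
  unfold psum
  rw [show ({j | j.1 ≤ 0} : Finset (Fin (m + n + 1))) = {0} by
      ext j
      simp only [Finset.mem_filter, Finset.mem_univ, true_and, Finset.mem_singleton, Fin.ext_iff]
      simp]
  simp

theorem comp_ext {a b : Comp m n d} (h : ∀ k < m + n, psum a k = psum b k) : a = b := by
  have h' : ∀ k, psum a k = psum b k := fun k => by
    by_cases hk : k < m + n
    · exact h k hk
    · rw [psum_of_le a (not_lt.1 hk), psum_of_le b (not_lt.1 hk)]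
  apply Subtype.ext
  funext ⟨k, hk⟩
  cases k with
  | zero =>
    have := h' 0
    rwa [psum_zero, psum_zero] at this
  | succ k =>
    have h1 := h' k
    have h2 := h' (k + 1)
    rw [psum_succ a hk, psum_succ b hk] at h2
    omega

/-- The number of partial sums smaller than `x`. -/
def below (c : Comp m n d) (x : ℤ) : ℕ := Finset.card {k ∈ Finset.range (m + n) | (psum c k : ℤ) < x}

theorem below_le (c : Comp m n d) (x : ℤ) : below c x ≤ m + n := by
  unfold below
  exact (Finset.card_filter_le _ _).trans (by simp)

theorem below_mono (c : Comp m n d) {x y : ℤ} (h : x ≤ y) : below c x ≤ below c y := by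
  unfold below
  apply Finset.card_le_card
  intro k
  simp only [Finset.mem_filter]
  rintro ⟨h1, h2⟩
  exact ⟨h1, h2.trans_le h⟩

/-- Partial sums increase, so the indices counted by `below` form an initial segment. -/
theorem lt_below_iff (c : Comp m n d) (x : ℤ) (k : ℕ) :
    k < below c x ↔ k < m + n ∧ (psum c k : ℤ) < x := by
  unfold below
  constructor
  · intro h
    by_contra hc
    have : Finset.filter (fun l => (psum c l : ℤ) < x) (Finset.range (m + n)) ⊆ Finset.range k := by
      intro l
      simp only [Finset.mem_filter, Finset.mem_range]
      rintro ⟨h1, h2⟩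
      by_contra hl
      have := psum_mono c (not_lt.1 hl)
      exact hc ⟨by omega, by omega⟩
    have := Finset.card_le_card this
    simp only [Finset.card_range] at this
    omega
  · rintro ⟨h1, h2⟩
    have : Finset.range (k + 1) ⊆ Finset.filter (fun l => (psum c l : ℤ) < x) (Finset.range (m + n)) := by
      intro l
      simp only [Finset.mem_filter, Finset.mem_range]
      intro hl
      have := psum_mono c (show l ≤ k by omega)
      exact ⟨by omega, by omega⟩
    have := Finset.card_le_card this
    simp only [Finset.card_range] at this
    omega

theorem below_of_nonpos (c : Comp m n d) {x : ℤ} (h : x ≤ 0) : below c x = 0 := by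
  by_contra hc
  have := (lt_below_iff c x 0).1 (Nat.pos_of_ne_zero hc)
  omega

/-- The index of the interval `R_i^c` that contains `x`. -/
def lab (c : Comp m n d) (x : SymInt d) : Idx m n :=
  ⟨(below c x.1 : ℤ) - below c (-x.1), by
    have h1 := below_le c x.1
    have h2 := below_le c (-x.1)
    simp only [Set.mem_Icc]
    push_cast
    omega⟩

theorem coe_lab (c : Comp m n d) (x : SymInt d) :
    (lab c x).1 = (below c x.1 : ℤ) - below c (-x.1) := rfl

theorem coe_lab_of_nonneg (c : Comp m n d) {x : SymInt d} (h : 0 ≤ x.1) :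
    (lab c x).1 = below c x.1 := by
  rw [coe_lab, below_of_nonpos c (show -x.1 ≤ 0 by omega)]
  simp

theorem lab_mono (c : Comp m n d) : Monotone (lab c) := by
  intro x y h
  rw [← Subtype.coe_le_coe] at h ⊢
  rw [coe_lab, coe_lab]
  have h1 := below_mono c h
  have h2 := below_mono c (show -y.1 ≤ -x.1 by omega)
  omega

theorem lab_opp (c : Comp m n d) (x : SymInt d) : lab c x.opp = (lab c x).opp := by
  ext
  simp only [SymInt.coe_opp, coe_lab, neg_neg]
  omega

theorem lab_origin (c : Comp m n d) : lab c (SymInt.origin d) = SymInt.origin (m + n) := by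
  ext
  simp [coe_lab]

theorem lab_nonneg {c : Comp m n d} {x : SymInt d} (h : 0 ≤ x.1) : 0 ≤ (lab c x).1 := by
  rw [coe_lab_of_nonneg c h]; omega

theorem lab_nonpos {c : Comp m n d} {x : SymInt d} (h : x.1 ≤ 0) : (lab c x).1 ≤ 0 := by
  have := lab_nonneg (c := c) (x := x.opp) (by simpa using h)
  rw [lab_opp] at this
  simpa using this

theorem isLabelling_lab (c : Comp m n d) : IsLabelling (lab c) where
  convex h1 h2 h := le_antisymm ((lab_mono c h2).trans h.ge) (lab_mono c h1)
  opp h := by rw [lab_opp, lab_opp, h]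

theorem lab_eq_iff (c : Comp m n d) {x y : SymInt d} (h : x ≤ y) : lab c x = lab c y ↔
    ∀ k < m + n, ((psum c k : ℤ) < y.1 → (psum c k : ℤ) < x.1) ∧
      ((psum c k : ℤ) < -x.1 → (psum c k : ℤ) < -y.1) := by
  rw [← Subtype.coe_le_coe] at h
  have h1 := below_mono c h
  have h2 := below_mono c (show -y.1 ≤ -x.1 by omega)
  rw [Subtype.ext_iff, coe_lab, coe_lab]
  constructor
  · intro he k hk
    have e1 : below c x.1 = below c y.1 := by omega
    have e2 : below c (-x.1) = below c (-y.1) := by omega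
    constructor
    · intro hy
      exact ((lt_below_iff c _ k).1 (e1 ▸ (lt_below_iff c _ k).2 ⟨hk, hy⟩)).2
    · intro hy
      exact ((lt_below_iff c _ k).1 (e2 ▸ (lt_below_iff c _ k).2 ⟨hk, hy⟩)).2
  · intro hk
    have e1 : below c y.1 ≤ below c x.1 := by
      by_contra hc
      rw [not_le, lt_below_iff] at hc
      have := (lt_below_iff c _ _).2 ⟨hc.1, (hk _ hc.1).1 hc.2⟩
      omega
    have e2 : below c (-x.1) ≤ below c (-y.1) := by
      by_contra hc
      rw [not_le, lt_below_iff] at hc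
      have := (lt_below_iff c _ _).2 ⟨hc.1, (hk _ hc.1).2 hc.2⟩
      omega
    omega

theorem abs_coe_lab (c : Comp m n d) (x : SymInt d) : |(lab c x).1| = below c |x.1| := by
  rcases le_total 0 x.1 with h | h
  · rw [coe_lab_of_nonneg c h, abs_of_nonneg h]; simp
  · have := coe_lab_of_nonneg c (x := x.opp) (by simpa using h)
    rw [lab_opp] at this
    simp only [SymInt.coe_opp] at this
    rw [abs_of_nonpos h, ← this, abs_of_nonpos (by omega)]

theorem isOddIdx_lab (c : Comp m n d) (x : SymInt d) :
    IsOddIdx (lab c x) ↔ (psum c m : ℤ) < |x.1| := by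
  unfold IsOddIdx
  rw [abs_coe_lab]
  have h := lt_below_iff c |x.1| m
  rw [Nat.cast_lt, h]
  constructor
  · exact fun h => h.2
  · intro h1
    refine ⟨?_, h1⟩
    by_contra hn
    have h2 := psum_of_le c (show m + n ≤ m by omega)
    have h3 := x.2
    simp only [Set.mem_Icc] at h3
    rw [lt_abs] at h1
    omega

theorem IsOddIdx.opp {i : Idx m n} : IsOddIdx i.opp ↔ IsOddIdx i := by
  simp [IsOddIdx]

theorem mem_interval (c : Comp m n d) (i : Idx m n) (x : SymInt d) :
    x ∈ interval c i ↔ lab c x = i := by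
  have hx := x.2
  have hi := i.2
  simp only [Set.mem_Icc] at hx hi
  unfold interval
  simp only [Set.mem_ofPred_eq, Subtype.ext_iff, coe_lab]
  have hp := below_le c x.1
  have hn := below_le c (-x.1)
  -- Only the indices `k < m + n` are counted, so the last block has no bound of its own: its upper
  -- end is `d`, whence the assumption `y ≤ d`.
  have key : ∀ y : ℤ, ∀ k : ℕ, y ≤ d → 
      (below c y = k + 1 ∧ k + 1 ≤ m + n ↔ k + 1 ≤ m + n ∧ (psum c k : ℤ) < y ∧ y ≤ psum c (k + 1)) := by
    intro y k hy
    have h1 := lt_below_iff c y k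
    have h2 := lt_below_iff c y (k + 1)
    have h3 := below_le c y
    by_cases hk : k + 1 < m + n
    · omega
    · by_cases hk' : k + 1 = m + n
      · have := psum_of_le c hk'.ge
        omega
      · omega
  have key0 : ∀ y : ℤ, y ≤ d → (below c y = 0 ↔ y ≤ psum c 0) := by
    intro y hy
    have h1 := lt_below_iff c y 0
    by_cases hk : 0 < m + n
    · omega
    · have := psum_of_le c (show m + n ≤ 0 by omega)
      have := below_le c y
      omega
  split_ifs with h0 hpos
  · have h1 := key0 x.1 (by omega)
    have h2 := key0 (-x.1) (by omega)
    rw [h0, abs_le]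
    rcases le_total 0 x.1 with h | h
    · have := below_of_nonpos c (show -x.1 ≤ 0 by omega); omega
    · have := below_of_nonpos c h; omega
  · obtain ⟨k, hk⟩ : ∃ k : ℕ, i.1 = k + 1 := ⟨(i.1 - 1).toNat, by omega⟩
    have e1 : (i.1 - 1).toNat = k := by omega
    have e2 : i.1.toNat = k + 1 := by omega
    rw [e1, e2]
    have h1 := key x.1 k (by omega)
    rcases le_total 0 x.1 with h | h
    · have := below_of_nonpos c (show -x.1 ≤ 0 by omega); omega
    · have := below_of_nonpos c h; omega
  · obtain ⟨k, hk⟩ : ∃ k : ℕ, -i.1 = k + 1 := ⟨(-i.1 - 1).toNat, by omega⟩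
    have e1 : (-i.1 - 1).toNat = k := by omega
    have e2 : (-i.1).toNat = k + 1 := by omega
    rw [e1, e2]
    have h1 := key (-x.1) k (by omega)
    rcases le_total 0 x.1 with h | h
    · have := below_of_nonpos c (show -x.1 ≤ 0 by omega); omega
    · have := below_of_nonpos c h; omega

/-! ### Parabolic subgroups -/

theorem pres_simple_of_lab_eq {α : Type*} {f : SymInt d → α} (hf : IsLabelling f) {i : Fin d}
    (h : f (leftEnd i) = f (rightEnd i)) : Pres f (simple i) := by
  have hopp := hf.opp h
  intro x
  by_cases e1 : x = leftEnd i
  · rw [e1, simple_apply_leftEnd, h]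
  by_cases e2 : x = rightEnd i
  · rw [e2, simple_apply_rightEnd, h]
  by_cases e3 : x = (leftEnd i).opp
  · rw [e3, Weyl.map_opp, simple_apply_leftEnd, hopp]
  by_cases e4 : x = (rightEnd i).opp
  · rw [e4, Weyl.map_opp, simple_apply_rightEnd, hopp]
  congr 1
  simp only [Subtype.ext_iff, coe_simple_apply, leftEnd, rightEnd, SymInt.coe_opp] at *
  split_ifs at * <;> omega

theorem pres_lab_simple (c : Comp m n d) (i : Fin d) : Pres (lab c) (simple i) ↔ allowed c i := by
  have h : lab c (leftEnd i) = lab c (rightEnd i) ↔ allowed c i := by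
    rw [lab_eq_iff c (leftEnd_lt_rightEnd i).le]
    unfold allowed
    refine forall_congr' fun k => forall_congr' fun hk => ?_
    simp only [leftEnd, rightEnd]
    split_ifs <;> omega
  rw [← h]
  constructor
  · intro hp
    rw [← hp (leftEnd i), simple_apply_leftEnd]
  · exact pres_simple_of_lab_eq (isLabelling_lab c)

/-- The subgroup of elements that preserve a labelling. -/
def presSubgroup {α : Type*} (f : SymInt d → α) : Subgroup (Weyl d) where
  carrier := {w | Pres f w}
  mul_mem' h h' := h.mul h'
  one_mem' := Pres.one
  inv_mem' h := h.inv

theorem Pres.induction {α : Type*} {f : SymInt d → α} (hf : IsLabelling f)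
    {motive : Weyl d → Prop} (one : motive 1)
    (simple_mul : ∀ i w, Pres f (simple i) → Pres f w → len (simple i * w) = len w + 1 →
      (w⁻¹).1 (leftEnd i) < (w⁻¹).1 (rightEnd i) → motive w → motive (simple i * w))
    {w : Weyl d} (hw : Pres f w) : motive w := by
  generalize hk : len w = k
  induction k generalizing w with
  | zero => rw [eq_one_of_len_eq_zero hk]; exact one
  | succ k ih =>
    have h1 : w ≠ 1 := by
      rintro rfl
      rw [len_eq_ninv, ninv_one] at hk
      omega
    obtain ⟨i, w', h2, h3, rfl, h5, h6⟩ := hw.exists_simple hf h1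
    exact simple_mul i w' h2 h3 h5 h6 (ih h3 (by omega))

theorem mem_parabolic {c : Comp m n d} {w : Weyl d} : w ∈ parabolic c ↔ Pres (lab c) w := by
  constructor
  · intro h
    have : parabolic c ≤ presSubgroup (lab c) := by
      unfold parabolic
      rw [Subgroup.closure_le]
      rintro _ ⟨i, hi, rfl⟩
      exact (pres_lab_simple c i).2 hi
    exact this h
  · intro h
    refine Pres.induction (isLabelling_lab c) (one_mem _) ?_ h
    intro i w hi _ _ _ hw
    exact mul_mem (Subgroup.subset_closure ⟨i, (pres_lab_simple c i).1 hi, rfl⟩) hw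

/-- The subgroup of elements that fix a set pointwise. -/
def fixSubgroup (S : SymInt d → Prop) : Subgroup (Weyl d) where
  carrier := {w | ∀ x, S x → w.1 x = x}
  mul_mem' h h' x hx := by rw [Weyl.mul_apply, h' x hx, h x hx]
  one_mem' _ _ := rfl
  inv_mem' h x hx := by rw [Weyl.inv_eq_iff, h x hx]

/-- Membership in the even or odd part is used only through these two consequences: the blocks are
preserved and the points of the other parity are fixed. -/
theorem parabolicEven_le (c : Comp m n d) : parabolicEven c ≤
    presSubgroup (lab c) ⊓ fixSubgroup (fun x => IsOddIdx (lab c x)) := by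
  unfold parabolicEven
  rw [Subgroup.closure_le]
  rintro _ ⟨i, hi, hm, rfl⟩
  refine ⟨(pres_lab_simple c i).2 hi, fun x hx => ?_⟩
  simp only at hx
  rw [isOddIdx_lab, lt_abs] at hx
  ext
  rw [coe_simple_apply]
  split_ifs <;> omega

theorem parabolicOdd_le (c : Comp m n d) : parabolicOdd c ≤
    presSubgroup (lab c) ⊓ fixSubgroup (fun x => ¬ IsOddIdx (lab c x)) := by
  unfold parabolicOdd
  rw [Subgroup.closure_le]
  rintro _ ⟨i, hi, hm, rfl⟩
  refine ⟨(pres_lab_simple c i).2 hi, fun x hx => ?_⟩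
  simp only at hx
  rw [isOddIdx_lab, not_lt, abs_le] at hx
  ext
  rw [coe_simple_apply]
  split_ifs <;> omega

theorem pres_of_mem_even {c : Comp m n d} {u : Weyl d} (hu : u ∈ parabolicEven c) : Pres (lab c) u :=
  (parabolicEven_le c hu).1

theorem pres_of_mem_odd {c : Comp m n d} {u : Weyl d} (hu : u ∈ parabolicOdd c) : Pres (lab c) u :=
  (parabolicOdd_le c hu).1

theorem apply_of_mem_even {c : Comp m n d} {u : Weyl d} (hu : u ∈ parabolicEven c) {x : SymInt d}
    (hx : IsOddIdx (lab c x)) : u.1 x = x :=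
  (parabolicEven_le c hu).2 x hx

theorem apply_of_mem_odd {c : Comp m n d} {u : Weyl d} (hu : u ∈ parabolicOdd c) {x : SymInt d}
    (hx : ¬ IsOddIdx (lab c x)) : u.1 x = x :=
  (parabolicOdd_le c hu).2 x hx

theorem commute_of_even_odd {c : Comp m n d} {u w : Weyl d} (hu : u ∈ parabolicEven c)
    (hw : w ∈ parabolicOdd c) : u * w = w * u := by
  apply Weyl.ext'
  intro x
  simp only [Weyl.mul_apply]
  by_cases hx : IsOddIdx (lab c x)
  · rw [apply_of_mem_even hu hx, apply_of_mem_even hu (by rwa [pres_of_mem_odd hw])]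
  · rw [apply_of_mem_odd hw hx, apply_of_mem_odd hw (by rwa [pres_of_mem_even hu])]

theorem Pres.exists_factor {c : Comp m n d} {w : Weyl d} (hw : Pres (lab c) w) :
    ∃ u ∈ parabolicEven c, ∃ v ∈ parabolicOdd c, w = u * v := by
  refine Pres.induction (motive := fun w => ∃ u ∈ parabolicEven c, ∃ v ∈ parabolicOdd c, w = u * v)
    (isLabelling_lab c) ⟨1, one_mem _, 1, one_mem _, by simp⟩ ?_ hw
  rintro i w hi _ _ _ ⟨u, hu, v, hv, rfl⟩
  have ha := (pres_lab_simple c i).1 hi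
  rcases lt_trichotomy i.1 (psum c m) with h | h | h
  · exact ⟨simple i * u, mul_mem (Subgroup.subset_closure ⟨i, ha, h, rfl⟩) hu, v, hv, by
      rw [mul_assoc]⟩
  -- The reflection at `i = psum c m` is excluded from `W_c` if `n > 0`, and does not exist if `n =
  -- 0`, since then `psum c m = d`.
  · exfalso
    by_cases hn : m < m + n
    · exact ha m hn h
    · have := psum_of_le c (not_lt.1 hn)
      have := i.2
      omega
  · have hs : simple i ∈ parabolicOdd c := Subgroup.subset_closure ⟨i, ha, h, rfl⟩
    refine ⟨u, hu, simple i * v, mul_mem hs hv, ?_⟩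
    rw [← mul_assoc, ← mul_assoc, commute_of_even_odd hu hs]

theorem even_odd_factor_unique {c : Comp m n d} {u u' v v' : Weyl d} (hu : u ∈ parabolicEven c)
    (hu' : u' ∈ parabolicEven c) (hv : v ∈ parabolicOdd c) (hv' : v' ∈ parabolicOdd c)
    (h : u * v = u' * v') : u = u' ∧ v = v' := by
  have h1 : u'⁻¹ * u = v' * v⁻¹ := by
    rw [inv_mul_eq_iff_eq_mul, ← mul_assoc, eq_mul_inv_iff_mul_eq, h]
  have h2 : u'⁻¹ * u = 1 := by
    apply Weyl.ext'
    intro x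
    by_cases hx : IsOddIdx (lab c x)
    · exact apply_of_mem_even (mul_mem (inv_mem hu') hu) hx
    · rw [h1]; exact apply_of_mem_odd (mul_mem hv' (inv_mem hv)) hx
  have h3 : u = u' := by rw [inv_mul_eq_one] at h2; exact h2.symm
  subst h3
  exact ⟨rfl, mul_left_cancel h⟩

/-! ### Double cosets and matrices -/

theorem card_kappa (a b : Comp m n d) (g : Weyl d) (i j : Idx m n) :
    kappa a g b i j = Finset.card {x | lab b x = j ∧ lab a (g.1 x) = i} := by
  have : interval a i ∩ (fun x => g.1 x) '' interval b j =
      (fun x => g.1 x) '' ({x | lab b x = j ∧ lab a (g.1 x) = i} : Finset (SymInt d)) := by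
    ext y
    simp only [Set.mem_inter_iff, mem_interval, Set.mem_image, Finset.coe_filter, Finset.mem_univ,
      true_and, Set.mem_ofPred_eq]
    constructor
    · rintro ⟨h, x, hx, rfl⟩
      exact ⟨x, ⟨hx, h⟩, rfl⟩
    · rintro ⟨x, ⟨hx, h⟩, rfl⟩
      exact ⟨h, x, hx, rfl⟩
  simp only [kappa, Matrix.of_apply]
  rw [this, Set.ncard_image_of_injective _ (fun x y h => g.apply_inj.1 h), Set.ncard_coe_finset]

theorem kappa_eq_of_lab {a a' b b' : Comp m n d} {g g' : Weyl d} (hb : ∀ x, lab b x = lab b' x)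
    (ha : ∀ x, lab a (g.1 x) = lab a' (g'.1 x)) : kappa a g b = kappa a' g' b' := by
  ext i j
  rw [card_kappa, card_kappa]
  simp only [hb, ha]

theorem kappa_mul_left {a b : Comp m n d} {p g : Weyl d} (hp : Pres (lab a) p) :
    kappa a (p * g) b = kappa a g b :=
  kappa_eq_of_lab (fun _ => rfl) fun x => hp (g.1 x)

theorem kappa_inv (a b : Comp m n d) (g : Weyl d) (i j : Idx m n) :
    kappa a g⁻¹ b i j = kappa b g a j i := by
  rw [card_kappa, card_kappa]
  apply Finset.card_nbij' (fun x => (g⁻¹).1 x) (fun x => g.1 x)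
  · intro x
    simp only [Finset.coe_filter, Finset.mem_univ, true_and, Set.mem_ofPred_eq]
    rintro ⟨h1, h2⟩
    exact ⟨h2, by simpa using h1⟩
  · intro x
    simp only [Finset.coe_filter, Finset.mem_univ, true_and, Set.mem_ofPred_eq]
    rintro ⟨h1, h2⟩
    exact ⟨h2, by simpa using h1⟩
  · intro x _; simp
  · intro x _; simp

theorem kappa_mul_right {a b : Comp m n d} {p g : Weyl d} (hp : Pres (lab b) p) :
    kappa a (g * p) b = kappa a g b := by
  ext i j
  rw [← inv_inv (g * p), kappa_inv, mul_inv_rev, kappa_mul_left hp.inv, kappa_inv]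

theorem sum_kappa_row (a b : Comp m n d) (g : Weyl d) (i : Idx m n) :
    ∑ j, kappa a g b i j = Finset.card {x | lab a x = i} := by
  classical
  simp only [card_kappa]
  rw [show Finset.card {x | lab a x = i} = Finset.card {x | lab a (g.1 x) = i} from ?_]
  · rw [Finset.card_eq_sum_card_fiberwise (f := lab b) (t := Finset.univ) (by simp)]
    refine Finset.sum_congr rfl fun j _ => ?_
    rw [Finset.filter_filter]
    congr 1
    ext x
    simp [and_comm]
  · apply Finset.card_nbij' (fun x => (g⁻¹).1 x) (fun x => g.1 x) <;> intro x <;> simp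

theorem sum_kappa_col (a b : Comp m n d) (g : Weyl d) (j : Idx m n) :
    ∑ i, kappa a g b i j = Finset.card {x | lab b x = j} := by
  rw [← sum_kappa_row b a g⁻¹ j]
  simp only [kappa_inv]

/-- Monotone functions on a finite set are determined by the sizes of their fibres. -/
theorem eq_of_monotoneOn_of_card_fiber {α β : Type*} [LinearOrder α] [LinearOrder β] [Fintype β]
    {S : Finset α} {f f' : α → β} (hf : ∀ x ∈ S, ∀ y ∈ S, x ≤ y → f x ≤ f y)
    (hf' : ∀ x ∈ S, ∀ y ∈ S, x ≤ y → f' x ≤ f' y)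
    (h : ∀ j, Finset.card {x ∈ S | f x = j} = Finset.card {x ∈ S | f' x = j}) :
    ∀ x ∈ S, f x = f' x := by
  have hle : ∀ j, Finset.card {x ∈ S | f x ≤ j} = Finset.card {x ∈ S | f' x ≤ j} := by
    intro j
    have hg : ∀ g : α → β, Finset.card {x ∈ S | g x ≤ j} =
        ∑ i with i ≤ j, Finset.card {x ∈ S | g x = i} := by
      intro g
      rw [Finset.card_eq_sum_card_fiberwise (f := g) (t := {i | i ≤ j})]
      · refine Finset.sum_congr rfl fun i hi => ?_
        rw [Finset.filter_filter]
        congr 1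
        ext x
        simp only [Finset.mem_filter, Finset.mem_univ, true_and] at hi ⊢
        constructor
        · rintro ⟨a, b, c⟩; exact ⟨a, c⟩
        · rintro ⟨a, rfl⟩; exact ⟨a, hi, rfl⟩
      · intro x; simp
    rw [hg, hg]
    exact Finset.sum_congr rfl fun i _ => h i
  -- If `g x < g' x`, monotonicity makes `{g' ≤ g x}` a proper subset of `{g ≤ g x}`, since `x` lies
  -- only in the latter; this contradicts equal cardinalities.
  have key : ∀ g g' : α → β, (∀ x ∈ S, ∀ y ∈ S, x ≤ y → g x ≤ g y) →
      (∀ x ∈ S, ∀ y ∈ S, x ≤ y → g' x ≤ g' y) →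
      (∀ j, Finset.card {x ∈ S | g x ≤ j} = Finset.card {x ∈ S | g' x ≤ j}) →
      ∀ x ∈ S, ¬ g x < g' x := by
    intro g g' hg hg' hc x hx hlt
    have hss : Finset.filter (fun y => g' y ≤ g x) S ⊂ Finset.filter (fun y => g y ≤ g x) S := by
      rw [Finset.ssubset_iff_of_subset]
      · exact ⟨x, by simp [hx], by simp [hx, hlt]⟩
      · intro y
        simp only [Finset.mem_filter]
        rintro ⟨hy, h1⟩
        refine ⟨hy, hg y hy x hx ?_⟩
        by_contra hyx
        exact (hlt.trans_le (hg' x hx y hy (not_le.1 hyx).le)).not_ge h1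
    exact (Finset.card_lt_card hss).ne (hc _).symm
  intro x hx
  rcases lt_trichotomy (f x) (f' x) with h1 | h1 | h1
  · exact absurd h1 (key f f' hf hf' hle x hx)
  · exact h1
  · exact absurd h1 (key f' f hf' hf (fun j => (hle j).symm) x hx)

theorem comp_eq_of_lab {a b : Comp m n d} (h : ∀ x, lab a x = lab b x) : a = b := by
  have key : ∀ a b : Comp m n d, (∀ x, lab a x = lab b x) → ∀ k < m + n, psum a k ≤ psum b k := by
    intro a b h k hk
    by_contra hc
    rw [not_le] at hc
    have hd := psum_le a k
    have h1 := h ⟨psum a k, by simp only [Set.mem_Icc]; omega⟩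
    rw [Subtype.ext_iff, coe_lab_of_nonneg _ (by simp), coe_lab_of_nonneg _ (by simp)] at h1
    have h2 := lt_below_iff a (psum a k) k
    have h3 := lt_below_iff b (psum a k) k
    simp only at h1
    omega
  exact comp_ext fun k hk => le_antisymm (key a b h k hk) (key b a (fun x => (h x).symm) k hk)

theorem comp_eq_of_card {a b : Comp m n d}
    (h : ∀ i, Finset.card {x | lab a x = i} = Finset.card {x | lab b x = i}) : a = b :=
  comp_eq_of_lab fun x => eq_of_monotoneOn_of_card_fiber (S := Finset.univ)
    (fun _ _ _ _ hxy => lab_mono a hxy) (fun _ _ _ _ hxy => lab_mono b hxy) h x (Finset.mem_univ x)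

theorem Inc.mono_lab {a b : Comp m n d} {y : Weyl d} (hy : Inc (lab a) y) {u v : SymInt d} (huv : u ≤ v)
    (h : lab a u = lab a v) : lab b ((y⁻¹).1 u) ≤ lab b ((y⁻¹).1 v) := by
  rcases huv.eq_or_lt with rfl | h1
  · exact le_rfl
  · exact lab_mono b (hy u v h1 h).le

/-- Two minimal coset representatives with the same matrix differ by an element of `W_b`. -/
theorem pres_of_kappa_eq {a b : Comp m n d} {g y : Weyl d} (hg : Inc (lab a) g)
    (hy : Inc (lab a) y) (h : kappa a g b = kappa a y b) : Pres (lab b) (g⁻¹ * y) := by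
  -- On each block of `a`, both `z ↦ lab b (g⁻¹ z)` and `z ↦ lab b (y⁻¹ z)` are monotone, with fibre
  -- sizes given by a row of the matrix; so they coincide.
  have key : ∀ z, lab b ((g⁻¹).1 z) = lab b ((y⁻¹).1 z) := by
    intro z
    refine eq_of_monotoneOn_of_card_fiber (S := {x | lab a x = lab a z})
      (f := fun z => lab b ((g⁻¹).1 z)) (f' := fun z => lab b ((y⁻¹).1 z)) ?_ ?_ ?_ z (by simp)
    · intro u hu v hv huv
      simp only [Finset.mem_filter, Finset.mem_univ, true_and] at hu hv
      exact hg.mono_lab huv (hu.trans hv.symm)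
    · intro u hu v hv huv
      simp only [Finset.mem_filter, Finset.mem_univ, true_and] at hu hv
      exact hy.mono_lab huv (hu.trans hv.symm)
    · intro j
      have h1 := congrFun (congrFun h (lab a z)) j
      rw [← kappa_inv b a g, ← kappa_inv b a y, card_kappa, card_kappa] at h1
      simp only [Finset.filter_filter]
      convert h1
  intro x
  rw [Weyl.mul_apply, key, Weyl.inv_apply_self]

theorem inc_of_mem_doubleReps {a b : Comp m n d} {g : Weyl d} (hg : g ∈ doubleReps a b) :
    Inc (lab a) g ∧ Inc (lab b) g⁻¹ := by
  constructor
  · refine Inc.of_len_le (isLabelling_lab a) fun i hi => ?_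
    simpa using hg (simple i) (mem_parabolic.2 hi) 1 (one_mem _)
  · refine Inc.of_len_le (isLabelling_lab b) fun i hi => ?_
    have := hg 1 (one_mem _) (simple i) (mem_parabolic.2 hi)
    rw [len_inv, ← len_inv (simple i * g⁻¹)]
    simpa [mul_inv_rev, simple_inv] using this

/-- Every double coset contains an element of minimal length. -/
theorem exists_doubleRep (a b : Comp m n d) (y : Weyl d) :
    ∃ g ∈ doubleReps a b, kappa a g b = kappa a y b := by
  obtain ⟨p, hp, hmin⟩ := Set.exists_min_image
    {p : Weyl d × Weyl d | p.1 ∈ parabolic a ∧ p.2 ∈ parabolic b}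
    (fun p => len (p.1 * y * p.2)) (Set.toFinite _) ⟨(1, 1), one_mem _, one_mem _⟩
  refine ⟨p.1 * y * p.2, ?_, ?_⟩
  · intro u hu v hv
    have := hmin (u * p.1, p.2 * v) ⟨mul_mem hu hp.1, mul_mem hp.2 hv⟩
    simpa [mul_assoc] using this
  · rw [kappa_mul_right (mem_parabolic.1 hp.2), kappa_mul_left (mem_parabolic.1 hp.1)]

/-! ### Weights of inversions -/

theorem ninv_congr_of {Q Q' : SymInt d → SymInt d → Prop} {w w' : Weyl d}
    (h : ∀ x y, x < y → (w.1 y < w.1 x ∧ Q x y ↔ w'.1 y < w'.1 x ∧ Q' x y)) :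
    ninv Q w = ninv Q' w' := by
  classical
  unfold ninv
  congr 1
  ext p
  simp only [Finset.mem_filter, Finset.mem_univ, true_and]
  constructor
  · rintro ⟨h1, h2, h3, h4⟩; exact ⟨h1, h2, h3, (h _ _ h3).1 h4⟩
  · rintro ⟨h1, h2, h3, h4⟩; exact ⟨h1, h2, h3, (h _ _ h3).2 h4⟩

theorem ninv_eq_zero {Q : SymInt d → SymInt d → Prop} {w : Weyl d}
    (h : ∀ x y, x ≠ SymInt.origin d → y.opp ≤ x → x < y → w.1 y < w.1 x → ¬ Q x y) :
    ninv Q w = 0 := by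
  classical
  simp only [ninv, Finset.card_eq_zero]
  ext p
  simp only [Finset.mem_filter, Finset.mem_univ, true_and, Finset.notMem_empty, iff_false]
  rintro ⟨a, b, c, e, f⟩
  exact h _ _ a b c e f

theorem ninv_simple_of_not {Q : SymInt d → SymInt d → Prop} (i : Fin d)
    (h : ¬ Q (leftEnd i) (rightEnd i)) : ninv Q (simple i) = 0 := by
  refine ninv_eq_zero fun x y a b c e f => ?_
  have h1 := simple_inversion c e
  have : x = leftEnd i ∧ y = rightEnd i := by
    clear e f h
    simp only [← Subtype.coe_le_coe, ← Subtype.coe_lt_coe, ne_eq, Subtype.ext_iff, SymInt.coe_opp,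
        SymInt.coe_origin, leftEnd, rightEnd] at *
    split_ifs at * <;> omega
  rw [this.1, this.2] at f
  exact h f

/-- Both elements lie in the same odd block. -/
def SameOdd (c : Comp m n d) (x y : SymInt d) : Prop := lab c x = lab c y ∧ IsOddIdx (lab c x)

/-- Both elements lie in the same even block. -/
def SameEven (c : Comp m n d) (x y : SymInt d) : Prop := lab c x = lab c y ∧ ¬ IsOddIdx (lab c x)

theorem symRel_sameOdd (c : Comp m n d) : SymRel (SameOdd c) where
  swap h := ⟨h.1.symm, h.1 ▸ h.2⟩
  opp h := ⟨by rw [lab_opp, lab_opp, h.1], by rw [lab_opp, IsOddIdx.opp]; exact h.2⟩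

theorem symRel_sameEven (c : Comp m n d) : SymRel (SameEven c) where
  swap h := ⟨h.1.symm, h.1 ▸ h.2⟩
  opp h := ⟨by rw [lab_opp, lab_opp, h.1], by rw [lab_opp, IsOddIdx.opp]; exact h.2⟩

/-- `(-q)^{-k}`, where `k` is the number of inversions inside the odd blocks of `c`. -/
noncomputable def signWt (c : Comp m n d) (w : Weyl d) : ℤ[T;T⁻¹] := (-qinv) ^ ninv (SameOdd c) w

/-- The character of `W_c` by which its Hecke algebra acts on `[xy]_c`. -/
noncomputable def charWt (c : Comp m n d) (w : Weyl d) : ℤ[T;T⁻¹] :=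
  q ^ ninv (SameEven c) w * (-1) ^ ninv (SameOdd c) w

theorem sameOdd_pres {c : Comp m n d} {w : Weyl d} (hw : Pres (lab c) w) :
    (fun x y => SameOdd c (w.1 x) (w.1 y)) = SameOdd c := by
  funext x y
  simp only [SameOdd, hw x, hw y]

theorem sameEven_pres {c : Comp m n d} {w : Weyl d} (hw : Pres (lab c) w) :
    (fun x y => SameEven c (w.1 x) (w.1 y)) = SameEven c := by
  funext x y
  simp only [SameEven, hw x, hw y]

theorem signWt_mul {c : Comp m n d} {w w' : Weyl d} (hw' : Pres (lab c) w')
    (h : ∀ x y, x < y → w'.1 y < w'.1 x → w.1 (w'.1 y) < w.1 (w'.1 x)) :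
    signWt c (w * w') = signWt c w * signWt c w' := by
  unfold signWt
  rw [ninv_mul (symRel_sameOdd c) _ _ (fun x y a _ b => h x y a b), sameOdd_pres hw'.inv, pow_add]

theorem charWt_mul {c : Comp m n d} {w w' : Weyl d} (hw' : Pres (lab c) w')
    (h : ∀ x y, x < y → w'.1 y < w'.1 x → w.1 (w'.1 y) < w.1 (w'.1 x)) :
    charWt c (w * w') = charWt c w * charWt c w' := by
  unfold charWt
  rw [ninv_mul (symRel_sameOdd c) _ _ (fun x y a _ b => h x y a b), sameOdd_pres hw'.inv,
    ninv_mul (symRel_sameEven c) _ _ (fun x y a _ b => h x y a b), sameEven_pres hw'.inv]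
  ring

theorem simple_mul_noncancel {p : Weyl d} {i : Fin d}
    (h : (p⁻¹).1 (leftEnd i) < (p⁻¹).1 (rightEnd i)) {x y : SymInt d} (hxy : x < y)
    (hp : p.1 y < p.1 x) : (simple i).1 (p.1 y) < (simple i).1 (p.1 x) := by
  by_contra hc
  have h1 : (simple i).1 (p.1 x) < (simple i).1 (p.1 y) :=
    lt_of_le_of_ne (not_lt.1 hc) (by rw [ne_eq, Weyl.apply_inj, Weyl.apply_inj]; exact hxy.ne)
  have h2 := Weyl.lt_of_leftEnd_lt h (simple_inversion hp h1)
  simp only [Weyl.inv_apply_self] at h2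
  exact h2.asymm hxy

theorem q_mul_qinv : q * qinv = 1 := by
  unfold q qinv
  rw [← LaurentPolynomial.T_add]
  simp

theorem Pres.lab_eq_of_inversion {c : Comp m n d} {w : Weyl d} (hw : Pres (lab c) w) {x y : SymInt d}
    (h : x < y) (h' : w.1 y < w.1 x) : lab c x = lab c y := by
  by_contra hc
  exact h'.asymm ((hw.lt_iff (isLabelling_lab c) hc).2 h)

/-- An inversion of an element of the odd part lies inside an odd block. -/
theorem sameOdd_of_inversion {c : Comp m n d} {v : Weyl d} (hv : v ∈ parabolicOdd c) {x y : SymInt d}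
    (h : x < y) (h' : v.1 y < v.1 x) : SameOdd c x y := by
  have h1 := (pres_of_mem_odd hv).lab_eq_of_inversion h h'
  refine ⟨h1, ?_⟩
  by_contra hc
  rw [apply_of_mem_odd hv hc, apply_of_mem_odd hv (h1 ▸ hc)] at h'
  exact h.asymm h'

theorem even_odd_noncancel {c : Comp m n d} {u v : Weyl d} (hu : u ∈ parabolicEven c)
    (hv : v ∈ parabolicOdd c) {x y : SymInt d} (h : x < y) (h' : v.1 y < v.1 x) :
    u.1 (v.1 y) < u.1 (v.1 x) := by
  have h1 := sameOdd_of_inversion hv h h'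
  have h2 := pres_of_mem_odd hv
  rwa [apply_of_mem_even hu (x := v.1 x) (by rw [h2]; exact h1.2),
    apply_of_mem_even hu (x := v.1 y) (by rw [h2]; exact h1.1 ▸ h1.2)]

/-- Thus `signWt`, defined on all of `W`, extends the coefficient `(-q)^{-ℓ(w^{(1)})}` from `W_c`.
-/
theorem signWt_even_mul_odd {c : Comp m n d} {u v : Weyl d} (hu : u ∈ parabolicEven c)
    (hv : v ∈ parabolicOdd c) : signWt c (u * v) = (-qinv) ^ len v := by
  unfold signWt
  congr 1
  rw [len_eq_ninv]
  apply ninv_congr_of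
  intro x y hxy
  have h2 := pres_of_mem_odd hv
  constructor
  · rintro ⟨h3, h4⟩
    rw [Weyl.mul_apply, Weyl.mul_apply, apply_of_mem_even hu (x := v.1 x) (by rw [h2]; exact h4.2),
      apply_of_mem_even hu (x := v.1 y) (by rw [h2]; exact h4.1 ▸ h4.2)] at h3
    exact ⟨h3, trivial⟩
  · rintro ⟨h3, _⟩
    exact ⟨even_odd_noncancel hu hv hxy h3, sameOdd_of_inversion hv hxy h3⟩

open Classical in
theorem sum_even_odd {M : Type*} [AddCommMonoid M] (c : Comp m n d) (F : Weyl d → M) :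
    ∑ u with u ∈ parabolicEven c, ∑ v with v ∈ parabolicOdd c, F (u * v) =
      ∑ w with Pres (lab c) w, F w := by
  rw [← Finset.sum_product']
  apply Finset.sum_bij (fun p _ => p.1 * p.2)
  · rintro ⟨u, v⟩ h
    simp only [Finset.mem_product, Finset.mem_filter, Finset.mem_univ, true_and] at h ⊢
    exact (pres_of_mem_even h.1).mul (pres_of_mem_odd h.2)
  · rintro ⟨u, v⟩ h ⟨u', v'⟩ h' he
    simp only [Finset.mem_product, Finset.mem_filter, Finset.mem_univ, true_and] at h h' he
    obtain ⟨h1, h2⟩ := even_odd_factor_unique h.1 h'.1 h.2 h'.2 he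
    rw [h1, h2]
  · intro w hw
    simp only [Finset.mem_filter, Finset.mem_univ, true_and] at hw
    obtain ⟨u, hu, v, hv, rfl⟩ := hw.exists_factor
    exact ⟨(u, v), by simp [hu, hv], rfl⟩
  · intro p _; rfl

/-! ### The Hecke algebra -/

theorem Tw_one : Tw (1 : Weyl d) = 1 := by
  unfold Tw
  rw [RingQuot.mkAlgHom_rel _ HeckeRel.one, map_one]

theorem Tw_mul {w w' : Weyl d} (h : len (w * w') = len w + len w') : Tw w * Tw w' = Tw (w * w') := by
  unfold Tw
  rw [← map_mul, RingQuot.mkAlgHom_rel _ (HeckeRel.mul w w' h)]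

/-- Adding `q t + q` removes the subtraction from the quadratic relation, which can then be carried
through algebra maps as an identity of sums. -/
theorem quad_expand {A : Type*} [Ring A] [Algebra ℤ[T;T⁻¹] A] (t : A) :
    (t + 1) * (t - algebraMap ℤ[T;T⁻¹] A q) + (q • t + q • (1 : A)) = t * t + t := by
  rw [add_mul, mul_sub, mul_sub, one_mul, one_mul, ← Algebra.commutes, ← Algebra.smul_def,
    Algebra.algebraMap_eq_smul_one]
  abel

theorem Tw_simple_sq_add (i : Fin d) :
    Tw (simple i) * Tw (simple i) + Tw (simple i) = q • Tw (simple i) + q • (1 : Hecke d) := by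
  have h1 := congrArg (RingQuot.mkAlgHom ℤ[T;T⁻¹] (HeckeRel d))
    (quad_expand (FreeAlgebra.ι ℤ[T;T⁻¹] (simple i)))
  rw [map_add, RingQuot.mkAlgHom_rel ℤ[T;T⁻¹] (HeckeRel.quad i), map_zero, zero_add, map_add,
    map_smul, map_smul, map_one, map_add, map_mul] at h1
  exact h1.symm

theorem Tw_simple_sq (i : Fin d) :
    Tw (simple i) * Tw (simple i) = (q - 1) • Tw (simple i) + q • (1 : Hecke d) := by
  have h0 : Tw (simple i) + (-1 : ℤ[T;T⁻¹]) • Tw (simple i) = 0 := by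
    nth_rewrite 1 [← one_smul ℤ[T;T⁻¹] (Tw (simple i))]
    rw [← add_smul]
    simp
  rw [← add_zero (Tw (simple i) * Tw (simple i)), ← h0, ← add_assoc, Tw_simple_sq_add, add_right_comm,
    ← add_smul, sub_eq_add_neg]

theorem xy_eq_sum (c : Comp m n d) [DecidablePred (Pres (lab c))] :
    xy c = ∑ w with Pres (lab c) w, signWt c w • Tw w := by
  classical
  unfold xy xEven yOdd
  rw [Finset.sum_mul]
  refine Eq.trans ?_ ((sum_even_odd c (fun w => signWt c w • Tw w)).trans (by congr))
  refine Finset.sum_congr rfl fun u hu => ?_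
  rw [Finset.mul_sum]
  refine Finset.sum_congr rfl fun v hv => ?_
  simp only [Finset.mem_filter, Finset.mem_univ, true_and] at hu hv
  rw [mul_smul_comm, signWt_even_mul_odd hu hv, Tw_mul]
  exact len_mul fun x y h h' => even_odd_noncancel hu hv h h'

/-- The cosets `{w, w s_i}` partition `W_c`, and each has exactly one member that is increasing at
`s_i`. -/
theorem sum_pres_pairs {M : Type*} [AddCommMonoid M] (c : Comp m n d) [DecidablePred (Pres (lab c))]
    {i : Fin d} (hi : Pres (lab c) (simple i)) (F : Weyl d → M) :
    ∑ w with Pres (lab c) w, F w =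
      ∑ w with Pres (lab c) w ∧ w.1 (leftEnd i) < w.1 (rightEnd i), (F w + F (w * simple i)) := by
  classical
  rw [← Finset.sum_filter_add_sum_filter_not _ (fun w => w.1 (leftEnd i) < w.1 (rightEnd i)),
    Finset.filter_filter, Finset.filter_filter, Finset.sum_add_distrib]
  congr 1
  apply Finset.sum_nbij' (fun w => w * simple i) (fun w => w * simple i)
  · intro w
    simp only [Finset.mem_filter, Finset.mem_univ, true_and, Weyl.mul_apply, simple_apply_leftEnd,
      simple_apply_rightEnd]
    rintro ⟨h1, h2⟩
    exact ⟨h1.mul hi, (w.lt_or_gt i).resolve_left h2⟩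
  · intro w
    simp only [Finset.mem_filter, Finset.mem_univ, true_and, Weyl.mul_apply, simple_apply_leftEnd,
      simple_apply_rightEnd]
    rintro ⟨h1, h2⟩
    exact ⟨h1.mul hi, h2.asymm⟩
  · intro w _; rw [mul_assoc, simple_mul_self, mul_one]
  · intro w _; rw [mul_assoc, simple_mul_self, mul_one]
  · intro w _; rw [mul_assoc, simple_mul_self, mul_one]

/-- On a pair `{w, ws}` with `ws` longer, `T_w + T_{ws}` is an eigenvector of right multiplication
by `T_s` with eigenvalue `q`, and `T_w - q⁻¹ T_{ws}` is one with eigenvalue `-1`. -/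
theorem xy_mul_Tw_simple (c : Comp m n d) {i : Fin d} (hi : Pres (lab c) (simple i)) :
    xy c * Tw (simple i) = charWt c (simple i) • xy c := by
  classical
  have hlr : lab c (leftEnd i) = lab c (rightEnd i) := by rw [← hi (leftEnd i), simple_apply_leftEnd]
  rw [xy_eq_sum, Finset.sum_mul, sum_pres_pairs c hi, sum_pres_pairs c hi, Finset.smul_sum]
  refine Finset.sum_congr rfl fun w hw => ?_
  simp only [Finset.mem_filter, Finset.mem_univ, true_and] at hw
  obtain ⟨hw, hlt⟩ := hw
  have h1 : Tw w * Tw (simple i) = Tw (w * simple i) :=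
    Tw_mul (by rw [len_mul_simple hlt, len_simple])
  have h2 : Tw (w * simple i) * Tw (simple i) = (q - 1) • Tw (w * simple i) + q • Tw w := by
    rw [← h1, mul_assoc, Tw_simple_sq, mul_add, mul_smul_comm, mul_smul_comm, mul_one]
  have h3 : signWt c (w * simple i) = signWt c w * signWt c (simple i) :=
    signWt_mul hi fun x y h h' => apply_simple_lt hlt h h'
  rw [smul_mul_assoc, smul_mul_assoc, h1, h2, h3]
  unfold signWt charWt
  by_cases ho : IsOddIdx (lab c (leftEnd i))
  · rw [ninv_simple (Q := SameOdd c) i ⟨hlr, ho⟩, ninv_simple_of_not (Q := SameEven c) i (fun h => h.2 ho)]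
    simp only [pow_one, pow_zero, one_mul, smul_add, smul_smul]
    have hq := q_mul_qinv
    generalize (-qinv) ^ ninv (SameOdd c) w = s
    rw [← add_assoc, ← add_smul, add_comm]
    congr 2
    · linear_combination (-s) * hq
    · linear_combination (-s) * hq
  · rw [ninv_simple_of_not (Q := SameOdd c) i (fun h => ho h.2), ninv_simple (Q := SameEven c) i ⟨hlr, ho⟩]
    simp only [pow_one, pow_zero, mul_one, smul_add, smul_smul]
    generalize (-qinv) ^ ninv (SameOdd c) w = s
    rw [← add_assoc, ← add_smul, add_comm]
    congr 2
    · ring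
    · ring

theorem charWt_one (c : Comp m n d) : charWt c 1 = 1 := by
  simp [charWt, ninv_one]

theorem xy_mul_Tw (c : Comp m n d) {p : Weyl d} (hp : Pres (lab c) p) :
    xy c * Tw p = charWt c p • xy c := by
  refine Pres.induction (motive := fun p => xy c * Tw p = charWt c p • xy c) (isLabelling_lab c)
    (by rw [Tw_one, mul_one, charWt_one, one_smul]) ?_ hp
  intro i w hi hw hl hlt ih
  rw [← Tw_mul (by rw [hl, len_simple, add_comm]), ← mul_assoc, xy_mul_Tw_simple c hi, smul_mul_assoc,
    ih, smul_smul, charWt_mul hw fun x y h h' => simple_mul_noncancel hlt h h']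

theorem eq_zero_of_add_eq_self (R : Type*) {M : Type*} [Ring R] [AddCommMonoid M] [Module R M]
    {x y : M} (h : x + y = y) : x = 0 := by
  let _ : AddCommGroup M := Module.addCommMonoidToAddCommGroup R
  exact add_eq_right.1 h

/-- The anti-involution `T_w ↦ T_{w⁻¹}` of the Hecke algebra. -/
noncomputable def antiInv (d : ℕ) : Hecke d →ₐ[ℤ[T;T⁻¹]] (Hecke d)ᵐᵒᵖ :=
  RingQuot.liftAlgHom ℤ[T;T⁻¹] ⟨FreeAlgebra.lift ℤ[T;T⁻¹] fun w => MulOpposite.op (Tw w⁻¹), by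
    intro a b h
    cases h with
    | one => simp [Tw_one]
    | mul w w' h =>
      rw [map_mul, FreeAlgebra.lift_ι_apply, FreeAlgebra.lift_ι_apply, FreeAlgebra.lift_ι_apply,
        ← MulOpposite.op_mul, Tw_mul, mul_inv_rev]
      rw [← mul_inv_rev, len_inv, len_inv, len_inv, h, add_comm]
    | quad i =>
      have h1 := congrArg (FreeAlgebra.lift ℤ[T;T⁻¹] fun w => MulOpposite.op (Tw w⁻¹))
        (quad_expand (FreeAlgebra.ι ℤ[T;T⁻¹] (simple i)))
      rw [map_add, map_add _ (_ * _), map_mul _ (FreeAlgebra.ι ℤ[T;T⁻¹] (simple i)), map_add, map_smul,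
        map_smul, map_one, FreeAlgebra.lift_ι_apply, simple_inv, ← MulOpposite.op_mul,
        ← MulOpposite.op_add, Tw_simple_sq_add, MulOpposite.op_add, MulOpposite.op_smul,
        MulOpposite.op_smul, MulOpposite.op_one] at h1
      rw [map_zero]
      exact eq_zero_of_add_eq_self ℤ[T;T⁻¹] h1⟩

theorem antiInv_Tw (w : Weyl d) : antiInv d (Tw w) = MulOpposite.op (Tw w⁻¹) := by
  refine Eq.trans ?_ (FreeAlgebra.lift_ι_apply (R := ℤ[T;T⁻¹]) (fun w => MulOpposite.op (Tw w⁻¹)) w)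
  exact RingQuot.liftAlgHom_mkAlgHom_apply _ _ _ _

/-! ### Sums over double cosets -/

open Classical in
/-- The minimal representatives `y` of cosets in `W_a \ W` with matrix `κ(a, y, b) = M`. -/
noncomputable def minReps (a : Comp m n d) (M : Matrix (Idx m n) (Idx m n) ℤ) (b : Comp m n d) :
    Finset (Weyl d) := {y | Inc (lab a) y ∧ toInt (kappa a y b) = M}

theorem mem_minReps {a b : Comp m n d} {M : Matrix (Idx m n) (Idx m n) ℤ} {y : Weyl d} :
    y ∈ minReps a M b ↔ Inc (lab a) y ∧ toInt (kappa a y b) = M := by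
  simp [minReps]

theorem toInt_inj {A B : Matrix (Idx m n) (Idx m n) ℕ} : toInt A = toInt B ↔ A = B := by
  constructor
  · intro h
    ext i j
    have := congrFun (congrFun h i) j
    simpa [toInt] using this
  · rintro rfl; rfl

theorem toInt_apply (A : Matrix (Idx m n) (Idx m n) ℕ) (i j : Idx m n) : toInt A i j = A i j := rfl

/-- The signed sum of the `T_y` over `minReps a M b`. -/
noncomputable def cosetSum (a : Comp m n d) (M : Matrix (Idx m n) (Idx m n) ℤ) (b : Comp m n d) :
    Hecke d := ∑ y ∈ minReps a M b, signWt b y • Tw y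

/-- The labels of `x` and of `g x`. -/
def cell (a : Comp m n d) (g : Weyl d) (b : Comp m n d) (x : SymInt d) : Idx m n × Idx m n :=
  (lab a (g.1 x), lab b x)

/-- The classes are the sets `g⁻¹ R_i ∩ R_j`, convex because `g` is increasing on the blocks of `b`.
By `pres_cell` their group is `W_δ`, so the theory of labellings applies to `W_δ` as well. -/
theorem isLabelling_cell {a b : Comp m n d} {g : Weyl d} (hg : Inc (lab b) g⁻¹) :
    IsLabelling (cell a g b) where
  convex {x y z} h1 h2 h := by
    simp only [cell, Prod.mk.injEq] at h ⊢
    have hb : lab b y = lab b x := (isLabelling_lab b).convex h1 h2 h.2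
    refine ⟨?_, hb⟩
    have hle : ∀ {u v}, u ≤ v → lab b u = lab b v → g.1 u ≤ g.1 v := by
      intro u v huv he
      rcases huv.eq_or_lt with rfl | hlt
      · exact le_rfl
      · have := hg u v hlt he
        rw [inv_inv] at this
        exact this.le
    exact (isLabelling_lab a).convex (hle h1 hb.symm) (hle h2 (hb.trans h.2)) h.1
  opp {x y} h := by
    simp only [cell, Prod.mk.injEq] at h ⊢
    rw [g.map_opp, g.map_opp, lab_opp, lab_opp, lab_opp, lab_opp, h.1, h.2]
    exact ⟨rfl, rfl⟩

theorem mem_conjInv {g w : Weyl d} {H : Subgroup (Weyl d)} :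
    w ∈ conjInv g H ↔ g * w * g⁻¹ ∈ H := by
  unfold conjInv
  rw [Subgroup.mem_map]
  constructor
  · rintro ⟨h, hh, rfl⟩
    simpa [mul_assoc] using hh
  · intro h
    exact ⟨_, h, by simp [mul_assoc]⟩

theorem pres_cell {a b : Comp m n d} {g w : Weyl d} :
    Pres (cell a g b) w ↔ w ∈ deltaGroup a g b := by
  unfold deltaGroup
  rw [Subgroup.mem_inf, mem_conjInv, mem_parabolic, mem_parabolic]
  constructor
  · intro h
    refine ⟨fun x => ?_, fun x => (Prod.mk.inj (h x)).2⟩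
    have := (Prod.mk.inj (h ((g⁻¹).1 x))).1
    simpa using this
  · rintro ⟨h1, h2⟩ x
    simp only [cell, Prod.mk.injEq]
    refine ⟨?_, h2 x⟩
    have := h1 (g.1 x)
    simpa using this

theorem mem_deltaReps {a b : Comp m n d} {g r : Weyl d} (hg : Inc (lab b) g⁻¹) :
    r ∈ deltaReps a g b ↔ Inc (cell a g b) r := by
  have hc := isLabelling_cell (a := a) hg
  constructor
  · intro h
    exact Inc.of_len_le hc fun i hi => h _ (pres_cell.1 hi)
  · intro h x hx
    rw [(pres_cell.2 hx).len_mul hc h]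
    omega

theorem apply_lt_iff_of_inc_inv {b : Comp m n d} {g : Weyl d} (hg : Inc (lab b) g⁻¹)
    {x y : SymInt d} (h : lab b x = lab b y) : g.1 x < g.1 y ↔ x < y := by
  have := hg.inv_lt_iff h
  rwa [inv_inv] at this

theorem inc_mul_of_pres {a b : Comp m n d} {g r : Weyl d} (hga : Inc (lab a) g)
    (hr : Pres (lab b) r) (hrc : Inc (cell a g b) r) : Inc (lab a) (g * r) := by
  intro x y hxy h
  have h1 := hga x y hxy h
  rw [mul_inv_rev, Weyl.mul_apply, Weyl.mul_apply]
  by_cases h2 : lab b ((g⁻¹).1 x) = lab b ((g⁻¹).1 y)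
  · exact hrc _ _ h1 (by simp only [cell, Weyl.apply_inv_self, h, h2])
  · exact (hr.inv.lt_iff (isLabelling_lab b) h2).2 h1

/-- The products `g r` with `r ∈ 𝒟_δ ∩ W_b` are exactly the minimal representatives for `W_a` inside
`W_a g W_b`, and that double coset is detected by its matrix. Each product is reduced, and `g` does
not alter the inversions inside blocks of `b`. -/
theorem Tw_mul_TReps {a b : Comp m n d} {g : Weyl d} (hga : Inc (lab a) g) (hgb : Inc (lab b) g⁻¹) :
    Tw g * TReps a g b = cosetSum a (toInt (kappa a g b)) b := by
  classical
  have h1 : TReps a g b = ∑ r with Pres (lab b) r,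
      if r ∈ deltaReps a g b then signWt b r • Tw r else 0 := by
    refine Eq.trans ?_ (sum_even_odd b fun r => if r ∈ deltaReps a g b then signWt b r • Tw r else 0)
    unfold TReps
    refine Finset.sum_congr (by congr) fun u hu => Finset.sum_congr (by congr) fun v hv => ?_
    simp only [Finset.mem_filter, Finset.mem_univ, true_and] at hu hv
    rw [signWt_even_mul_odd hu hv]
  rw [h1, ← Finset.sum_filter, Finset.filter_filter, Finset.mul_sum]
  unfold cosetSum
  apply Finset.sum_bij (fun r _ => g * r)
  · intro r hr
    simp only [Finset.mem_filter, Finset.mem_univ, true_and] at hr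
    rw [mem_minReps, kappa_mul_right hr.1]
    exact ⟨inc_mul_of_pres hga hr.1 ((mem_deltaReps hgb).1 hr.2), rfl⟩
  · intro r _ r' _ h
    exact mul_left_cancel h
  · intro y hy
    rw [mem_minReps, toInt_inj] at hy
    have hp := pres_of_kappa_eq hga hy.1 hy.2.symm
    refine ⟨g⁻¹ * y, ?_, by simp⟩
    simp only [Finset.mem_filter, Finset.mem_univ, true_and]
    refine ⟨hp, (mem_deltaReps hgb).2 fun u v huv h => ?_⟩
    simp only [cell, Prod.mk.injEq] at h
    have h2 := hy.1 _ _ ((apply_lt_iff_of_inc_inv hgb h.2).2 huv) h.1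
    simpa [mul_inv_rev] using h2
  · intro r hr
    simp only [Finset.mem_filter, Finset.mem_univ, true_and] at hr
    have hlab : ∀ x y, lab b x = lab b y → (g.1 (r.1 y) < g.1 (r.1 x) ↔ r.1 y < r.1 x) := by
      intro x y h
      exact apply_lt_iff_of_inc_inv hgb (by rw [hr.1, hr.1, h])
    have h2 : signWt b (g * r) = signWt b r := by
      unfold signWt
      congr 1
      apply ninv_congr_of
      intro x y _
      simp only [Weyl.mul_apply]
      constructor
      · rintro ⟨h3, h4⟩; exact ⟨(hlab _ _ h4.1).1 h3, h4⟩
      · rintro ⟨h3, h4⟩; exact ⟨(hlab _ _ h4.1).2 h3, h4⟩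
    rw [mul_smul_comm, h2, Tw_mul]
    exact len_mul fun x y h h' => (hlab x y (hr.1.lab_eq_of_inversion h h')).2 h'

open Classical in
/-- Every element is uniquely a product of an element that preserves the labelling and a
minimal coset representative. -/
theorem sum_decomposition {α M : Type*} [AddCommMonoid M] {f : SymInt d → α} (hf : IsLabelling f)
    (G : Weyl d → M) :
    ∑ p with Pres f p, ∑ y with Inc f y, G (p * y) = ∑ y, G y := by
  rw [← Finset.sum_product']
  apply Finset.sum_bij (fun p _ => p.1 * p.2)
  · intro p _; simp
  · rintro ⟨p, y⟩ h ⟨p', y'⟩ h' he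
    simp only [Finset.mem_product, Finset.mem_filter, Finset.mem_univ, true_and] at h h' he
    have e : y' = (p'⁻¹ * p) * y := by rw [mul_assoc, he, inv_mul_cancel_left]
    have := Inc.eq_one hf (h'.1.inv.mul h.1) h.2 (by rw [← e]; exact h'.2)
    have e2 : p' = p := by rwa [inv_mul_eq_one] at this
    subst e2
    rw [mul_left_cancel he]
  · intro y _
    obtain ⟨p, y', h1, h2, rfl⟩ := exists_decomposition hf y
    exact ⟨(p, y'), by simp [h1, h2], rfl⟩
  · intro p _; rfl

/-- `x, y` lie in the same odd block of `b`, or `w x, w y` lie in the same odd block of `a`. -/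
def JointOdd (a : Comp m n d) (w : Weyl d) (b : Comp m n d) (x y : SymInt d) : Prop :=
  SameOdd b x y ∨ SameOdd a (w.1 x) (w.1 y)

/-- The parity condition on the entries of a matrix in `Ξ`. -/
def ParityBound (A : Matrix (Idx m n) (Idx m n) ℕ) : Prop :=
  ∀ i j, ¬ (IsOddIdx i ↔ IsOddIdx j) → A i j ≤ 1

theorem parityBound_of_mem_Xi {A : Matrix (Idx m n) (Idx m n) ℕ} (h : A ∈ Xi m n d) :
    ParityBound A := fun i j hij => by
  rcases h.2.2 i j hij with h | h <;> omega

/-- Two distinct points in one cell make its entry at least `2`, which the parity bound allows only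
for labels of equal parity. -/
theorem ParityBound.isOddIdx_iff {a b : Comp m n d} {w : Weyl d} (hA : ParityBound (kappa a w b))
    {x y : SymInt d} (hxy : x ≠ y) (hb : lab b x = lab b y) (ha : lab a (w.1 x) = lab a (w.1 y)) :
    IsOddIdx (lab a (w.1 x)) ↔ IsOddIdx (lab b x) := by
  by_contra hc
  have h1 := hA _ _ hc
  rw [card_kappa, Finset.card_le_one] at h1
  exact hxy (h1 x (by simp) y (by simp [hb, ha]))

/-- Every element of the double coset is uniquely `p y`. Inversions from `p` lie inside `a`-blocks,
those from `y` cross them, and the parity bound makes a pair sharing an `a`-block and an odd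
`b`-block odd for both. Hence the weight takes the form `JointOdd`, which treats the two sides
alike. -/
theorem xy_mul_cosetSum {a b : Comp m n d} {A : Matrix (Idx m n) (Idx m n) ℕ} (hA : ParityBound A)
    [DecidablePred fun y => kappa a y b = A] :
    xy a * cosetSum a (toInt A) b =
      ∑ y with kappa a y b = A, (-qinv) ^ ninv (JointOdd a y b) y • Tw y := by
  classical
  rw [xy_eq_sum, cosetSum, Finset.sum_mul_sum]
  refine Eq.trans ?_ ((sum_decomposition (isLabelling_lab a) (fun y => if kappa a y b = A then
    (-qinv) ^ ninv (JointOdd a y b) y • Tw y else 0)).trans (Finset.sum_filter _ _).symm)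
  refine Finset.sum_congr (by congr) fun p hp => ?_
  simp only [Finset.mem_filter, Finset.mem_univ, true_and] at hp
  rw [← Finset.sum_filter, Finset.filter_filter]
  refine Finset.sum_congr ?_ fun y hy => ?_
  · ext y
    rw [mem_minReps, toInt_inj]
    simp only [Finset.mem_filter, Finset.mem_univ, true_and, kappa_mul_left hp]
  simp only [Finset.mem_filter, Finset.mem_univ, true_and, kappa_mul_left hp] at hy
  have hnc : ∀ u v, u < v → y.1 v < y.1 u → p.1 (y.1 v) < p.1 (y.1 u) :=
    fun u v h h' => hp.apply_lt (isLabelling_lab a) hy.1 h h'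
  rw [smul_mul_smul_comm, Tw_mul (len_mul hnc)]
  congr 1
  unfold signWt
  rw [← pow_add]
  congr 1
  have hsym : SymRel (JointOdd a (p * y) b) := by
    constructor
    · rintro u v (h | h)
      · exact Or.inl ((symRel_sameOdd b).swap h)
      · exact Or.inr ((symRel_sameOdd a).swap h)
    · rintro u v (h | h)
      · exact Or.inl ((symRel_sameOdd b).opp h)
      · refine Or.inr ?_
        rw [Weyl.map_opp, Weyl.map_opp]
        exact (symRel_sameOdd a).opp h
  rw [ninv_mul hsym _ _ (fun u v h _ h' => hnc u v h h')]
  congr 1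
  · apply ninv_congr
    intro u v huv hp'
    have hla := hp.lab_eq_of_inversion huv hp'
    simp only [JointOdd, Weyl.mul_apply, Weyl.apply_inv_self]
    rw [congrFun (congrFun (sameOdd_pres hp) u) v]
    constructor
    · exact Or.inr
    · rintro (h | h)
      · refine ⟨hla, ?_⟩
        have hA' : ParityBound (kappa a y b) := by rw [hy.2]; exact hA
        have := hA'.isOddIdx_iff (x := (y⁻¹).1 u) (y := (y⁻¹).1 v)
          (by rw [ne_eq, Weyl.apply_inj]; exact huv.ne) h.1 (by simpa using hla)
        rw [Weyl.apply_inv_self] at this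
        exact this.2 h.2
      · exact h
  · apply ninv_congr
    intro u v huv hy'
    simp only [JointOdd, Weyl.mul_apply]
    rw [congrFun (congrFun (sameOdd_pres hp) (y.1 u)) (y.1 v)]
    constructor
    · exact Or.inl
    · rintro (h | h)
      · exact h
      · exact absurd ((hy.1.lt_iff h.1.symm).1 hy') huv.asymm

theorem op_sum {ι M : Type*} [AddCommMonoid M] (s : Finset ι) (F : ι → M) :
    MulOpposite.op (∑ i ∈ s, F i) = ∑ i ∈ s, MulOpposite.op (F i) :=
  map_sum (MulOpposite.opAddEquiv (α := M)) F s

theorem antiInv_xy (c : Comp m n d) : antiInv d (xy c) = MulOpposite.op (xy c) := by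
  classical
  rw [xy_eq_sum, map_sum, op_sum]
  apply Finset.sum_nbij' (fun w => w⁻¹) (fun w => w⁻¹)
  · intro w; simp only [Finset.mem_filter, Finset.mem_univ, true_and]; exact Pres.inv
  · intro w; simp only [Finset.mem_filter, Finset.mem_univ, true_and]; exact Pres.inv
  · intro w _; simp
  · intro w _; simp
  · intro w hw
    simp only [Finset.mem_filter, Finset.mem_univ, true_and] at hw
    rw [map_smul, antiInv_Tw, MulOpposite.op_smul]
    unfold signWt
    rw [ninv_inv (symRel_sameOdd c), sameOdd_pres hw]

/-- Passing to `y⁻¹` transposes the matrix and exchanges the two alternatives in `JointOdd`. -/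
theorem antiInv_xy_mul_cosetSum {a b : Comp m n d} {A : Matrix (Idx m n) (Idx m n) ℕ}
    (hA : ParityBound A) : antiInv d (xy b * cosetSum b (toInt A.transpose) a) =
      MulOpposite.op (xy a * cosetSum a (toInt A) b) := by
  classical
  have hA' : ParityBound A.transpose := fun i j h => hA j i fun h' => h h'.symm
  have hk : ∀ y : Weyl d, kappa b y⁻¹ a = (kappa a y b).transpose := by
    intro y
    ext i j
    rw [kappa_inv, Matrix.transpose_apply]
  rw [xy_mul_cosetSum hA, xy_mul_cosetSum hA', map_sum, op_sum]
  apply Finset.sum_nbij' (fun w => w⁻¹) (fun w => w⁻¹)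
  · intro y
    simp only [Finset.mem_filter, Finset.mem_univ, true_and]
    intro h
    have := hk y⁻¹
    rw [inv_inv, h] at this
    exact Matrix.transpose_injective this.symm
  · intro y
    simp only [Finset.mem_filter, Finset.mem_univ, true_and]
    intro h
    rw [hk, h]
  · intro w _; simp
  · intro w _; simp
  · intro w hw
    rw [map_smul, antiInv_Tw, MulOpposite.op_smul]
    congr 2
    have hsym : SymRel (JointOdd a w⁻¹ b) := by
      constructor
      · rintro u v (h | h)
        · exact Or.inl ((symRel_sameOdd b).swap h)
        · exact Or.inr ((symRel_sameOdd a).swap h)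
      · rintro u v (h | h)
        · exact Or.inl ((symRel_sameOdd b).opp h)
        · refine Or.inr ?_
          rw [Weyl.map_opp, Weyl.map_opp]
          exact (symRel_sameOdd a).opp h
    rw [ninv_inv hsym]
    apply ninv_congr
    intro x y _ _
    simp only [JointOdd, Weyl.inv_apply_self]
    exact or_comm

/-- `[xy]_a` times the sum over the double coset is a left multiple of `[xy]_b`. -/
theorem exists_mul_xy {a b : Comp m n d} {A : Matrix (Idx m n) (Idx m n) ℕ} (hA : ParityBound A) :
    ∃ z, xy a * cosetSum a (toInt A) b = z * xy b := by
  refine ⟨MulOpposite.unop (antiInv d (cosetSum b (toInt A.transpose) a)), ?_⟩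
  apply MulOpposite.op_injective
  rw [← antiInv_xy_mul_cosetSum hA, map_mul, antiInv_xy, MulOpposite.op_mul, MulOpposite.op_unop]

/-! ### The maps `φ` and the elements `e_A` -/

theorem mem_permModule {c : Comp m n d} {x : Hecke d} : x ∈ permModule c ↔ ∃ h, x = xy c * h := by
  unfold permModule
  rw [Submodule.mem_span_singleton]
  constructor
  · rintro ⟨h, rfl⟩
    exact ⟨h.unop, rfl⟩
  · rintro ⟨h, rfl⟩
    exact ⟨MulOpposite.op h, rfl⟩

theorem inSummand_congr {c : Comp m n d} {h h' : Hecke d} (e : xy c * h = xy c * h') :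
    inSummand c h = inSummand c h' := by
  unfold inSummand
  congr 1
  exact Subtype.ext e

theorem inSummand_add (c : Comp m n d) (h h' : Hecke d) :
    inSummand c (h + h') = inSummand c h + inSummand c h' := by
  unfold inSummand
  rw [← map_add]
  congr 1
  exact Subtype.ext (mul_add _ _ _)

theorem inSummand_smul (c : Comp m n d) (r : ℤ[T;T⁻¹]) (h : Hecke d) :
    inSummand c (r • h) = r • inSummand c h := by
  unfold inSummand
  rw [← algebraMap_smul (Hecke d)ᵐᵒᵖ r (DirectSum.lof _ _ _ _ _), ← map_smul]
  congr 1
  apply Subtype.ext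
  change xy c * (r • h) = algebraMap ℤ[T;T⁻¹] (Hecke d)ᵐᵒᵖ r • (xy c * h)
  rw [algebraMap_smul, mul_smul_comm]

theorem inSummand_zero (c : Comp m n d) : inSummand c (0 : Hecke d) = 0 := by
  have := inSummand_smul c 0 0
  rwa [zero_smul, zero_smul] at this

theorem inSummand_sum {ι : Type*} (c : Comp m n d) (s : Finset ι) (F : ι → Hecke d) :
    inSummand c (∑ i ∈ s, F i) = ∑ i ∈ s, inSummand c (F i) := by
  classical
  induction s using Finset.induction_on with
  | empty => simp [inSummand_zero]
  | insert i s hi ih => rw [Finset.sum_insert hi, Finset.sum_insert hi, inSummand_add, ih]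

/-- Endomorphisms are determined by their values on the elements `[xy]_c h`. -/
theorem schur_ext {f f' : Schur m n d} (h : ∀ c x, f (inSummand c x) = f' (inSummand c x)) :
    f = f' := by
  apply DirectSum.linearMap_ext
  intro c
  apply LinearMap.ext
  rintro ⟨x, hx⟩
  obtain ⟨y, rfl⟩ := mem_permModule.1 hx
  exact h c y

/-- Left multiplication by `z`. -/
noncomputable def leftMul (z : Hecke d) : Hecke d →ₗ[(Hecke d)ᵐᵒᵖ] Hecke d where
  toFun x := z * x
  map_add' := mul_add z
  map_smul' r x := (mul_assoc z x r.unop).symm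

/-- With `[xy]_a T_g T_{𝒟_δ ∩ W_b} = z [xy]_b`, the map is left multiplication by `z`, so it is well
defined whatever the annihilator of `[xy]_b` may be. -/
theorem exists_isPhi {a b : Comp m n d} {g : Weyl d} (hga : Inc (lab a) g) (hgb : Inc (lab b) g⁻¹)
    (hA : ParityBound (kappa a g b)) : ∃ f, IsPhi a g b f := by
  classical
  obtain ⟨z, hz⟩ := exists_mul_xy (a := a) (b := b) hA
  rw [← Tw_mul_TReps hga hgb] at hz
  have hmem : ∀ x ∈ permModule b, leftMul z x ∈ permModule a := by
    intro x hx
    obtain ⟨h, rfl⟩ := mem_permModule.1 hx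
    refine mem_permModule.2 ⟨Tw g * TReps a g b * h, ?_⟩
    change z * (xy b * h) = _
    rw [← mul_assoc, ← hz]
    simp only [mul_assoc]
  refine ⟨DirectSum.toModule _ _ _ fun c =>
    if hc : b = c then (DirectSum.lof (Hecke d)ᵐᵒᵖ (Comp m n d) (fun c => permModule c) a).comp
      ((leftMul z).restrict (fun x hx => hmem x (hc ▸ hx))) else 0, fun c h => ?_⟩
  rw [inSummand, DirectSum.toModule_lof]
  by_cases hc : b = c
  · subst hc
    rw [dif_pos rfl, if_pos rfl, LinearMap.comp_apply, inSummand]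
    congr 1
    apply Subtype.ext
    change z * (xy b * h) = xy a * (Tw g * TReps a g b * h)
    rw [← mul_assoc, ← hz]
    simp only [mul_assoc]
  · rw [dif_neg hc, if_neg hc, LinearMap.zero_apply]

/-- If an element of the intersection moves `x`, then `x` and its image share a cell, so the labels
there have equal parity; `hpar` says they do not. -/
theorem conjInv_inf_eq_bot {a b : Comp m n d} {g : Weyl d} (hA : ParityBound (kappa a g b))
    {H K : Subgroup (Weyl d)} (hH : ∀ w ∈ H, Pres (lab a) w) (hK : ∀ w ∈ K, Pres (lab b) w)
    (hpar : ∀ w ∈ H, ∀ w' ∈ K, ∀ x y, w.1 x ≠ x → w'.1 y ≠ y →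
      ¬ (IsOddIdx (lab a x) ↔ IsOddIdx (lab b y))) : conjInv g H ⊓ K = ⊥ := by
  rw [Subgroup.eq_bot_iff_forall]
  intro w hw
  rw [Subgroup.mem_inf, mem_conjInv] at hw
  apply Weyl.ext'
  intro x
  by_contra hx
  rw [Weyl.one_apply] at hx
  have h1 : lab b (w.1 x) = lab b x := hK w hw.2 x
  have h2 : lab a (g.1 (w.1 x)) = lab a (g.1 x) := by
    have := hH _ hw.1 (g.1 x)
    simpa using this
  refine hpar _ hw.1 _ hw.2 (g.1 x) x ?_ hx (hA.isOddIdx_iff (Ne.symm hx) h1.symm h2.symm)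
  simp only [Weyl.mul_apply, Weyl.inv_apply_self, ne_eq, Weyl.apply_inj]
  exact hx

theorem mem_superReps {a b : Comp m n d} {g : Weyl d} (hg : g ∈ doubleReps a b)
    (hA : ParityBound (kappa a g b)) : g ∈ superReps a b := by
  refine ⟨hg, ?_, ?_⟩
  · refine conjInv_inf_eq_bot hA (fun _ => pres_of_mem_odd) (fun _ => pres_of_mem_even) ?_
    intro w hw w' hw' x y hx hy h
    by_cases ho : IsOddIdx (lab b y)
    · exact hy (apply_of_mem_even hw' ho)
    · exact hx (apply_of_mem_odd hw fun h' => ho (h.1 h'))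
  · refine conjInv_inf_eq_bot hA (fun _ => pres_of_mem_even) (fun _ => pres_of_mem_odd) ?_
    intro w hw w' hw' x y hx hy h
    by_cases ho : IsOddIdx (lab b y)
    · exact hx (apply_of_mem_even hw (h.2 ho))
    · exact hy (apply_of_mem_odd hw' ho)

open Classical in
/-- `e_M` maps `[xy]_b h` to `[xy]_a` times the double coset sum of `M`, if `M ∈ Ξ` has the row and
column sums prescribed by `a` and `b`. -/
theorem eInt_apply {a b : Comp m n d} {M : Matrix (Idx m n) (Idx m n) ℤ} (h0 : ∀ i j, 0 ≤ M i j)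
    (hXi : M.map Int.toNat ∈ Xi m n d)
    (hrow : ∀ i, ∑ j, M i j = Finset.card {x | lab a x = i})
    (hcol : ∀ j, ∑ i, M i j = Finset.card {x | lab b x = j}) (c : Comp m n d) (h : Hecke d) :
    eInt M (inSummand c h) = if b = c then inSummand a (cosetSum a M b * h) else 0 := by
  have hM : toInt (M.map Int.toNat) = M := by
    ext i j
    simp [toInt, h0 i j]
  rw [eInt, if_pos h0]
  generalize M.map Int.toNat = A at *
  subst hM
  simp only [toInt_apply] at *
  unfold e
  split_ifs with hp hbc hbc
  · obtain ⟨hs, hk⟩ := hp.2.choose_spec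
    generalize hp.2.choose = p at *
    obtain ⟨a', g, b'⟩ := p
    simp only at hs hk ⊢
    -- The margins of the matrix recover the two compositions of the chosen triple; `g` itself need
    -- not be identified, since the coset sum depends only on its matrix.
    have ea : a' = a := comp_eq_of_card fun i => by
      have := hrow i
      rw [hk, ← Nat.cast_sum, sum_kappa_row] at this
      exact_mod_cast this
    have eb : b' = b := comp_eq_of_card fun j => by
      have := hcol j
      rw [hk, ← Nat.cast_sum, sum_kappa_col] at this
      exact_mod_cast this
    subst ea eb
    obtain ⟨hga, hgb⟩ := inc_of_mem_doubleReps hs.1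
    have hex := exists_isPhi hga hgb (hk ▸ parityBound_of_mem_Xi hXi)
    rw [phi, dif_pos hex, hex.choose_spec c h, if_pos hbc, Tw_mul_TReps hga hgb, hk]
  · obtain ⟨hs, hk⟩ := hp.2.choose_spec
    generalize hp.2.choose = p at *
    obtain ⟨a', g, b'⟩ := p
    simp only at hs hk ⊢
    have eb : b' = b := comp_eq_of_card fun j => by
      have := hcol j
      rw [hk, ← Nat.cast_sum, sum_kappa_col] at this
      exact_mod_cast this
    subst eb
    obtain ⟨hga, hgb⟩ := inc_of_mem_doubleReps hs.1
    have hex := exists_isPhi hga hgb (hk ▸ parityBound_of_mem_Xi hXi)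
    rw [phi, dif_pos hex, hex.choose_spec c h, if_neg hbc]
  -- Here no admissible triple has matrix `A`. A representative `y` would supply one through its
  -- double coset, so the coset sum is empty and both sides vanish; surjectivity of `κ` onto `Ξ` is
  -- not needed.
  · have he : minReps a (toInt A) b = ∅ := by
      by_contra hne
      obtain ⟨y, hy⟩ := Finset.nonempty_iff_ne_empty.2 hne
      rw [mem_minReps, toInt_inj] at hy
      obtain ⟨g, hg, hgk⟩ := exists_doubleRep a b y
      refine hp ⟨hXi, (a, g, b), mem_superReps hg ?_, ?_⟩
      · rw [hgk, hy.2]; exact parityBound_of_mem_Xi hXi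
      · rw [hgk, hy.2]
    rw [cosetSum, he, Finset.sum_empty, zero_mul, inSummand_zero, LinearMap.zero_apply]
  · rw [LinearMap.zero_apply]

theorem eInt_toInt (A : Matrix (Idx m n) (Idx m n) ℕ) : eInt (toInt A) = (e A : Schur m n d) := by
  rw [eInt, if_pos fun i j => by simp [toInt]]
  congr 1

open Classical in
theorem e_apply {a b : Comp m n d} {g : Weyl d} (hXi : kappa a g b ∈ Xi m n d) (c : Comp m n d)
    (h : Hecke d) : e (kappa a g b) (inSummand c h) =
      if b = c then inSummand a (cosetSum a (toInt (kappa a g b)) b * h) else 0 := by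
  rw [← eInt_toInt]
  apply eInt_apply
  · intro i j; simp [toInt]
  · exact hXi
  · intro i
    rw [← sum_kappa_row a b g]
    simp [toInt]
  · intro j
    rw [← sum_kappa_col a b g]
    simp [toInt]

/-! ### Compositions whose labels differ at one pair of points -/

/-- The labels of `a` and `b` differ exactly at `z` and `-z`, where `0 < z`. -/
structure DifferAt (a b : Comp m n d) (z : SymInt d) : Prop where
  pos : 0 < z.1
  agree : ∀ x, x ≠ z → x ≠ z.opp → lab a x = lab b x
  ne : lab a z ≠ lab b z

theorem DifferAt.symm {a b : Comp m n d} {z : SymInt d} (h : DifferAt a b z) : DifferAt b a z :=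
  ⟨h.pos, fun x h1 h2 => (h.agree x h1 h2).symm, h.ne.symm⟩

/-- So `z` is alone in its class of the common refinement of the two labellings. The point `-z` is
no competitor: it would force both labels of `z` to be `0`. -/
theorem DifferAt.eq_of_lab {a b : Comp m n d} {z x : SymInt d} (h : DifferAt a b z)
    (ha : lab a x = lab a z) (hb : lab b x = lab b z) : x = z := by
  by_contra h1
  by_cases h2 : x = z.opp
  · subst h2
    rw [lab_opp, Subtype.ext_iff, SymInt.coe_opp] at ha hb
    refine h.ne (Subtype.ext ?_)
    omega
  · have := h.agree x h1 h2
    rw [ha, hb] at this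
    exact h.ne this

/-- The inverse of an element of `W_a` keeps the order of points in different `a`-blocks, so only
pairs lying in a common block of both labellings need a test. -/
theorem Inc.of_cell_one {a b : Comp m n d} {p : Weyl d} (hp : Pres (lab a) p)
    (hc : Inc (cell a 1 b) p) : Inc (lab b) p := by
  intro x y hxy h
  by_cases ha : lab a x = lab a y
  · exact hc x y hxy (by simp [cell, ha, h])
  · exact (hp.inv.lt_iff (isLabelling_lab a) ha).2 hxy

theorem isLabelling_cell_one (a b : Comp m n d) : IsLabelling (cell a 1 b) :=
  isLabelling_cell (by rw [inv_one]; exact Inc.one)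

/-- The signed permutation that exchanges `x` with `z` and `-x` with `-z`. -/
def signedSwap (x z : SymInt d) (hx : x.1 ≠ 0) (hz : z.1 ≠ 0) : Weyl d :=
  ⟨Function.Involutive.toPerm (fun u => if u = x then z else if u = z then x else
      if u = x.opp then z.opp else if u = z.opp then x.opp else u) (by
      intro u
      simp only [Subtype.ext_iff, apply_ite Subtype.val, SymInt.coe_opp]
      split_ifs <;> omega), by
    intro u
    change (if u.opp = x then z else if u.opp = z then x else
      if u.opp = x.opp then z.opp else if u.opp = z.opp then x.opp else u.opp) =
      (if u = x then z else if u = z then x else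
      if u = x.opp then z.opp else if u = z.opp then x.opp else u).opp
    split_ifs <;> simp only [Subtype.ext_iff, SymInt.coe_opp] at * <;> omega⟩

theorem signedSwap_apply (x z : SymInt d) (hx : x.1 ≠ 0) (hz : z.1 ≠ 0) (u : SymInt d) :
    (signedSwap x z hx hz).1 u = if u = x then z else if u = z then x else
      if u = x.opp then z.opp else if u = z.opp then x.opp else u := rfl

theorem pres_signedSwap {c : Comp m n d} {x z : SymInt d} (hx : x.1 ≠ 0) (hz : z.1 ≠ 0)
    (h : lab c x = lab c z) : Pres (lab c) (signedSwap x z hx hz) := by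
  intro u
  rw [signedSwap_apply]
  split_ifs with h1 h2 h3 h4
  · rw [h1, h]
  · rw [h2, h]
  · rw [h3, lab_opp, lab_opp, h]
  · rw [h4, lab_opp, lab_opp, h]
  · rfl

/-- Inside `W_a`, the subgroup `W_a ∩ W_b` is the stabilizer of `z`, so its minimal coset
representatives correspond to the points that can be moved to `z`. One is obtained from a signed
transposition by stripping off its factor in `W_a ∩ W_b`. -/
theorem DifferAt.exists_pres {a b : Comp m n d} {z x : SymInt d} (h : DifferAt a b z)
    (hx : x ≠ SymInt.origin d) (hxz : lab a x = lab a z) :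
    ∃ p, Pres (lab a) p ∧ Inc (lab b) p ∧ p.1 x = z := by
  have hx' : x.1 ≠ 0 := fun h => hx (Subtype.ext h)
  have h0 := pres_signedSwap hx' h.pos.ne' hxz
  have h0x : (signedSwap x z hx' h.pos.ne').1 x = z := by simp [signedSwap_apply]
  obtain ⟨t, p, ht, hp, he⟩ := exists_decomposition (isLabelling_cell_one a b)
    (signedSwap x z hx' h.pos.ne')
  rw [he] at h0 h0x
  have htz := ht z
  simp only [cell, Weyl.one_apply, Prod.mk.injEq] at htz
  have htz' : t.1 z = z := h.eq_of_lab htz.1 htz.2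
  have hta : Pres (lab a) t := fun u => (Prod.mk.inj (ht u)).1
  have hpa : Pres (lab a) p := by
    have := hta.inv.mul h0
    rwa [inv_mul_cancel_left] at this
  refine ⟨p, hpa, Inc.of_cell_one hpa hp, ?_⟩
  rw [Weyl.mul_apply] at h0x
  rw [← t.apply_inj, h0x, htz']

theorem DifferAt.pres_unique {a b : Comp m n d} {z x : SymInt d} (h : DifferAt a b z)
    {p p' : Weyl d} (hp : Pres (lab a) p) (hp' : Pres (lab a) p') (hi : Inc (lab b) p)
    (hi' : Inc (lab b) p') (hx : p.1 x = z) (hx' : p'.1 x = z) : p = p' := by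
  have hta : Pres (lab a) (p' * p⁻¹) := hp'.mul hp.inv
  have htz : (p' * p⁻¹).1 z = z := by rw [← hx, Weyl.mul_apply, Weyl.inv_apply_self, hx', hx]
  have htb : Pres (lab b) (p' * p⁻¹) := by
    intro u
    by_cases h1 : u = z
    · rw [h1, htz]
    by_cases h2 : u = z.opp
    · rw [h2, Weyl.map_opp, htz]
    rw [← h.agree u h1 h2, ← hta u, h.agree]
    · intro h3; rw [← htz, Weyl.apply_inj] at h3; exact h1 h3
    · intro h3
      have h4 : (p' * p⁻¹).1 u = (p' * p⁻¹).1 z.opp := by rw [h3, Weyl.map_opp, htz]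
      exact h2 ((Weyl.apply_inj _).1 h4)
  have := Inc.eq_one (isLabelling_lab b) htb hi (by simpa using hi')
  rwa [mul_inv_eq_one, eq_comm] at this

/-- The two factorizations of an element that is minimal for the intersection of `W_a` and `W_b`. -/
theorem exists_other_factorization {a b : Comp m n d} {c w : Weyl d} (hcb : Pres (lab b) c)
    (hca : Inc (lab a) c) (hw : Inc (lab b) w) :
    ∃ p y, Pres (lab a) p ∧ Inc (lab b) p ∧ Inc (lab a) y ∧ p * y = c * w := by
  -- The product `c w` is minimal for `W_a ∩ W_b`. Splitting off a minimal representative `y` for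
  -- `W_a` leaves `p` minimal for `W_a ∩ W_b`, hence for `W_b`.
  have hcell : Inc (cell a 1 b) (c * w) := by
    intro x y hxy h
    simp only [cell, Weyl.one_apply, Prod.mk.injEq] at h
    rw [mul_inv_rev, Weyl.mul_apply, Weyl.mul_apply]
    exact hw _ _ (hca x y hxy h.1) (by rw [hcb.inv, hcb.inv, h.2])
  obtain ⟨p, y, hp, hy, he⟩ := exists_decomposition (isLabelling_lab a) (c * w)
  refine ⟨p, y, hp, Inc.of_cell_one hp ?_, hy, he.symm⟩
  intro u v huv h
  have h1 := hcell u v huv h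
  rw [he, mul_inv_rev, Weyl.mul_apply, Weyl.mul_apply] at h1
  simp only [cell, Weyl.one_apply, Prod.mk.injEq] at h
  exact (hy.inv_lt_iff (by rw [hp.inv, hp.inv, h.1])).1 h1

theorem factorization_unique {a : Comp m n d} {p p' y y' : Weyl d} (hp : Pres (lab a) p)
    (hp' : Pres (lab a) p') (hy : Inc (lab a) y) (hy' : Inc (lab a) y') (h : p * y = p' * y') :
    p = p' ∧ y = y' := by
  have e : y' = (p'⁻¹ * p) * y := by rw [mul_assoc, h, inv_mul_cancel_left]
  have := Inc.eq_one (isLabelling_lab a) (hp'.inv.mul hp) hy (by rw [← e]; exact hy')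
  have e2 : p' = p := by rwa [inv_mul_eq_one] at this
  subst e2
  exact ⟨rfl, mul_left_cancel h⟩

/-- Replacing `b` by `a` changes the row of `±x` only, because `y` sends these two points to `±z`.
-/
theorem DifferAt.kappa_eq {a b c : Comp m n d} {z x : SymInt d} (h : DifferAt a b z) {y : Weyl d}
    (hx : y.1 x = z) : toInt (kappa a y c) = toInt (kappa b y c) + Etheta (lab a z) (lab c x) -
      Etheta (lab b z) (lab c x) := by
  classical
  ext i j
  have hsum : ∀ a : Comp m n d, toInt (kappa a y c) i j =
      ∑ u, if lab c u = j ∧ lab a (y.1 u) = i then (1 : ℤ) else 0 := by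
    intro a
    rw [toInt_apply, card_kappa, Finset.card_filter]
    push_cast
    rfl
  have hne : x ≠ x.opp := by
    intro he
    rw [he, Weyl.map_opp, Subtype.ext_iff, SymInt.coe_opp] at hx
    have h1 := h.pos
    rw [he] at hx
    have h2 : x.1 = 0 := by
      have := congrArg Subtype.val he
      simp only [SymInt.coe_opp] at this
      omega
    have h3 : x = SymInt.origin d := Subtype.ext h2
    rw [← he, h3, Weyl.apply_origin, SymInt.coe_origin] at hx
    omega
  have hdiff : toInt (kappa a y c) i j - toInt (kappa b y c) i j =
      ∑ u ∈ {x, x.opp}, ((if lab c u = j ∧ lab a (y.1 u) = i then (1 : ℤ) else 0) -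
        if lab c u = j ∧ lab b (y.1 u) = i then (1 : ℤ) else 0) := by
    rw [hsum, hsum, ← Finset.sum_sub_distrib]
    symm
    apply Finset.sum_subset (Finset.subset_univ _)
    intro u _ hu
    simp only [Finset.mem_insert, Finset.mem_singleton, not_or] at hu
    rw [h.agree (y.1 u), sub_self]
    · intro h1; rw [← hx, Weyl.apply_inj] at h1; exact hu.1 h1
    · intro h1; rw [← hx, ← Weyl.map_opp, Weyl.apply_inj] at h1; exact hu.2 h1
  rw [Finset.sum_pair hne, Weyl.map_opp, hx, lab_opp, lab_opp, lab_opp] at hdiff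
  simp only [Matrix.sub_apply, Matrix.add_apply, Etheta, Matrix.single_apply]
  rw [sub_eq_iff_eq_add'] at hdiff
  rw [hdiff, add_sub_assoc]
  congr 1
  simp only [and_comm (a := lab c x = j), and_comm (a := (lab c x).opp = j)]
  ring

/-- A bijection given as a relation, for use where neither direction has an explicit formula. -/
theorem sum_eq_sum_of_relation {α β M : Type*} [AddCommMonoid M] {s : Finset α} {t : Finset β}
    {F : α → M} {F' : β → M} (R : α → β → Prop) (h1 : ∀ x ∈ s, ∃ y ∈ t, R x y)
    (h2 : ∀ y ∈ t, ∃ x ∈ s, R x y)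
    (u1 : ∀ x ∈ s, ∀ y ∈ t, ∀ y' ∈ t, R x y → R x y' → y = y')
    (u2 : ∀ x ∈ s, ∀ x' ∈ s, ∀ y ∈ t, R x y → R x' y → x = x')
    (hF : ∀ x ∈ s, ∀ y ∈ t, R x y → F x = F' y) : ∑ x ∈ s, F x = ∑ y ∈ t, F' y := by
  choose f hf using h1
  apply Finset.sum_bij f
  · exact fun x hx => (hf x hx).1
  · intro x hx x' hx' he
    exact u2 x hx x' hx' _ (hf x hx).1 (hf x hx).2 (he ▸ (hf x' hx').2)
  · intro y hy
    obtain ⟨x, hx, hxy⟩ := h2 y hy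
    exact ⟨x, hx, u1 x hx _ (hf x hx).1 _ hy (hf x hx).2 hxy⟩
  · exact fun x hx => hF x hx _ (hf x hx).1 (hf x hx).2

theorem mem_minReps_one {a b : Comp m n d} {c : Weyl d} :
    c ∈ minReps a (toInt (kappa a 1 b)) b ↔ Inc (lab a) c ∧ Pres (lab b) c := by
  rw [mem_minReps, toInt_inj]
  refine and_congr_right fun hc => ?_
  constructor
  · intro h
    have := pres_of_kappa_eq Inc.one hc h.symm
    rwa [inv_one, one_mul] at this
  · intro h
    have := kappa_mul_right (a := a) (g := 1) h
    rwa [one_mul] at this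

open Classical in
/-- The product of two coset sums, expressed through the cosets in `W_a \ W` and the point that is
moved to `z`. -/
theorem DifferAt.xy_mul_cosetSum_mul {a b c : Comp m n d} {z : SymInt d} (h : DifferAt a b z)
    (A : Matrix (Idx m n) (Idx m n) ℕ) (ω : Weyl d → SymInt d → ℤ[T;T⁻¹])
    (hω : ∀ t w p y x, Pres (lab b) t → Inc (lab a) t → Inc (lab b) w → Pres (lab a) p →
      Inc (lab b) p → Inc (lab a) y → p * y = t * w → (t * w).1 x = z → kappa b w c = A →
      signWt b t * signWt c w * charWt a p = ω y x) :
    xy a * (cosetSum a (toInt (kappa a 1 b)) b * cosetSum b (toInt A) c) =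
      ∑ k, ∑ y ∈ minReps a (toInt A + Etheta (lab a z) k - Etheta (lab b z) k) c,
        ∑ x with x ≠ SymInt.origin d ∧ lab c x = k ∧ lab a (y.1 x) = lab a z,
          ω y x • (xy a * Tw y) := by
  have hz : z ≠ SymInt.origin d := fun h1 => by have := h.pos; rw [h1, SymInt.coe_origin] at this; omega
  rw [cosetSum, cosetSum, Finset.sum_mul_sum, Finset.mul_sum]
  simp only [Finset.mul_sum]
  rw [← Finset.sum_product', Finset.sum_sigma', Finset.sum_sigma']
  -- A pair `(t, w)` determines `tw = py` and the point `x` moved to `z`. Conversely `(y, x)`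
  -- determines `p` by `p (y x) = z`, and `py` is then refactored as `tw`.
  apply sum_eq_sum_of_relation (fun (q : Weyl d × Weyl d)
    (r : (_ : (_ : Idx m n) × Weyl d) × SymInt d) => (q.1 * q.2).1 r.2 = z ∧
      ∃ p, Pres (lab a) p ∧ Inc (lab b) p ∧ p * r.1.2 = q.1 * q.2)
  · rintro ⟨t, w⟩ hq
    simp only [Finset.mem_product, mem_minReps_one] at hq
    rw [mem_minReps, toInt_inj] at hq
    obtain ⟨⟨hta, htb⟩, hw, hA⟩ := hq
    obtain ⟨p, y, hp, hpb, hy, he⟩ := exists_other_factorization htb hta hw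
    have hx : (t * w).1 (((t * w)⁻¹).1 z) = z := Weyl.apply_inv_self _ _
    refine ⟨⟨⟨lab c (((t * w)⁻¹).1 z), y⟩, ((t * w)⁻¹).1 z⟩, ?_, hx, p, hp, hpb, he⟩
    simp only [Finset.mem_sigma, Finset.mem_univ, true_and, Finset.mem_filter, mem_minReps]
    refine ⟨⟨hy, ?_⟩, ?_, ?_⟩
    · rw [← hA, ← kappa_mul_left (g := w) htb, ← h.kappa_eq hx, ← he, kappa_mul_left hp]
    · rwa [ne_eq, Weyl.apply_eq_origin]
    · rw [← hp, ← Weyl.mul_apply, he, hx]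
  · rintro ⟨⟨k, y⟩, x⟩ hr
    simp only [Finset.mem_sigma, Finset.mem_univ, true_and, Finset.mem_filter, mem_minReps] at hr
    obtain ⟨⟨hy, hyA⟩, hx0, rfl, hxz⟩ := hr
    obtain ⟨p, hp, hpb, hpx⟩ := h.exists_pres (x := y.1 x) (by rwa [ne_eq, Weyl.apply_eq_origin]) hxz
    obtain ⟨t, w, ht, hta, hw, he⟩ := exists_other_factorization hp hpb hy
    have hx : (t * w).1 x = z := by rw [he, Weyl.mul_apply, hpx]
    refine ⟨(t, w), ?_, hx, p, hp, hpb, he.symm⟩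
    simp only [Finset.mem_product, mem_minReps_one]
    rw [mem_minReps]
    refine ⟨⟨hta, ht⟩, hw, ?_⟩
    have h1 := h.kappa_eq (c := c) hx
    rw [kappa_mul_left ht, he, kappa_mul_left hp, hyA] at h1
    rw [add_sub_assoc, add_sub_assoc, add_left_inj] at h1
    exact h1.symm
  · rintro ⟨t, w⟩ hq ⟨⟨k, y⟩, x⟩ hr ⟨⟨k', y'⟩, x'⟩ hr' ⟨h1, p, h2, h3, h4⟩ ⟨h1', p', h2', h3', h4'⟩
    simp only [Finset.mem_sigma, Finset.mem_univ, true_and, Finset.mem_filter, mem_minReps] at *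
    have ex : x = x' := by rw [← (t * w).apply_inj, h1, h1']
    obtain ⟨_, ey⟩ := factorization_unique h2 h2' hr.1.1 hr'.1.1 (h4.trans h4'.symm)
    subst ex ey
    rw [← hr.2.2.1, ← hr'.2.2.1]
  · rintro ⟨t, w⟩ hq ⟨t', w'⟩ hq' ⟨⟨k, y⟩, x⟩ hr ⟨h1, p, h2, h3, h4⟩ ⟨h1', p', h2', h3', h4'⟩
    simp only [Finset.mem_product, mem_minReps_one] at hq hq' h1 h1' h4 h4'
    rw [mem_minReps] at hq hq'
    rw [← h4, Weyl.mul_apply] at h1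
    rw [← h4', Weyl.mul_apply] at h1'
    have ep := h.pres_unique h2 h2' h3 h3' h1 h1'
    subst ep
    obtain ⟨et, ew⟩ := factorization_unique hq.1.2 hq'.1.2 hq.2.1 hq'.2.1 (h4.symm.trans h4')
    rw [et, ew]
  · rintro ⟨t, w⟩ hq ⟨⟨k, y⟩, x⟩ hr ⟨h1, p, h2, h3, h4⟩
    simp only [Finset.mem_product, mem_minReps_one, Finset.mem_sigma, Finset.mem_univ, true_and,
      Finset.mem_filter] at hq hr h1 h4 ⊢
    rw [mem_minReps] at hr
    rw [mem_minReps, toInt_inj] at hq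
    obtain ⟨⟨hta, htb⟩, hw, hA⟩ := hq
    have hy := hr.1.1
    rw [smul_mul_smul_comm, Tw_mul (htb.len_mul (isLabelling_lab b) hw), ← h4,
      ← Tw_mul (h2.len_mul (isLabelling_lab a) hy), mul_smul_comm, ← mul_assoc, xy_mul_Tw a h2,
      smul_mul_assoc, smul_smul, hω t w p y x htb hta hw h2 h3 hy h4 h1 hA]

/-! ### Weights of the factors -/

/-- The labels of `a` and `b` differ exactly at `z` and `-z`, where `0 < z`, and the label of `z`
increases by one. -/
structure IsStep (a b : Comp m n d) (z : SymInt d) : Prop where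
  pos : 0 < z.1
  agree : ∀ x, x ≠ z → x ≠ z.opp → lab a x = lab b x
  step : (lab a z).1 + 1 = (lab b z).1

theorem IsStep.differAt {a b : Comp m n d} {z : SymInt d} (h : IsStep a b z) : DifferAt a b z :=
  ⟨h.pos, h.agree, fun he => by have := h.step; rw [he] at this; omega⟩

theorem SymInt.ne_opp_of_pos {x z : SymInt d} (hz : 0 < z.1) (hx : 0 ≤ x.1) : x ≠ z.opp := by
  intro h
  have := congrArg Subtype.val h
  simp only [SymInt.coe_opp] at this
  omega

/-- A point beyond `z` in the same `a`-block would keep its label under `b` while `z` moves up, so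
`lab b` would not be monotone. Likewise `z` is the first point of its `b`-block. -/
theorem IsStep.le_of_lab {a b : Comp m n d} {z x : SymInt d} (h : IsStep a b z)
    (hx : lab a x = lab a z) : x ≤ z := by
  by_contra hc
  rw [not_le] at hc
  have hp := h.pos
  have hc' := Subtype.coe_lt_coe.2 hc
  have h1 := h.agree x hc.ne' (SymInt.ne_opp_of_pos hp (by omega))
  have h2 := Subtype.coe_le_coe.2 (lab_mono b hc.le)
  rw [← h1, hx] at h2
  have := h.step
  omega

theorem IsStep.ge_of_lab {a b : Comp m n d} {z x : SymInt d} (h : IsStep a b z)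
    (hx : lab b x = lab b z) : z ≤ x := by
  by_contra hc
  rw [not_le] at hc
  have hs := h.step
  have h0 := lab_nonneg (c := a) h.pos.le
  have h3 : x ≠ z.opp := by
    rintro rfl
    rw [lab_opp, Subtype.ext_iff, SymInt.coe_opp] at hx
    omega
  have h1 := h.agree x hc.ne h3
  have h2 := Subtype.coe_le_coe.2 (lab_mono a hc.le)
  rw [h1, hx] at h2
  omega

/-- The number of inversions in the block of `z` when `z` is the only point of its block that
is moved out of order. -/
theorem ninv_of_max {f : Comp m n d} {z : SymInt d} (hz : 0 < z.1)
    (hmax : ∀ x, lab f x = lab f z → x ≤ z) {t : Weyl d} (ht : Pres (lab f) t)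
    (hinc : ∀ x y, x < y → lab f x = lab f y → x ≠ z → x ≠ z.opp → y ≠ z → y ≠ z.opp →
      (t⁻¹).1 x < (t⁻¹).1 y) {P : Idx m n → Prop} (hP : ∀ i, P i → P i.opp) :
    (P (lab f z) → ninv (fun x y => lab f x = lab f y ∧ P (lab f x)) t =
      Finset.card {x | x ≠ SymInt.origin d ∧ lab f x = lab f z ∧ (t⁻¹).1 z < x}) ∧
    (¬ P (lab f z) → ninv (fun x y => lab f x = lab f y ∧ P (lab f x)) t = 0) := by
  have hsym : SymRel (fun x y => lab f x = lab f y ∧ P (lab f x)) :=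
    ⟨fun h => ⟨h.1.symm, h.1 ▸ h.2⟩, fun h => ⟨by rw [lab_opp, lab_opp, h.1], by
      rw [lab_opp]; exact hP _ h.2⟩⟩
  have h1 := ninv_inv hsym t
  simp only [ht _] at h1
  rw [← h1]
  -- Off `±z` the map `t⁻¹` is increasing on blocks, and counted pairs satisfy `|x| ≤ y`. So the
  -- larger point of an inversion is `z`, even in the central block, which contains `-z` as well.
  have key : ∀ x y, y.opp ≤ x → x < y → (t⁻¹).1 y < (t⁻¹).1 x → lab f x = lab f y → y = z := by
    intro x y h2 h3 h4 h5
    have h2' := Subtype.coe_le_coe.2 h2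
    have h3' := Subtype.coe_lt_coe.2 h3
    rw [SymInt.coe_opp] at h2'
    have hy : y ≠ z.opp := SymInt.ne_opp_of_pos hz (by omega)
    by_contra hne
    by_cases hx : x = z
    · subst hx
      exact (hmax y h5.symm).not_gt h3
    by_cases hx' : x = z.opp
    · subst hx'
      rw [SymInt.coe_opp] at h2' h3'
      have h6 := lab_nonneg (c := f) hz.le
      have h7 := lab_nonneg (c := f) (x := y) (by omega)
      have h8 := congrArg Subtype.val h5
      rw [lab_opp, SymInt.coe_opp] at h8
      have h9 : lab f y = lab f z := Subtype.ext (by omega)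
      have := Subtype.coe_le_coe.2 (hmax y h9)
      exact hne (Subtype.ext (by omega))
    exact (hinc x y h3 h5 hx hx' hne hy).asymm h4
  constructor
  · intro hPz
    unfold ninv
    apply Finset.card_nbij' (fun p => (t⁻¹).1 p.1) (fun x => (t.1 x, z))
    · rintro ⟨x, y⟩
      simp only [Finset.coe_filter, Finset.mem_univ, true_and, Set.mem_ofPred_eq]
      rintro ⟨h2, h3, h4, h5, h6, h7⟩
      have := key x y h3 h4 h5 h6
      subst this
      exact ⟨by rwa [ne_eq, Weyl.apply_eq_origin], by rw [ht.inv, h6], h5⟩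
    · rintro x
      simp only [Finset.coe_filter, Finset.mem_univ, true_and, Set.mem_ofPred_eq]
      rintro ⟨h2, h3, h4⟩
      have h5 : lab f (t.1 x) = lab f z := by rw [ht, h3]
      refine ⟨by rwa [ne_eq, Weyl.apply_eq_origin], ?_, ?_, by simpa using h4, h5, h5 ▸ hPz⟩
      · rw [← Subtype.coe_le_coe, SymInt.coe_opp]
        by_contra hc
        have h6 := lab_nonneg (c := f) hz.le
        have h7 := lab_nonpos (c := f) (x := t.1 x) (by omega)
        have h8 : lab f (t.1 x).opp = lab f z := by
          rw [lab_opp]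
          ext
          rw [SymInt.coe_opp, h5]
          rw [h5] at h7
          omega
        have := Subtype.coe_le_coe.2 (hmax _ h8)
        rw [SymInt.coe_opp] at this
        omega
      · refine lt_of_le_of_ne (hmax _ h5) fun h6 => ?_
        rw [← h6, Weyl.inv_apply_self] at h4
        exact h4.false
    · rintro ⟨x, y⟩
      simp only [Finset.coe_filter, Finset.mem_univ, true_and, Set.mem_ofPred_eq]
      rintro ⟨h2, h3, h4, h5, h6, h7⟩
      rw [key x y h3 h4 h5 h6, Weyl.apply_inv_self]
    · intro x _; simp
  · intro hPz
    refine ninv_eq_zero fun x y _ h3 h4 h5 h6 => hPz ?_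
    rw [← key x y h3 h4 h5 h6.1, ← h6.1]
    exact h6.2

/-- The mirror image of `ninv_of_max`. The label of `z` has to be positive here, since the first
point of the central block is not. -/
theorem ninv_of_min {f : Comp m n d} {z : SymInt d} (hz : 0 < (lab f z).1)
    (hmin : ∀ x, lab f x = lab f z → z ≤ x) {t : Weyl d} (ht : Pres (lab f) t)
    (hinc : ∀ x y, x < y → lab f x = lab f y → x ≠ z → x ≠ z.opp → y ≠ z → y ≠ z.opp →
      (t⁻¹).1 x < (t⁻¹).1 y) {P : Idx m n → Prop} (hP : ∀ i, P i → P i.opp) :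
    (P (lab f z) → ninv (fun x y => lab f x = lab f y ∧ P (lab f x)) t =
      Finset.card {x | x ≠ SymInt.origin d ∧ lab f x = lab f z ∧ x < (t⁻¹).1 z}) ∧
    (¬ P (lab f z) → ninv (fun x y => lab f x = lab f y ∧ P (lab f x)) t = 0) := by
  have hsym : SymRel (fun x y => lab f x = lab f y ∧ P (lab f x)) :=
    ⟨fun h => ⟨h.1.symm, h.1 ▸ h.2⟩, fun h => ⟨by rw [lab_opp, lab_opp, h.1], by
      rw [lab_opp]; exact hP _ h.2⟩⟩
  have h1 := ninv_inv hsym t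
  simp only [ht _] at h1
  rw [← h1]
  have hpos : ∀ x, lab f x = lab f z → 0 < x.1 := by
    intro x hx
    by_contra hc
    have := lab_nonpos (c := f) (x := x) (by omega)
    rw [hx] at this
    omega
  have hz' := hpos z rfl
  have key : ∀ x y, y.opp ≤ x → x < y → (t⁻¹).1 y < (t⁻¹).1 x → lab f x = lab f y → x = z := by
    intro x y h2 h3 h4 h5
    have h2' := Subtype.coe_le_coe.2 h2
    have h3' := Subtype.coe_lt_coe.2 h3
    rw [SymInt.coe_opp] at h2'
    have hy : y ≠ z.opp := SymInt.ne_opp_of_pos hz' (by omega)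
    by_contra hne
    by_cases hyz : y = z
    · subst hyz
      exact (hmin x h5).not_gt h3
    by_cases hx' : x = z.opp
    · subst hx'
      have h7 := lab_nonneg (c := f) (x := y) (by omega)
      have h8 := congrArg Subtype.val h5
      rw [lab_opp, SymInt.coe_opp] at h8
      omega
    exact (hinc x y h3 h5 hne hx' hyz hy).asymm h4
  constructor
  · intro hPz
    unfold ninv
    apply Finset.card_nbij' (fun p => (t⁻¹).1 p.2) (fun x => (z, t.1 x))
    · rintro ⟨x, y⟩
      simp only [Finset.coe_filter, Finset.mem_univ, true_and, Set.mem_ofPred_eq]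
      rintro ⟨h2, h3, h4, h5, h6, h7⟩
      have := key x y h3 h4 h5 h6
      subst this
      refine ⟨?_, by rw [ht.inv, h6], h5⟩
      rw [ne_eq, Weyl.apply_eq_origin]
      rintro rfl
      have := hpos _ h6.symm
      rw [SymInt.coe_origin] at this
      omega
    · rintro x
      simp only [Finset.coe_filter, Finset.mem_univ, true_and, Set.mem_ofPred_eq]
      rintro ⟨h2, h3, h4⟩
      have h5 : lab f (t.1 x) = lab f z := by rw [ht, h3]
      have h6 := hpos _ h5
      refine ⟨?_, ?_, ?_, by simpa using h4, h5.symm, hPz⟩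
      · rintro rfl; rw [SymInt.coe_origin] at hz'; omega
      · rw [← Subtype.coe_le_coe, SymInt.coe_opp]; omega
      · refine lt_of_le_of_ne (hmin _ h5) fun h6 => ?_
        rw [h6, Weyl.inv_apply_self] at h4
        exact h4.false
    · rintro ⟨x, y⟩
      simp only [Finset.coe_filter, Finset.mem_univ, true_and, Set.mem_ofPred_eq]
      rintro ⟨h2, h3, h4, h5, h6, h7⟩
      rw [key x y h3 h4 h5 h6, Weyl.apply_inv_self]
    · intro x _; simp
  · intro hPz
    refine ninv_eq_zero fun x y _ h3 h4 h5 h6 => hPz ?_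
    rw [← key x y h3 h4 h5 h6.1]
    exact h6.2

/-- The weights of an element all of whose inversions lie in the block with label `i`. -/
theorem wt_of_ninv {f : Comp m n d} {i : Idx m n} {t : Weyl d} {N : ℕ}
    (h : ∀ P : Idx m n → Prop, (∀ j, P j → P j.opp) →
      (P i → ninv (fun x y => lab f x = lab f y ∧ P (lab f x)) t = N) ∧
      (¬ P i → ninv (fun x y => lab f x = lab f y ∧ P (lab f x)) t = 0)) :
    signWt f t = qdot i ^ N ∧ charWt f t = qddot i ^ N := by
  have h1 := h IsOddIdx fun j hj => IsOddIdx.opp.2 hj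
  have h2 := h (fun j => ¬ IsOddIdx j) fun j hj h' => hj (IsOddIdx.opp.1 h')
  change (_ → ninv (SameOdd f) t = N) ∧ (_ → ninv (SameOdd f) t = 0) at h1
  change (_ → ninv (SameEven f) t = N) ∧ (_ → ninv (SameEven f) t = 0) at h2
  unfold signWt charWt qdot qddot
  by_cases ho : IsOddIdx i
  · rw [h1.1 ho, h2.2 (by simpa using ho), if_pos ho, if_pos ho, pow_zero, one_mul]
    exact ⟨rfl, rfl⟩
  · rw [h1.2 ho, h2.1 ho, if_neg ho, if_neg ho]
    simp

theorem IsStep.inc_off {a b : Comp m n d} {z : SymInt d} (h : DifferAt a b z) {t : Weyl d}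
    (ht : Inc (lab b) t) : ∀ x y, x < y → lab a x = lab a y → x ≠ z → x ≠ z.opp → y ≠ z →
      y ≠ z.opp → (t⁻¹).1 x < (t⁻¹).1 y := fun x y hxy he h1 h2 h3 h4 =>
  ht x y hxy (by rw [← h.agree x h1 h2, he, h.agree y h3 h4])

/-- Transport of a count along an element that is increasing on inverse blocks. -/
theorem card_transport {f : Comp m n d} {i : Idx m n} {y : Weyl d} (R : SymInt d → SymInt d → Prop)
    [DecidableRel R] {z x : SymInt d} (hzx : z = y.1 x)
    (hR : ∀ u, lab f (y.1 u) = i → (R (y.1 x) (y.1 u) ↔ R x u)) :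
    Finset.card {u | u ≠ SymInt.origin d ∧ lab f u = i ∧ R z u} =
      Finset.card {u | u ≠ SymInt.origin d ∧ lab f (y.1 u) = i ∧ R x u} := by
  subst hzx
  apply Finset.card_nbij' (fun u => (y⁻¹).1 u) (fun u => y.1 u)
  · intro u
    simp only [Finset.coe_filter, Finset.mem_univ, true_and, Set.mem_ofPred_eq]
    rintro ⟨h1, h2, h3⟩
    refine ⟨by rwa [ne_eq, Weyl.apply_eq_origin], by simpa using h2, ?_⟩
    rw [← hR _ (by simpa using h2)]
    simpa using h3
  · intro u
    simp only [Finset.coe_filter, Finset.mem_univ, true_and, Set.mem_ofPred_eq]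
    rintro ⟨h1, h2, h3⟩
    exact ⟨by rwa [ne_eq, Weyl.apply_eq_origin], h2, (hR u h2).2 h3⟩
  · intro u _; simp
  · intro u _; simp

/-- The weights when the block label of `z` goes up outside. -/
theorem IsStep.wt_left {a b : Comp m n d} {z x : SymInt d} (h : IsStep a b z) {t y : Weyl d}
    (ht : Pres (lab a) t) (hi : Inc (lab b) t) (hy : Inc (lab a) y) (hx : (t * y).1 x = z) :
    signWt a t = qdot (lab a z) ^ (Finset.card {u | u ≠ SymInt.origin d ∧
        lab a (y.1 u) = lab a z ∧ x < u}) ∧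
      charWt a t = qddot (lab a z) ^ (Finset.card {u | u ≠ SymInt.origin d ∧
        lab a (y.1 u) = lab a z ∧ x < u}) := by
  have hzx : (t⁻¹).1 z = y.1 x := by rw [Weyl.inv_eq_iff, ← hx, Weyl.mul_apply]
  have hyx : lab a (y.1 x) = lab a z := by rw [← hzx, ht.inv]
  rw [← card_transport (fun x u => x < u) hzx fun u hu => hy.lt_iff (hyx.trans hu.symm)]
  exact wt_of_ninv fun P hP => ninv_of_max h.pos (fun x => h.le_of_lab) ht
    (IsStep.inc_off h.differAt hi) hP

/-- The weights when the block label of `z` goes down outside. -/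
theorem IsStep.wt_right {a b : Comp m n d} {z x : SymInt d} (h : IsStep a b z) {t y : Weyl d}
    (ht : Pres (lab b) t) (hi : Inc (lab a) t) (hy : Inc (lab b) y) (hx : (t * y).1 x = z) :
    signWt b t = qdot (lab b z) ^ (Finset.card {u | u ≠ SymInt.origin d ∧
        lab b (y.1 u) = lab b z ∧ u < x}) ∧
      charWt b t = qddot (lab b z) ^ (Finset.card {u | u ≠ SymInt.origin d ∧
        lab b (y.1 u) = lab b z ∧ u < x}) := by
  have hzx : (t⁻¹).1 z = y.1 x := by rw [Weyl.inv_eq_iff, ← hx, Weyl.mul_apply]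
  have hyx : lab b (y.1 x) = lab b z := by rw [← hzx, ht.inv]
  rw [← card_transport (fun x u => u < x) hzx fun u hu => hy.lt_iff (hu.trans hyx.symm)]
  have hb : 0 < (lab b z).1 := by
    have := lab_nonneg (c := a) h.pos.le
    have := h.step
    omega
  exact wt_of_ninv fun P hP => ninv_of_min hb (fun x => h.ge_of_lab) ht
    (IsStep.inc_off h.differAt.symm hi) hP

/-! ### Inversions of words -/

/-- Raising one letter of a word by one step changes the number of inversions by the difference of
the numbers of equal letters on both sides. -/
theorem card_inversions_step {α β : Type*} [Fintype α] [LinearOrder α] [LinearOrder β]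
    {E : α → α → Prop} [DecidableRel E] {L L' : α → β} {x₀ : α} {i i' : β}
    (hL : L x₀ = i') (hL' : L' x₀ = i) (hii' : ∀ j, j < i' ↔ j ≤ i)
    (h1 : ∀ x y, E x y → x ≠ x₀ → L x = L' x) (h2 : ∀ x y, E x y → y ≠ x₀ → L y = L' y) :
    Finset.card {p : α × α | p.1 < p.2 ∧ E p.1 p.2 ∧ L p.2 < L p.1} +
        Finset.card {x | x < x₀ ∧ E x x₀ ∧ L x = i'} =
      Finset.card {p : α × α | p.1 < p.2 ∧ E p.1 p.2 ∧ L' p.2 < L' p.1} +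
        Finset.card {x | x₀ < x ∧ E x₀ x ∧ L' x = i} := by
  have hlt : i < i' := (hii' i).2 le_rfl
  have hge : ∀ j, i < j ↔ i' ≤ j := fun j => by rw [← not_le, ← hii', not_lt]
  have e1 : Finset.card {x | x < x₀ ∧ E x x₀ ∧ L x = i'} = Finset.card
      {p : α × α | p.1 < p.2 ∧ E p.1 p.2 ∧ p.2 = x₀ ∧ L p.1 = i'} := by
    apply Finset.card_nbij' (fun x => (x, x₀)) (fun p => p.1)
    · intro x; simp
    · rintro ⟨x, y⟩
      simp only [Finset.coe_filter, Finset.mem_univ, true_and, Set.mem_ofPred_eq]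
      rintro ⟨a, b, rfl, c⟩
      exact ⟨a, b, c⟩
    · intro x _; rfl
    · rintro ⟨x, y⟩
      simp only [Finset.coe_filter, Finset.mem_univ, true_and, Set.mem_ofPred_eq]
      rintro ⟨a, b, rfl, c⟩
      rfl
  have e2 : Finset.card {x | x₀ < x ∧ E x₀ x ∧ L' x = i} = Finset.card
      {p : α × α | p.1 < p.2 ∧ E p.1 p.2 ∧ p.1 = x₀ ∧ L' p.2 = i} := by
    apply Finset.card_nbij' (fun x => (x₀, x)) (fun p => p.2)
    · intro x; simp
    · rintro ⟨x, y⟩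
      simp only [Finset.coe_filter, Finset.mem_univ, true_and, Set.mem_ofPred_eq]
      rintro ⟨a, b, rfl, c⟩
      exact ⟨a, b, c⟩
    · intro x _; rfl
    · rintro ⟨x, y⟩
      simp only [Finset.coe_filter, Finset.mem_univ, true_and, Set.mem_ofPred_eq]
      rintro ⟨a, b, rfl, c⟩
      rfl
  rw [e1, e2, ← Finset.card_union_of_disjoint, ← Finset.card_union_of_disjoint]
  · congr 1
    ext ⟨x, y⟩
    simp only [Finset.mem_union, Finset.mem_filter, Finset.mem_univ, true_and]
    rw [← and_or_left, ← and_or_left, ← and_or_left, ← and_or_left]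
    refine and_congr_right fun hxy => and_congr_right fun hE => ?_
    -- A pair starting at `x₀` is inverted for `i'` iff it is inverted for `i` or its other letter
    -- is `i`; a pair ending at `x₀` is inverted for `i` iff it is inverted for `i'` or its other
    -- letter is `i'`.
    by_cases hx : x = x₀
    · subst hx
      have hy := h2 x y hE hxy.ne'
      rw [hL, hL', hy, hii', le_iff_lt_or_eq]
      constructor
      · rintro (h | ⟨h, _⟩)
        · exact h.imp_right fun h => ⟨rfl, h⟩
        · exact absurd h hxy.ne'
      · rintro (h | ⟨_, h⟩)
        · exact Or.inl (Or.inl h)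
        · exact Or.inl (Or.inr h)
    · have hxL := h1 x y hE hx
      by_cases hy : y = x₀
      · subst hy
        rw [hL, hL', hxL, hge, le_iff_lt_or_eq]
        constructor
        · rintro (h | ⟨_, h⟩)
          · exact Or.inl (Or.inl h)
          · exact Or.inl (Or.inr h.symm)
        · rintro (h | ⟨h, _⟩)
          · exact h.imp_right fun h => ⟨rfl, h.symm⟩
          · exact absurd h hx
      · rw [hxL, h2 x y hE hy]
        simp [hx, hy]
  · rw [Finset.disjoint_left]
    rintro ⟨x, y⟩
    simp only [Finset.mem_filter, Finset.mem_univ, true_and]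
    rintro ⟨h3, h4, h5⟩ ⟨_, _, rfl, h6⟩
    rw [hL'] at h5
    exact absurd h6 h5.ne
  · rw [Finset.disjoint_left]
    rintro ⟨x, y⟩
    simp only [Finset.mem_filter, Finset.mem_univ, true_and]
    rintro ⟨h3, h4, h5⟩ ⟨_, _, rfl, h6⟩
    rw [hL, h6] at h5
    exact h5.false

theorem IsOddIdx.ne_zero {i : Idx m n} (h : IsOddIdx i) : i.1 ≠ 0 := by
  intro h0
  unfold IsOddIdx at h
  rw [h0, abs_zero] at h
  omega

/-- For a minimal coset representative, inversions are inversions of the word of labels. -/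
theorem Inc.apply_lt_iff_lab {a : Comp m n d} {w : Weyl d} (hw : Inc (lab a) w) {x y : SymInt d}
    (hxy : x < y) : w.1 y < w.1 x ↔ lab a (w.1 y) < lab a (w.1 x) := by
  constructor
  · intro h
    refine lt_of_le_of_ne (lab_mono a h.le) fun he => ?_
    exact hxy.asymm ((hw.lt_iff he).1 h)
  · intro h
    by_contra hc
    exact (lab_mono a (not_lt.1 hc)).not_gt h

/-- `x, y` lie in the same odd block, and on the side of `0` given by `s`. -/
def SameOddSide (c : Comp m n d) (s : ℤ) (x y : SymInt d) : Prop :=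
  SameOdd c x y ∧ 0 < s * (lab c x).1

-- Odd blocks avoid `0`, so each inversion inside one has exactly one representative on either side
-- of `0`. The side can thus be chosen to contain a given point `x` but not `-x`.
open Classical in
theorem ninv_sameOdd_eq_card {a c : Comp m n d} {w : Weyl d} (hw : Inc (lab a) w) {s : ℤ}
    (hs : s = 1 ∨ s = -1) : ninv (SameOdd c) w = Finset.card {p : SymInt d × SymInt d | p.1 < p.2 ∧
      SameOddSide c s p.1 p.2 ∧ lab a (w.1 p.2) < lab a (w.1 p.1)} := by
  have hpos : ninv (SameOdd c) w = Finset.card {p : SymInt d × SymInt d | p.1 < p.2 ∧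
      SameOddSide c 1 p.1 p.2 ∧ lab a (w.1 p.2) < lab a (w.1 p.1)} := by
    unfold ninv
    congr 1
    ext ⟨x, y⟩
    simp only [Finset.mem_filter, Finset.mem_univ, true_and]
    constructor
    · rintro ⟨h1, h2, h3, h4, h5⟩
      refine ⟨h3, ⟨h5, ?_⟩, (hw.apply_lt_iff_lab h3).1 h4⟩
      have h6 := Subtype.coe_le_coe.2 h2
      have h7 := Subtype.coe_lt_coe.2 h3
      rw [SymInt.coe_opp] at h6
      have h8 := lab_nonneg (c := c) (x := y) (by omega)
      rw [← h5.1] at h8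
      have h9 := h5.2.ne_zero
      omega
    · rintro ⟨h3, ⟨h5, h6⟩, h4⟩
      have hx : 0 < x.1 := by
        by_contra hc
        have := lab_nonpos (c := c) (x := x) (by omega)
        omega
      have h7 := Subtype.coe_lt_coe.2 h3
      refine ⟨?_, ?_, h3, (hw.apply_lt_iff_lab h3).2 h4, h5⟩
      · rintro rfl; rw [SymInt.coe_origin] at hx; omega
      · rw [← Subtype.coe_le_coe, SymInt.coe_opp]; omega
  rcases hs with rfl | rfl
  · exact hpos
  · rw [hpos]
    have hside : ∀ x y s, SameOddSide c s x y → SameOddSide c (-s) y.opp x.opp := by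
      rintro x y s ⟨h1, h2⟩
      refine ⟨(symRel_sameOdd c).opp ((symRel_sameOdd c).swap h1), ?_⟩
      rw [lab_opp, SymInt.coe_opp, ← h1.1, neg_mul_neg]
      exact h2
    apply Finset.card_nbij' (fun p => (p.2.opp, p.1.opp)) (fun p => (p.2.opp, p.1.opp))
    · rintro ⟨x, y⟩
      simp only [Finset.coe_filter, Finset.mem_univ, true_and, Set.mem_ofPred_eq, Weyl.map_opp,
        lab_opp, SymInt.opp_lt_opp]
      rintro ⟨h1, h2, h3⟩
      exact ⟨h1, hside _ _ _ h2, h3⟩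
    · rintro ⟨x, y⟩
      simp only [Finset.coe_filter, Finset.mem_univ, true_and, Set.mem_ofPred_eq, Weyl.map_opp,
        lab_opp, SymInt.opp_lt_opp]
      rintro ⟨h1, h2, h3⟩
      exact ⟨h1, by simpa using hside _ _ _ h2, h3⟩
    · rintro ⟨x, y⟩ _; simp
    · rintro ⟨x, y⟩ _; simp

theorem lt_iff_le_of_succ {i i' : Idx m n} (h : i.1 + 1 = i'.1) (j : Idx m n) : j < i' ↔ j ≤ i := by
  rw [← Subtype.coe_lt_coe, ← Subtype.coe_le_coe]
  omega

/-- Comparison of the odd inversions of the two coset representatives: odd case. -/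
theorem IsStep.ninv_odd {a b c : Comp m n d} {z x : SymInt d} (h : IsStep a b z) {t y w : Weyl d}
    (hy : Inc (lab a) y) (hw : Inc (lab b) w)
    (hx : t.1 x = z) (hya : ∀ u, lab a (y.1 u) = lab a (t.1 u))
    (hwb : ∀ u, lab b (w.1 u) = lab b (t.1 u)) (hodd : IsOddIdx (lab c x)) :
    ninv (SameOdd c) w + Finset.card {u | u ≠ SymInt.origin d ∧ lab c u = lab c x ∧
        lab b (w.1 u) = lab b z ∧ u < x} =
      ninv (SameOdd c) y + Finset.card {u | u ≠ SymInt.origin d ∧ lab c u = lab c x ∧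
        lab a (y.1 u) = lab a z ∧ x < u} := by
  classical
  obtain ⟨s, hs, hsx⟩ : ∃ s : ℤ, (s = 1 ∨ s = -1) ∧ 0 < s * (lab c x).1 := by
    rcases lt_or_gt_of_ne hodd.ne_zero with h0 | h0
    · exact ⟨-1, Or.inr rfl, by omega⟩
    · exact ⟨1, Or.inl rfl, by omega⟩
  have hne : ∀ u, lab c u = lab c x → u ≠ SymInt.origin d := by
    rintro u hu rfl
    rw [lab_origin] at hu
    exact hodd.ne_zero (by rw [← hu, SymInt.coe_origin])
  -- On the side of `x` the two words of labels differ at `x` alone, as `-x` lies on the other side.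
  have hoff : ∀ u, 0 < s * (lab c u).1 → u ≠ x → lab b (w.1 u) = lab a (y.1 u) := by
    intro u hu hux
    rw [hya, hwb, h.agree]
    · rw [← hx, ne_eq, Weyl.apply_inj]; exact hux
    · rw [← hx, ← Weyl.map_opp, ne_eq, Weyl.apply_inj]
      rintro rfl
      rw [lab_opp, SymInt.coe_opp, mul_neg] at hu
      omega
  have key := card_inversions_step (E := SameOddSide c s) (L := fun u => lab b (w.1 u))
    (L' := fun u => lab a (y.1 u)) (x₀ := x) (i := lab a z) (i' := lab b z)
    (by simp only [hwb, hx]) (by simp only [hya, hx]) (lt_iff_le_of_succ h.step)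
    (fun u v huv hux => hoff u huv.2 hux)
    (fun u v huv hvx => hoff v (by rw [← huv.1.1]; exact huv.2) hvx)
  rw [← ninv_sameOdd_eq_card hw hs, ← ninv_sameOdd_eq_card hy hs] at key
  refine Eq.trans ?_ (key.trans ?_)
  · congr 2
    ext u
    simp only [Finset.mem_filter, Finset.mem_univ, true_and]
    simp only [SameOddSide, SameOdd]
    constructor
    · rintro ⟨h1, h2, h3, h4⟩
      exact ⟨h4, ⟨⟨h2, h2 ▸ hodd⟩, h2 ▸ hsx⟩, h3⟩
    · rintro ⟨h4, ⟨⟨h2, _⟩, _⟩, h3⟩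
      exact ⟨hne u h2, h2, h3, h4⟩
  · congr 2
    ext u
    simp only [Finset.mem_filter, Finset.mem_univ, true_and]
    simp only [SameOddSide, SameOdd]
    constructor
    · rintro ⟨h4, ⟨⟨h2, _⟩, _⟩, h3⟩
      exact ⟨hne u h2.symm, h2.symm, h3, h4⟩
    · rintro ⟨h1, h2, h3, h4⟩
      exact ⟨h4, ⟨⟨h2.symm, hodd⟩, hsx⟩, h3⟩

/-- Comparison of the odd inversions of the two coset representatives: even case. -/
theorem DifferAt.ninv_even {a b c : Comp m n d} {z x : SymInt d} (h : DifferAt a b z)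
    {t y w : Weyl d} (hy : Inc (lab a) y) (hw : Inc (lab b) w)
    (hx : t.1 x = z) (hya : ∀ u, lab a (y.1 u) = lab a (t.1 u))
    (hwb : ∀ u, lab b (w.1 u) = lab b (t.1 u)) (heven : ¬ IsOddIdx (lab c x)) :
    ninv (SameOdd c) w = ninv (SameOdd c) y := by
  have hoff : ∀ u, IsOddIdx (lab c u) → lab b (w.1 u) = lab a (y.1 u) := by
    intro u hu
    rw [hya, hwb, h.agree]
    · rw [← hx, ne_eq, Weyl.apply_inj]; rintro rfl; exact heven hu
    · rw [← hx, ← Weyl.map_opp, ne_eq, Weyl.apply_inj]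
      rintro rfl
      rw [lab_opp, IsOddIdx.opp] at hu
      exact heven hu
  apply ninv_congr_of
  intro u v huv
  rw [hw.apply_lt_iff_lab huv, hy.apply_lt_iff_lab huv]
  constructor
  · rintro ⟨h1, h2⟩
    rw [hoff u h2.2, hoff v (h2.1 ▸ h2.2)] at h1
    exact ⟨h1, h2⟩
  · rintro ⟨h1, h2⟩
    rw [← hoff u h2.2, ← hoff v (h2.1 ▸ h2.2)] at h1
    exact ⟨h1, h2⟩

/-! ### Counting along rows -/

/-- Split a count of elements beyond `x` into the blocks beyond that of `x` and the rest. -/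
theorem card_split {c : Comp m n d} {x : SymInt d} (P : SymInt d → Prop) [DecidablePred P]
    (R : SymInt d → Prop) [DecidablePred R] (RI : Idx m n → Prop) [DecidablePred RI]
    (h1 : ∀ u, R u → lab c u = lab c x ∨ RI (lab c u)) (h2 : ∀ u, RI (lab c u) → R u)
    (h3 : ¬ RI (lab c x)) :
    Finset.card {u | u ≠ SymInt.origin d ∧ P u ∧ R u} =
      ∑ j with RI j, Finset.card {u | u ≠ SymInt.origin d ∧ lab c u = j ∧ P u} +
      Finset.card {u | u ≠ SymInt.origin d ∧ lab c u = lab c x ∧ P u ∧ R u} := by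
  have e1 : ∑ j with RI j, Finset.card {u | u ≠ SymInt.origin d ∧ lab c u = j ∧ P u} =
      Finset.card {u | u ≠ SymInt.origin d ∧ P u ∧ RI (lab c u)} := by
    rw [Finset.card_eq_sum_card_fiberwise (f := lab c) (t := {j | RI j})]
    · refine Finset.sum_congr rfl fun j hj => ?_
      rw [Finset.filter_filter]
      congr 1
      ext u
      simp only [Finset.mem_filter, Finset.mem_univ, true_and] at hj ⊢
      constructor
      · rintro ⟨h4, rfl, h5⟩; exact ⟨⟨h4, h5, hj⟩, rfl⟩
      · rintro ⟨⟨h4, h5, _⟩, h6⟩; exact ⟨h4, h6, h5⟩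
    · intro u
      simp only [Finset.coe_filter, Finset.mem_univ, true_and, Set.mem_ofPred_eq]
      exact fun h => h.2.2
  rw [e1, ← Finset.card_union_of_disjoint]
  · congr 1
    ext u
    simp only [Finset.mem_union, Finset.mem_filter, Finset.mem_univ, true_and]
    constructor
    · rintro ⟨h4, h5, h6⟩
      rcases h1 u h6 with h7 | h7
      · exact Or.inr ⟨h4, h7, h5, h6⟩
      · exact Or.inl ⟨h4, h5, h7⟩
    · rintro (⟨h4, h5, h7⟩ | ⟨h4, h7, h5, h6⟩)
      · exact ⟨h4, h5, h2 u h7⟩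
      · exact ⟨h4, h5, h6⟩
  · rw [Finset.disjoint_left]
    intro u
    simp only [Finset.mem_filter, Finset.mem_univ, true_and]
    rintro ⟨_, _, h4⟩ ⟨_, h5, _⟩
    exact h3 (h5 ▸ h4)

/-- The entries of `κ`, with `0` removed from the central block. -/
theorem card_nonzero_kappa (a c : Comp m n d) (y : Weyl d) (i j : Idx m n) :
    Finset.card {u | u ≠ SymInt.origin d ∧ lab c u = j ∧ lab a (y.1 u) = i} +
      (if i.1 = 0 ∧ j.1 = 0 then 1 else 0) = kappa a y c i j := by
  classical
  rw [card_kappa]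
  split_ifs with h
  · have hi : i = SymInt.origin _ := Subtype.ext h.1
    have hj : j = SymInt.origin _ := Subtype.ext h.2
    subst hi hj
    rw [← Finset.card_erase_add_one (s := {x | lab c x = _ ∧ _}) (a := SymInt.origin d)]
    · congr 2
      ext u
      simp
    · simp [lab_origin]
  · rw [add_zero]
    congr 1
    ext u
    simp only [Finset.mem_filter, Finset.mem_univ, true_and]
    constructor
    · exact fun h => h.2
    · refine fun h' => ⟨?_, h'⟩
      rintro rfl
      rw [Weyl.apply_origin, lab_origin, lab_origin] at h'
      exact h ⟨by rw [← h'.2]; rfl, by rw [← h'.1]; rfl⟩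

theorem Etheta_apply (i k r s : Idx m n) : Etheta i k r s =
    (if i = r ∧ k = s then 1 else 0) + (if i.opp = r ∧ k.opp = s then 1 else 0) := by
  simp only [Etheta, Matrix.add_apply, Matrix.single_apply]

/-- Row `i` of the matrix of a coset that occurs in the product. -/
theorem card_nonzero_row {a c : Comp m n d} {y : Weyl d} {A : Matrix (Idx m n) (Idx m n) ℕ}
    {i i' k : Idx m n} (hi : 0 ≤ i.1) (hi' : 0 ≤ i'.1) (hne : i ≠ i')
    (h : toInt (kappa a y c) = toInt A + Etheta i k - Etheta i' k) (j : Idx m n) :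
    (Finset.card {u | u ≠ SymInt.origin d ∧ lab c u = j ∧ lab a (y.1 u) = i} : ℤ) =
      A i j + (if j = k then 1 else 0) + (if i.1 = 0 then ((if j = k.opp then 1 else 0) -
        (if j.1 = 0 then 1 else 0)) else 0) := by
  have h1 := card_nonzero_kappa a c y i j
  have h2 := congrFun (congrFun h i) j
  rw [Matrix.sub_apply, Matrix.add_apply, toInt_apply, toInt_apply, ← h1, Etheta_apply,
    Etheta_apply] at h2
  have e1 : ¬ (i'.opp = i) := by
    intro h; rw [Subtype.ext_iff, SymInt.coe_opp] at h
    exact hne (Subtype.ext (by omega))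
  have e2 : i.opp = i ↔ i.1 = 0 := by
    rw [Subtype.ext_iff, SymInt.coe_opp]; omega
  simp only [hne.symm, e1, e2, false_and, if_false, true_and, eq_comm (a := k), eq_comm (a := k.opp)] at h2
  push_cast at h2
  by_cases hi0 : i.1 = 0
  · simp only [hi0, true_and, if_true] at h2 ⊢
    linarith
  · simp only [hi0, false_and, if_false] at h2 ⊢
    linarith

/-- In row `0` the shift also adds a point in column `-k`, while the excluded origin is missing from
column `0`. These cancel, because `-k` lies beyond `k` exactly when `0` does. -/
theorem sum_nonzero_row {a c : Comp m n d} {y : Weyl d} {A : Matrix (Idx m n) (Idx m n) ℕ}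
    {i i' k : Idx m n} (hi : 0 ≤ i.1) (hi' : 0 ≤ i'.1) (hne : i ≠ i')
    (h : toInt (kappa a y c) = toInt A + Etheta i k - Etheta i' k) (RI : Idx m n → Prop)
    [DecidablePred RI] (hk : ¬ RI k) (hk' : RI k.opp ↔ RI (SymInt.origin (m + n))) :
    ∑ j with RI j, Finset.card {u | u ≠ SymInt.origin d ∧ lab c u = j ∧ lab a (y.1 u) = i} =
      ∑ j with RI j, A i j := by
  zify
  rw [Finset.sum_congr rfl fun j _ => card_nonzero_row hi hi' hne h j, Finset.sum_add_distrib,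
    Finset.sum_add_distrib]
  have e0 : ∀ j : Idx m n, j.1 = 0 ↔ j = SymInt.origin (m + n) := fun j => by
    rw [Subtype.ext_iff, SymInt.coe_origin]
  have e1 : ∑ j with RI j, (if j = k then (1 : ℤ) else 0) = 0 := by
    rw [Finset.sum_ite_eq', if_neg (by simpa using hk)]
  by_cases hi0 : i.1 = 0
  · simp only [hi0, if_true, e0]
    rw [Finset.sum_sub_distrib, e1, Finset.sum_ite_eq', Finset.sum_ite_eq']
    simp [hk']
  · simp only [hi0, if_false, Finset.sum_const_zero, e1, add_zero]

/-- The centre follows the general pattern: `E^θ_00` adds `2`, and leaving out the origin takes away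
`1`. -/
theorem card_nonzero_block {a c : Comp m n d} {y : Weyl d} {A : Matrix (Idx m n) (Idx m n) ℕ}
    {i i' k : Idx m n} (hi : 0 ≤ i.1) (hi' : 0 ≤ i'.1) (hne : i ≠ i')
    (h : toInt (kappa a y c) = toInt A + Etheta i k - Etheta i' k) :
    Finset.card {u | u ≠ SymInt.origin d ∧ lab c u = k ∧ lab a (y.1 u) = i} = A i k + 1 := by
  have h1 := card_nonzero_row hi hi' hne h k
  have e2 : k = k.opp ↔ k.1 = 0 := by
    rw [Subtype.ext_iff, SymInt.coe_opp]; omega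
  simp only [if_true, e2, sub_self, ite_self, add_zero] at h1
  exact_mod_cast h1

theorem sum_pow_card_lt {α M : Type*} [LinearOrder α] [CommRing M] (s : Finset α) (r : M) :
    ∑ x ∈ s, r ^ Finset.card {u ∈ s | u < x} = ∑ t ∈ Finset.range s.card, r ^ t := by
  induction s using Finset.induction_on_max with
  | empty => simp
  | insert x s hx ih =>
    have hxs : x ∉ s := fun h => (hx x h).false
    rw [Finset.sum_insert hxs, Finset.card_insert_of_notMem hxs, Finset.sum_range_succ, ← ih, add_comm]
    congr 1
    · refine Finset.sum_congr rfl fun y hy => ?_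
      rw [Finset.filter_insert, if_neg (hx y hy).asymm]
    · rw [Finset.filter_insert, if_neg (lt_irrefl x), Finset.filter_true_of_mem hx]

theorem sum_pow_card_gt {α M : Type*} [LinearOrder α] [CommRing M] (s : Finset α) (r : M) :
    ∑ x ∈ s, r ^ Finset.card {u ∈ s | x < u} = ∑ t ∈ Finset.range s.card, r ^ t :=
  sum_pow_card_lt (α := αᵒᵈ) s r

/-! ### The product formula -/

/-- `R` and `RI` are the strict orders of `[-d..d]` and `𝕀`, or both are the reversed orders. -/
def OrderPair (m n d : ℕ) (R : SymInt d → SymInt d → Prop) (RI : Idx m n → Idx m n → Prop) :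
    Prop :=
  ((∀ x u, R x u ↔ x < u) ∧ ∀ k j, RI k j ↔ k < j) ∨ ((∀ x u, R x u ↔ u < x) ∧ ∀ k j, RI k j ↔ j < k)

namespace OrderPair
variable {R : SymInt d → SymInt d → Prop} {RI : Idx m n → Idx m n → Prop}

theorem swap (h : OrderPair m n d R RI) : OrderPair m n d (fun x u => R u x) (fun k j => RI j k) := by
  rcases h with h | h
  · exact Or.inr ⟨fun x u => h.1 u x, fun k j => h.2 j k⟩
  · exact Or.inl ⟨fun x u => h.1 u x, fun k j => h.2 j k⟩

theorem lab_or (h : OrderPair m n d R RI) (c : Comp m n d) {x u : SymInt d} (hxu : R x u) :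
    lab c u = lab c x ∨ RI (lab c x) (lab c u) := by
  rcases h with h | h
  · rw [h.1] at hxu
    rw [h.2]
    exact (lab_mono c hxu.le).eq_or_lt.imp_left Eq.symm
  · rw [h.1] at hxu
    rw [h.2]
    exact (lab_mono c hxu.le).eq_or_lt

theorem of_lab (h : OrderPair m n d R RI) (c : Comp m n d) {x u : SymInt d}
    (hxu : RI (lab c x) (lab c u)) : R x u := by
  rcases h with h | h
  · rw [h.2] at hxu
    rw [h.1]
    exact lt_of_not_ge fun hc => (lab_mono c hc).not_gt hxu
  · rw [h.2] at hxu
    rw [h.1]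
    exact lt_of_not_ge fun hc => (lab_mono c hc).not_gt hxu

theorem irrefl_idx (h : OrderPair m n d R RI) (k : Idx m n) : ¬ RI k k := by
  rcases h with h | h <;> rw [h.2] <;> exact lt_irrefl k

theorem irrefl (h : OrderPair m n d R RI) (x : SymInt d) : ¬ R x x := by
  rcases h with h | h <;> rw [h.1] <;> exact lt_irrefl x

theorem opp_iff (h : OrderPair m n d R RI) (k : Idx m n) :
    RI k k.opp ↔ RI k (SymInt.origin (m + n)) := by
  rcases h with h | h <;>
    rw [h.2, h.2, ← Subtype.coe_lt_coe, ← Subtype.coe_lt_coe, SymInt.coe_opp, SymInt.coe_origin] <;>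
    omega

open Classical in
theorem sum_pow (h : OrderPair m n d R RI) (s : Finset (SymInt d)) (r : ℤ[T;T⁻¹]) :
    ∑ x ∈ s, r ^ Finset.card {u ∈ s | R x u} = qint r s.card := by
  rcases h with h | h
  · simp only [h.1]
    rw [qint, ← sum_pow_card_gt]
  · simp only [h.1]
    rw [qint, ← sum_pow_card_lt]

end OrderPair

theorem qdot_of_odd {i : Idx m n} (h : IsOddIdx i) : qdot i = -qinv := if_pos h

theorem qdot_of_even {i : Idx m n} (h : ¬ IsOddIdx i) : qdot i = 1 := if_neg h

theorem qddot_mul_qdot_of_iff {i k : Idx m n} (h : IsOddIdx i ↔ IsOddIdx k) :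
    qddot i * qdot k = qb i := by
  unfold qddot qdot qb
  by_cases hi : IsOddIdx i
  · rw [if_pos hi, if_pos (h.1 hi), if_pos hi, neg_mul_neg, one_mul]
  · rw [if_neg hi, if_neg fun hk => hi (h.2 hk), if_neg hi, mul_one]

/-- The base `-1` encodes the parity condition: `[1] = 1` for a new entry `1`, and `[2] = 0` for a
forbidden entry `2`. -/
theorem qddot_mul_qdot_of_not_iff {i k : Idx m n} (h : ¬ (IsOddIdx i ↔ IsOddIdx k)) :
    qddot i * qdot k = -1 := by
  unfold qddot qdot
  by_cases hi : IsOddIdx i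
  · have hk : ¬ IsOddIdx k := fun hk => h ⟨fun _ => hk, fun _ => hi⟩
    rw [if_pos hi, if_neg hk, mul_one]
  · have hk : IsOddIdx k := by_contra fun hk => h ⟨fun h' => absurd h' hi, fun h' => absurd h' hk⟩
    rw [if_neg hi, if_pos hk, mul_neg, q_mul_qinv]

open Classical in
/-- The weights of the two factorizations of an element, in the notation of
`DifferAt.xy_mul_cosetSum_mul`: the first factors are weighted by counts beyond `x`, and the odd
inversions of the second factors differ by such counts. -/
def StepWeights (a b c : Comp m n d) (z : SymInt d) (R : SymInt d → SymInt d → Prop) : Prop :=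
  ∀ t w p y x, Pres (lab b) t → Inc (lab a) t → Inc (lab b) w → Pres (lab a) p →
    Inc (lab b) p → Inc (lab a) y → p * y = t * w → (t * w).1 x = z →
    charWt a p = qddot (lab a z) ^ Finset.card {u | u ≠ SymInt.origin d ∧
        lab a (y.1 u) = lab a z ∧ R x u} ∧
    signWt b t = qdot (lab b z) ^ Finset.card {u | u ≠ SymInt.origin d ∧
        lab b (w.1 u) = lab b z ∧ R u x} ∧
    (IsOddIdx (lab c x) →
      ninv (SameOdd c) w + Finset.card {u | u ≠ SymInt.origin d ∧ lab c u = lab c x ∧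
        lab b (w.1 u) = lab b z ∧ R u x} =
      ninv (SameOdd c) y + Finset.card {u | u ≠ SymInt.origin d ∧ lab c u = lab c x ∧
        lab a (y.1 u) = lab a z ∧ R x u})

theorem lab_factor {a : Comp m n d} {p y v : Weyl d} (hp : Pres (lab a) p) (he : p * y = v)
    (u : SymInt d) : lab a (y.1 u) = lab a (v.1 u) := by
  rw [← he, Weyl.mul_apply, hp]

theorem IsStep.stepWeights {a b : Comp m n d} {z : SymInt d} (h : IsStep a b z) (c : Comp m n d) :
    StepWeights a b c z (fun x u => x < u) := by
  intro t w p y x ht hta hw hp hpb hy he hx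
  refine ⟨?_, ?_, fun ho => ?_⟩
  · rw [(h.wt_left hp hpb hy (he ▸ hx)).2]
    congr!
  · rw [(h.wt_right ht hta hw hx).1]
    congr!
  · convert h.ninv_odd (t := t * w) hy hw hx (lab_factor hp he) (lab_factor ht rfl) ho

/-- When the label of `z` is lower in `b`, `z` is the first point of its `a`-block and the last of
its `b`-block, so all counts are taken on the opposite side of `x`. -/
theorem IsStep.stepWeights_symm {a b : Comp m n d} {z : SymInt d} (h : IsStep b a z)
    (c : Comp m n d) : StepWeights a b c z (fun x u => u < x) := by
  intro t w p y x ht hta hw hp hpb hy he hx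
  refine ⟨?_, ?_, fun ho => ?_⟩
  · rw [(h.wt_right hp hpb hy (he ▸ hx)).2]
    congr!
  · rw [(h.wt_left ht hta hw hx).1]
    congr!
  · convert (h.ninv_odd (t := t * w) hw hy hx (lab_factor ht rfl) (lab_factor hp he) ho).symm

section Weight
variable {a b c : Comp m n d} {z : SymInt d} {R : SymInt d → SymInt d → Prop}
  {RI : Idx m n → Idx m n → Prop} {A : Matrix (Idx m n) (Idx m n) ℕ}

open Classical in
/-- The weight of a term of the product. -/
theorem StepWeights.weight_eq (hS : StepWeights a b c z R) (h : DifferAt a b z)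
    (hR : OrderPair m n d R RI) (hA : ParityBound A) {t w p y : Weyl d} {x : SymInt d}
    (ht : Pres (lab b) t) (hta : Inc (lab a) t) (hw : Inc (lab b) w) (hp : Pres (lab a) p)
    (hpb : Inc (lab b) p) (hy : Inc (lab a) y) (he : p * y = t * w) (hx : (t * w).1 x = z)
    (hwA : kappa b w c = A) :
    signWt b t * signWt c w * charWt a p =
      qdot (lab b z) ^ (∑ j with RI j (lab c x), A (lab b z) j) *
        qddot (lab a z) ^ (∑ j with RI (lab c x) j, A (lab a z) j) *
        (qddot (lab a z) * qdot (lab c x)) ^ Finset.card {u | u ≠ SymInt.origin d ∧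
          lab c u = lab c x ∧ lab a (y.1 u) = lab a z ∧ R x u} * signWt c y := by
  obtain ⟨h1, h2, h3⟩ := hS t w p y x ht hta hw hp hpb hy he hx
  have hyM : toInt (kappa a y c) = toInt A + Etheta (lab a z) (lab c x) -
      Etheta (lab b z) (lab c x) := by
    rw [← hwA, ← kappa_mul_left (g := w) ht, ← h.kappa_eq hx, ← he, kappa_mul_left hp]
  rw [h1, h2, card_split (c := c) (x := x) _ _ (RI (lab c x)) (fun u => hR.lab_or c)
    (fun u => hR.of_lab c) (hR.irrefl_idx _),
    card_split (c := c) (x := x) _ (fun u => R u x) (fun j => RI j (lab c x))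
    (fun u => hR.swap.lab_or c) (fun u => hR.swap.of_lab c) (hR.irrefl_idx _),
    sum_nonzero_row (lab_nonneg h.pos.le) (lab_nonneg h.pos.le) h.ne hyM _ (hR.irrefl_idx _)
      (hR.opp_iff _)]
  have hrow : qdot (lab b z) ^ (∑ j with RI j (lab c x), Finset.card {u | u ≠ SymInt.origin d ∧
      lab c u = j ∧ lab b (w.1 u) = lab b z}) =
      qdot (lab b z) ^ (∑ j with RI j (lab c x), A (lab b z) j) := by
    -- In an even row `qdot` is `1`, so the origin missing from the count in row `0` does no harm.
    by_cases ho : IsOddIdx (lab b z)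
    · congr 1
      refine Finset.sum_congr rfl fun j _ => ?_
      have := card_nonzero_kappa b c w (lab b z) j
      rw [if_neg fun h0 => ho.ne_zero h0.1, add_zero, hwA] at this
      convert this
    · rw [qdot_of_even ho, one_pow, one_pow]
  rw [pow_add, hrow]
  set e := Finset.card {u | u ≠ SymInt.origin d ∧ lab c u = lab c x ∧
        lab b (w.1 u) = lab b z ∧ R u x} with he_def
  -- For mixed parity the entry of `A` at this cell is at most `1`, and `x` already occupies it.
  have he0 : ¬ (IsOddIdx (lab b z) ↔ IsOddIdx (lab c x)) → e = 0 := by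
    intro hpar
    have h4 := hA _ _ hpar
    rw [← hwA, card_kappa, Finset.card_le_one] at h4
    rw [he_def, Finset.card_eq_zero, Finset.filter_eq_empty_iff]
    rintro u _ ⟨_, h5, h6, h7⟩
    have h8 : u = x := h4 u (by simp [h5, h6]) x (by
      simp [(lab_factor ht rfl x).trans (congrArg (lab b) hx)])
    exact hR.irrefl x (h8 ▸ h7)
  unfold signWt
  by_cases hk : IsOddIdx (lab c x)
  · have h4 := h3 hk
    rw [qdot_of_odd hk, mul_pow, pow_add]
    generalize Finset.card {u | u ≠ SymInt.origin d ∧ lab c u = lab c x ∧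
      lab a (y.1 u) = lab a z ∧ R x u} = s at *
    -- The contribution `e` of `t` from the column of `x` makes up for the change in odd inversions
    -- from `w` to `y`, which leaves only the exponent `s`.
    have h5 : qdot (lab b z) ^ e * (-qinv) ^ ninv (SameOdd c) w =
        (-qinv) ^ s * (-qinv) ^ ninv (SameOdd c) y := by
      by_cases ho : IsOddIdx (lab b z)
      · rw [qdot_of_odd ho, ← pow_add, ← pow_add, add_comm e, h4, add_comm]
      · have := he0 fun h6 => ho (h6.2 hk)
        rw [this, add_zero] at h4
        rw [this, pow_zero, one_mul, h4, ← pow_add, add_comm]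
    linear_combination (qdot (lab b z) ^ (∑ j with RI j (lab c x), A (lab b z) j) *
      qddot (lab a z) ^ (∑ j with RI (lab c x) j, A (lab a z) j) * qddot (lab a z) ^ s) * h5
  · have h4 := h.ninv_even (t := t * w) hy hw hx (lab_factor hp he) (lab_factor ht rfl) hk
    rw [h4, qdot_of_even hk, mul_one, pow_add]
    have h5 : qdot (lab b z) ^ e = 1 := by
      by_cases ho : IsOddIdx (lab b z)
      · rw [he0 fun h6 => hk (h6.1 ho), pow_zero]
      · rw [qdot_of_even ho, one_pow]
    rw [h5]
    ring

/-- The coefficients of the product, uniformly in the parities. -/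
noncomputable def stepCoeff (A : Matrix (Idx m n) (Idx m n) ℕ) (RI : Idx m n → Idx m n → Prop)
    [∀ k j, Decidable (RI k j)] (i i' k : Idx m n) : ℤ[T;T⁻¹] :=
  qdot i' ^ (∑ j with RI j k, A i' j) * qddot i ^ (∑ j with RI k j, A i j)

-- For fixed `k` and `y`, the exponents counting the points beyond `x` in its cell run through `0,
-- …, A i k` as `x` varies, with `i = lab a z`, so the inner sum is a quantum integer.
open Classical in
theorem StepWeights.xy_mul (hS : StepWeights a b c z R) (h : DifferAt a b z)
    (hR : OrderPair m n d R RI) [∀ k j, Decidable (RI k j)] (hA : ParityBound A) :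
    xy a * (cosetSum a (toInt (kappa a 1 b)) b * cosetSum b (toInt A) c) =
      xy a * ∑ k, (stepCoeff A RI (lab a z) (lab b z) k *
          qint (qddot (lab a z) * qdot k) (A (lab a z) k + 1)) •
        cosetSum a (toInt A + Etheta (lab a z) k - Etheta (lab b z) k) c := by
  rw [h.xy_mul_cosetSum_mul A _ fun t w p y x ht hta hw hp hpb hy he hx hwA =>
    hS.weight_eq h hR hA ht hta hw hp hpb hy he hx hwA, Finset.mul_sum]
  refine Finset.sum_congr rfl fun k _ => ?_
  rw [cosetSum, Finset.smul_sum, Finset.mul_sum]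
  refine Finset.sum_congr rfl fun y hy => ?_
  rw [mem_minReps] at hy
  rw [smul_smul, mul_smul_comm, ← Finset.sum_smul]
  congr 1
  rw [← card_nonzero_block (lab_nonneg h.pos.le) (lab_nonneg h.pos.le) h.ne hy.2, ← hR.sum_pow,
    Finset.mul_sum, Finset.sum_mul]
  refine Finset.sum_congr (by congr!) fun x hx => ?_
  simp only [Finset.mem_filter, Finset.mem_univ, true_and] at hx
  rw [hx.2.1, stepCoeff, Finset.filter_filter]
  simp only [and_assoc]
  congr!

end Weight

/-! ### The matrices that occur in the product -/

theorem SymInt.eq_opp_iff {N : ℕ} {x y : SymInt N} : x = y.opp ↔ x.opp = y := by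
  rw [Subtype.ext_iff, Subtype.ext_iff, SymInt.coe_opp, SymInt.coe_opp]
  omega

theorem Etheta_opp (i k r s : Idx m n) : Etheta i k r.opp s.opp = Etheta i k r s := by
  rw [Etheta_apply, Etheta_apply, add_comm]
  simp only [SymInt.eq_opp_iff, SymInt.opp_opp]

theorem Etheta_nonneg (i k r s : Idx m n) : 0 ≤ Etheta i k r s := by
  rw [Etheta_apply]
  split_ifs <;> norm_num

theorem sum_Etheta_row (i k r : Idx m n) : ∑ s, Etheta i k r s =
    (if i = r then 1 else 0) + (if i.opp = r then 1 else 0) := by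
  simp [Etheta_apply, Finset.sum_add_distrib, ite_and]

theorem sum_Etheta_col (i k s : Idx m n) : ∑ r, Etheta i k r s =
    (if k = s then 1 else 0) + (if k.opp = s then 1 else 0) := by
  simp [Etheta_apply, Finset.sum_add_distrib, ite_and]

theorem Etheta_self {i k : Idx m n} (h : i.1 ≠ 0 ∨ k.1 ≠ 0) : Etheta i k i k = 1 := by
  rw [Etheta_apply, if_pos ⟨rfl, rfl⟩, if_neg, add_zero]
  rintro ⟨h1, h2⟩
  rw [Subtype.ext_iff, SymInt.coe_opp] at h1 h2
  omega

theorem Etheta_eq_zero {i i' k s : Idx m n} (hi : 0 ≤ i.1) (hi' : 0 ≤ i'.1) (hne : i ≠ i') :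
    Etheta i' k i s = 0 := by
  have h1 : ¬ i'.opp = i := by
    intro h
    rw [Subtype.ext_iff, SymInt.coe_opp] at h
    exact hne (Subtype.ext (by omega))
  simp [Etheta_apply, hne.symm, h1]

theorem ne_zero_of_not_iff {i k : Idx m n} (h : ¬ (IsOddIdx i ↔ IsOddIdx k)) :
    i.1 ≠ 0 ∨ k.1 ≠ 0 := by
  by_contra! hc
  exact h ⟨fun h' => absurd hc.1 h'.ne_zero, fun h' => absurd hc.2 h'.ne_zero⟩

theorem qint_one (p : ℤ[T;T⁻¹]) : qint p 1 = 1 := by simp [qint]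

theorem qint_neg_one_two : qint (-1) 2 = 0 := by simp [qint, Finset.sum_range_succ]

section Shift
variable {a b c : Comp m n d} {z : SymInt d} {A : Matrix (Idx m n) (Idx m n) ℕ} {g : Weyl d}

theorem DifferAt.sum_row (h : DifferAt a b z) (hA : A = kappa b g c) (k r : Idx m n) :
    ∑ s, (toInt A + Etheta (lab a z) k - Etheta (lab b z) k) r s =
      Finset.card {x | lab a x = r} := by
  -- The matrix `κ(a, g, c)` is the shift in the column of `g⁻¹ z`, which may differ from `k`; row
  -- sums of `Etheta` do not depend on the column.
  have h1 := h.kappa_eq (c := c) (g.apply_inv_self z)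
  rw [← sum_kappa_row a c g r]
  push_cast
  simp only [← toInt_apply, h1, hA, Matrix.sub_apply, Matrix.add_apply, Finset.sum_sub_distrib,
    Finset.sum_add_distrib, sum_Etheta_row]

theorem DifferAt.sum_col (hA : A = kappa b g c) (i i' k s : Idx m n) :
    ∑ r, (toInt A + Etheta i k - Etheta i' k) r s = Finset.card {x | lab c x = s} := by
  rw [← sum_kappa_col b c g s]
  push_cast
  simp only [hA, toInt_apply, Matrix.sub_apply, Matrix.add_apply, Finset.sum_sub_distrib,
    Finset.sum_add_distrib, sum_Etheta_col, add_sub_cancel_right]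

theorem sum_shift (hA : A ∈ Xi m n d) (i i' k : Idx m n) :
    ∑ r, ∑ s, (toInt A + Etheta i k - Etheta i' k) r s = 2 * d + 1 := by
  have h1 : ∑ r, ∑ s, (A r s : ℤ) = 2 * d + 1 := by exact_mod_cast hA.1
  simp only [toInt_apply, Matrix.sub_apply, Matrix.add_apply, Finset.sum_sub_distrib,
    Finset.sum_add_distrib, sum_Etheta_row, h1]
  simp

theorem shift_opp (hA : A ∈ Xi m n d) (i i' k r s : Idx m n) :
    (toInt A + Etheta i k - Etheta i' k) r.opp s.opp = (toInt A + Etheta i k - Etheta i' k) r s := by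
  simp only [toInt_apply, Matrix.sub_apply, Matrix.add_apply, Etheta_opp, ← hA.2.1 r s]

/-- If a coset has the shifted matrix, but this matrix is not in `Ξ`, then the shift violates the
parity condition at the entry `(i, k)`. -/
theorem entry_of_not_mem_Xi {y : Weyl d} {i i' k : Idx m n} (hA : A ∈ Xi m n d)
    (hy : toInt (kappa a y c) = toInt A + Etheta i k - Etheta i' k) (hXi : kappa a y c ∉ Xi m n d) :
    ¬ (IsOddIdx i ↔ IsOddIdx k) ∧ A i k = 1 := by
  have hs : ∑ r, ∑ s, kappa a y c r s = 2 * d + 1 := by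
    have := sum_shift hA i i' k
    rw [← hy] at this
    simp only [toInt_apply] at this
    exact_mod_cast this
  have ho : ∀ r s, kappa a y c r s = kappa a y c r.opp s.opp := by
    intro r s
    have := shift_opp hA i i' k r s
    rw [← hy] at this
    simp only [toInt_apply] at this
    exact_mod_cast this.symm
  -- The total and the symmetry survive the shift, so only the parity condition can fail.
  have h3 : ∃ r s, ¬ (IsOddIdx r ↔ IsOddIdx s) ∧ 2 ≤ kappa a y c r s := by
    by_contra hc
    refine hXi ⟨hs, ho, fun r s hrs => ?_⟩
    by_contra h4
    exact hc ⟨r, s, hrs, by omega⟩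
  obtain ⟨r, s, hrs, h2⟩ := h3
  have h4 := congrFun (congrFun hy r) s
  rw [Matrix.sub_apply, Matrix.add_apply, toInt_apply, toInt_apply] at h4
  have h5 := Etheta_nonneg i' k r s
  have h6 := parityBound_of_mem_Xi hA r s hrs
  have h7 : (i = r ∧ k = s) ∨ (i.opp = r ∧ k.opp = s) := by
    by_contra! hc
    rw [Etheta_apply i k, if_neg fun h => hc.1 h.1 h.2, if_neg fun h => hc.2 h.1 h.2] at h4
    omega
  rcases h7 with ⟨rfl, rfl⟩ | ⟨rfl, rfl⟩
  · rw [Etheta_self (ne_zero_of_not_iff hrs)] at h4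
    exact ⟨hrs, by omega⟩
  · rw [IsOddIdx.opp, IsOddIdx.opp] at hrs
    rw [Etheta_opp i, Etheta_self (ne_zero_of_not_iff hrs)] at h4
    rw [← hA.2.1] at h4 h6
    exact ⟨hrs, by omega⟩

theorem eInt_eq_zero {M : Matrix (Idx m n) (Idx m n) ℤ}
    (h : ¬ ((∀ r s, 0 ≤ M r s) ∧ M.map Int.toNat ∈ Xi m n d)) : (eInt M : Schur m n d) = 0 := by
  unfold eInt
  split_ifs with h0
  · exact dif_neg fun h1 => h ⟨h0, h1.1⟩
  · rfl

-- The uniform base may be replaced by `𝐪`: for equal parity they agree, and for mixed parity inside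
-- `Ξ` the old entry is `0`, so both integers are `[1]`. Outside `Ξ`, either there is no coset with
-- this matrix or the coefficient is `[2]` to the base `-1`, which is `0`.
open Classical in
theorem DifferAt.smul_eInt_apply (h : DifferAt a b z) (hA : A ∈ Xi m n d) (hAg : A = kappa b g c)
    (k : Idx m n) (C : ℤ[T;T⁻¹]) (c' : Comp m n d) (x : Hecke d) :
    (C * qint (qb (lab a z)) (A (lab a z) k + 1)) •
        eInt (toInt A + Etheta (lab a z) k - Etheta (lab b z) k) (inSummand c' x) =
      if c = c' then inSummand a ((C * qint (qddot (lab a z) * qdot k) (A (lab a z) k + 1)) •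
        cosetSum a (toInt A + Etheta (lab a z) k - Etheta (lab b z) k) c * x) else 0 := by
  by_cases hM : (∀ r s, 0 ≤ (toInt A + Etheta (lab a z) k - Etheta (lab b z) k) r s) ∧
      (toInt A + Etheta (lab a z) k - Etheta (lab b z) k).map Int.toNat ∈ Xi m n d
  · rw [eInt_apply hM.1 hM.2 (h.sum_row hAg k) (DifferAt.sum_col hAg _ _ k), smul_ite, smul_zero]
    congr 1
    rw [smul_mul_assoc, inSummand_smul]
    congr 2
    by_cases hp : IsOddIdx (lab a z) ↔ IsOddIdx k
    · rw [qddot_mul_qdot_of_iff hp]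
    · have h1 := parityBound_of_mem_Xi hM.2 _ _ hp
      rw [Matrix.map_apply, Matrix.sub_apply, Matrix.add_apply, toInt_apply,
        Etheta_self (ne_zero_of_not_iff hp),
        Etheta_eq_zero (lab_nonneg h.pos.le) (lab_nonneg h.pos.le) h.ne] at h1
      have h2 : A (lab a z) k = 0 := by omega
      rw [h2, zero_add, qint_one, qint_one]
  · rw [eInt_eq_zero hM, LinearMap.zero_apply, smul_zero]
    rcases (minReps a (toInt A + Etheta (lab a z) k - Etheta (lab b z) k) c).eq_empty_or_nonempty
      with he | ⟨y, hy⟩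
    · rw [cosetSum, he, Finset.sum_empty, smul_zero, zero_mul, inSummand_zero, ite_self]
    · rw [mem_minReps] at hy
      have h1 : kappa a y c ∉ Xi m n d := by
        intro hXi
        rw [← hy.2] at hM
        refine hM ⟨fun r s => by simp [toInt_apply], ?_⟩
        convert hXi
        ext r s
        simp [toInt_apply]
      obtain ⟨h2, h3⟩ := entry_of_not_mem_Xi hA hy.2 h1
      rw [h3, qddot_mul_qdot_of_not_iff h2, qint_neg_one_two, mul_zero, zero_smul, zero_mul,
        inSummand_zero, ite_self]

theorem StepWeights.e_mul_e {R : SymInt d → SymInt d → Prop} {RI : Idx m n → Idx m n → Prop}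
    [∀ k j, Decidable (RI k j)] (hS : StepWeights a b c z R) (h : DifferAt a b z)
    (hR : OrderPair m n d R RI) (hB : kappa a 1 b ∈ Xi m n d) (hA : A ∈ Xi m n d)
    (hAg : A = kappa b g c) : (e (kappa a 1 b) * e A : Schur m n d) =
      ∑ k, (stepCoeff A RI (lab a z) (lab b z) k * qint (qb (lab a z)) (A (lab a z) k + 1)) •
        eInt (toInt A + Etheta (lab a z) k - Etheta (lab b z) k) := by
  classical
  apply schur_ext
  intro c' x
  have h1 : e A (inSummand c' x) =
      if c = c' then inSummand b (cosetSum b (toInt A) c * x) else 0 := by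
    rw [hAg] at hA ⊢
    exact e_apply hA c' x
  rw [Module.End.mul_apply, h1, LinearMap.sum_apply]
  simp only [LinearMap.smul_apply, h.smul_eInt_apply hA hAg]
  split_ifs with hc
  · rw [e_apply hB, if_pos rfl, ← inSummand_sum]
    apply inSummand_congr
    rw [← Finset.sum_mul, ← mul_assoc, ← mul_assoc, ← mul_assoc (xy a)]
    exact congrArg (· * x) ((mul_assoc _ _ _).trans (hS.xy_mul h hR (parityBound_of_mem_Xi hA)))
  · simp

end Shift

/-- The entry `1` of the matrix at `(i, i')` supplies the single point `z`; any other point whose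
label changes would produce a further off-diagonal entry, apart from the mirror image `-z`. -/
theorem exists_differAt {a b : Comp m n d} {i i' : Idx m n} (hi : 0 ≤ i.1) (hi' : 0 ≤ i'.1)
    (hne : i ≠ i') (hD : (toInt (kappa a 1 b) - Etheta i i').IsDiag) :
    ∃ z, DifferAt a b z ∧ lab a z = i ∧ lab b z = i' := by
  classical
  have hD' : ∀ r s, r ≠ s → (Finset.card {x | lab b x = s ∧ lab a x = r} : ℤ) = Etheta i i' r s := by
    intro r s hrs
    have : (toInt (kappa a 1 b) - Etheta i i') r s = 0 := hD hrs
    rw [Matrix.sub_apply, toInt_apply, sub_eq_zero, card_kappa] at this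
    exact this
  have h1 : i.1 ≠ 0 ∨ i'.1 ≠ 0 := by
    by_contra! hc
    exact hne (Subtype.ext (hc.1.trans hc.2.symm))
  have h2 := hD' i i' hne
  rw [Etheta_self h1] at h2
  obtain ⟨z, hz⟩ := Finset.card_eq_one.1 (by exact_mod_cast h2)
  have hz' : ∀ x, lab b x = i' → lab a x = i → x = z := by
    intro x hb ha
    have : x ∈ ({z} : Finset (SymInt d)) := hz ▸ (by simp [hb, ha])
    simpa using this
  have hmem : z ∈ ({x | lab b x = i' ∧ lab a x = i} : Finset (SymInt d)) := by rw [hz]; simp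
  rw [Finset.mem_filter] at hmem
  obtain ⟨_, hzb, hza⟩ := hmem
  refine ⟨z, ⟨?_, fun x hx hx' => ?_, by rwa [hza, hzb]⟩, hza, hzb⟩
  -- For `z ≤ 0` both labels would be nonpositive, hence both `0`, contrary to `i ≠ i'`.
  · by_contra hc
    have h3 := lab_nonpos (c := a) (x := z) (by omega)
    have h4 := lab_nonpos (c := b) (x := z) (by omega)
    rw [hza] at h3
    rw [hzb] at h4
    omega
  · by_contra hc
    have h3 := hD' _ _ hc
    have h4 : 0 < Finset.card {u | lab b u = lab b x ∧ lab a u = lab a x} :=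
      Finset.card_pos.2 ⟨x, by simp⟩
    have h5 : (i = lab a x ∧ i' = lab b x) ∨ (i.opp = lab a x ∧ i'.opp = lab b x) := by
      by_contra! hc
      rw [Etheta_apply, if_neg fun h => hc.1 h.1 h.2, if_neg fun h => hc.2 h.1 h.2] at h3
      omega
    rcases h5 with ⟨h6, h7⟩ | ⟨h6, h7⟩
    · exact hx (hz' x h7.symm h6.symm)
    · refine hx' (SymInt.eq_opp_iff.2 (hz' _ ?_ ?_))
      · rw [lab_opp, ← h7, SymInt.opp_opp]
      · rw [lab_opp, ← h6, SymInt.opp_opp]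

/-! ### The central coefficient -/

/-- Negation of both indices pairs off all other entries, and the total `2d + 1` is odd. -/
theorem odd_central {A : Matrix (Idx m n) (Idx m n) ℕ} (hA : A ∈ Xi m n d) {i : Idx m n}
    (hi : i.1 = 0) : Odd (A i i) := by
  classical
  have hii : i.opp = i := by
    rw [Subtype.ext_iff, SymInt.coe_opp, hi, neg_zero]
  have h1 : ∑ p ∈ Finset.univ.erase (i, i), (A p.1 p.2 : ZMod 2) = 0 := by
    apply Finset.sum_involution fun p _ => (p.1.opp, p.2.opp)
    · rintro ⟨r, s⟩ _
      simp only [← hA.2.1]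
      exact CharTwo.add_self_eq_zero _
    · rintro ⟨r, s⟩ h _ he
      simp only [Prod.mk.injEq, Subtype.ext_iff, SymInt.coe_opp] at he
      simp only [Finset.mem_erase, ne_eq, Prod.mk.injEq, Subtype.ext_iff] at h
      omega
    · rintro ⟨r, s⟩ _
      simp
    · rintro ⟨r, s⟩ h
      simp only [Finset.mem_erase, ne_eq, Prod.mk.injEq, Finset.mem_univ, and_true] at h ⊢
      rwa [← SymInt.eq_opp_iff, ← SymInt.eq_opp_iff, hii]
  have h2 : ∑ p : Idx m n × Idx m n, (A p.1 p.2 : ZMod 2) = 1 := by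
    rw [Fintype.sum_prod_type]
    have := congrArg (Nat.cast : ℕ → ZMod 2) hA.1
    push_cast at this
    rw [this, show (2 : ZMod 2) = 0 from rfl]
    ring
  rw [← Finset.add_sum_erase _ _ (Finset.mem_univ (i, i)), h1, add_zero] at h2
  rw [← Nat.not_even_iff_odd, ← ZMod.natCast_eq_zero_iff_even]
  simp only at h2
  rw [h2]
  exact one_ne_zero

/-- Since `[r]_q (q^r + 1) = [2r]_q`, the exceptional central coefficient is the general one. -/
theorem cint_eq_qint {b : ℕ} (h : Even b) : cint b = qint q b := by
  obtain ⟨r, rfl⟩ := h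
  rw [cint, show (r + r) / 2 = r by omega, qint, qint, Finset.sum_range_add]
  simp only [pow_add, ← Finset.mul_sum]
  ring

end IotaSchur

/-! ### Assembly of the two multiplication formulas -/

open IotaSchur

theorem proposition3p4 (m n d : ℕ) (hd : 0 < d)
    (μ ν : Comp m n d) (g : Weyl d) (hg : g ∈ doubleReps μ ν)
    (A : Matrix (Idx m n) (Idx m n) ℕ) (hA : A ∈ Xi m n d) (hAg : A = kappa μ g ν)
    (h h' : Idx m n) (hh : 0 ≤ h.1) (hh' : h'.1 = h.1 + 1) :
    (∀ (lam : Comp m n d) (B : Matrix (Idx m n) (Idx m n) ℕ),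
      B ∈ Xi m n d → B = kappa lam 1 μ → (toInt B - Etheta h h').IsDiag →
        (h.1 ≠ 0 →
          (e B * e A : Schur m n d) =
            ∑ k, (qdot h' ^ (∑ j with j < k, A h' j) * qddot h ^ (∑ j with k < j, A h j) *
                qint (qb h) (A h k + 1)) •
              eInt (toInt A + Etheta h k - Etheta h' k)) ∧
        (h.1 = 0 →
          (e B * e A : Schur m n d) =
            (qdot h' ^ (∑ j with j < h, A h' j) * qddot h ^ (∑ j with h < j, A h j) *
                cint (A h h + 1)) •
              eInt (toInt A + Etheta h h - Etheta h' h) +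
            ∑ k with k ≠ h,
              (qdot h' ^ (∑ j with j < k, A h' j) * qddot h ^ (∑ j with k < j, A h j) *
                  qint (qb h) (A h k + 1)) •
                eInt (toInt A + Etheta h k - Etheta h' k))) ∧
    (∀ (lam' : Comp m n d) (C : Matrix (Idx m n) (Idx m n) ℕ),
      C ∈ Xi m n d → C = kappa lam' 1 μ → (toInt C - Etheta h' h).IsDiag →
        (e C * e A : Schur m n d) =
          ∑ k, (qdot h ^ (∑ j with k < j, A h j) * qddot h' ^ (∑ j with j < k, A h' j) *
              qint (qb h') (A h' k + 1)) •
            eInt (toInt A - Etheta h k + Etheta h' k)) := by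
  have hne : h ≠ h' := fun he => by rw [he] at hh'; omega
  constructor
  · rintro lam B hB rfl hD
    obtain ⟨z, hz, rfl, rfl⟩ := exists_differAt hh (by omega) hne hD
    have hs : IsStep lam μ z := ⟨hz.pos, hz.agree, hh'.symm⟩
    have key := (hs.stepWeights ν).e_mul_e (RI := fun k j => k < j) hz
      (Or.inl ⟨fun _ _ => Iff.rfl, fun _ _ => Iff.rfl⟩) hB hA hAg
    refine ⟨fun _ => key, fun h0 => ?_⟩
    -- For `h = 0` the formula is the same sum with the term `k = h` split off; `a_00 + 1` is even,
    -- so its coefficient can be rewritten with `cint`.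
    rw [key, ← Finset.add_sum_erase _ _ (Finset.mem_univ (lab lam z)),
      cint_eq_qint (odd_central hA h0).add_one,
      show qb (lab lam z) = q from if_neg fun ho => ho.ne_zero h0,
      Finset.filter_ne' Finset.univ (lab lam z)]
    rfl
  · rintro lam' C hC rfl hD
    obtain ⟨z, hz, rfl, rfl⟩ := exists_differAt (by omega) hh hne.symm hD
    -- Here the label of `z` drops from `h + 1` in `lam'` to `h` in `μ` when read from the left
    -- factor, so the roles of the two rows are exchanged and the order is reversed.
    have hs : IsStep μ lam' z := ⟨hz.pos, hz.symm.agree, hh'.symm⟩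
    rw [(hs.stepWeights_symm ν).e_mul_e (RI := fun k j => j < k) hz
      (Or.inr ⟨fun _ _ => Iff.rfl, fun _ _ => Iff.rfl⟩) hC hA hAg]
    refine Finset.sum_congr rfl fun k _ => ?_
    rw [sub_add_eq_add_sub]
    rfl
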